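/- Let $C_2>0$, $1<\gamma\le 2$, $\lambda>0$, and consider the autonomous system in $(\Sigma,K,u,w)$ $$\begin{aligned} \Sigma'&=\tfrac{(3\gamma-2)(C_2\Sigma^2+K+u^2-w^2-1)}{2(\gamma-1)C_2}+2C_2\Sigma^3+\tfrac{w^2}{C_2}+\Sigma(K+2u^2-2),\\ K'&=2K(2C_2\Sigma^2+K+2u^2-1),\\ u'&=u(2C_2\Sigma^2+K+2u^2-2)-\tfrac{\sqrt2\,w^2}{\lambda},\\ w'&=w\bigl(2C_2\Sigma^2+K+\Sigma+2u^2-\tfrac{\sqrt2\,u}{\lambda}\bigr), \end{aligned}$$ (the reduced system on the invariant set $A=v=0$ with scalar field), with $\Omega_t=(1-C_2\Sigma^2-K-u^2+w^2)/(\gamma-1)$. Since the field is polynomial it extends to $\mathbb C^4$. Equilibria whose formula contains the square root of a negative number are understood in $\mathbb C^4$, with the principal square root (only $w$ can be non-real, and then it is purely imaginary). Eigenvalues are those of the linearization at the point, with multiplicity. An equilibrium is a sink (source) if all eigenvalues have negative (positive) real part, a saddle if no eigenvalue has zero real part and both signs occur, and non-hyperbolic if some eigenvalue has zero real part. On a curve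 of equilibria these notions are applied to the eigenvalues other than one eigenvalue $0$, which belongs to the tangent direction of the curve (transverse eigenvalues); the curve is normally hyperbolic at a point if no transverse eigenvalue there has zero real part. Then the following hold. **Enumeration.** Every real equilibrium with $K,u,w\ge0$ is one of the points $N_1$, $L(\Sigma_0)$, $P_{13}$, $P_{14}$, $P_{13}(\lambda)$, $P_{14}(\lambda)$, $P_{15}(\lambda)$ below. All of these are equilibria. **$N_1=(0,1,0,0)$**: $\Omega_t=0$, eigenvalues $-1,-1,1,2$; a saddle. **$L(\Sigma_0)=\bigl(\Sigma_0,0,\sqrt{1-C_2\Sigma_0^2},0\bigr)$, $C_2\Sigma_0^2\le1$**: $\Omega_t=0$. The curve contains $P_{11}=(-1/\sqrt{C_2},0,0,0)$ and $P_{12}=(1/\sqrt{C_2},0,0,0)$. The eigenvalues are $0$, $\frac{(3\gamma-2)\Sigma_0}{\gamma-1}+4$, $-\frac{\sqrt{2-2C_2\Sigma_0^2}}{\lambda}+\Sigma_0+2$, $2$. The velocity $\bigl(1,0,-\frac{C_2\Sigma_0}{\sqrt{1-C_2\Sigma_0^2}},0\bigr)$ (for $C_2\Sigma_0^2<1$)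 and the null eigenvector $\bigl(-\frac{\sqrt{1-C_2\Sigma_0^2}}{C_2\Sigma_0},0,1,0\bigr)$ (for $\Sigma_0\ne0$) are both parallel to the tangent direction $\bigl(\sqrt{1-C_2\Sigma_0^2},0,-C_2\Sigma_0,0\bigr)$, which is non-zero and lies in the kernel of the linearization. $L$ is normally hyperbolic exactly at the points where the second and third eigenvalues are non-zero. Write $\ell=\sqrt2\sqrt{\frac{1-C_2\Sigma_0^2}{(\Sigma_0+2)^2}}$ and $\gamma_*=\frac{2\Sigma_0+4}{3\Sigma_0+4}$. *$L$ is a source* if one of the following holds: (1) $C_2>0$, $\Sigma_0=\frac1{\sqrt{C_2}}$, $\lambda>0$, $1<\gamma<2$; (2) $C_2>1$, $\Sigma_0=-\frac1{\sqrt{C_2}}$, $\lambda>0$, $\gamma_*<\gamma<2$; (3) $C_2>1$, $0<\Sigma_0<\frac1{\sqrt{C_2}}$, $\lambda>\ell$, $1<\gamma<2$; (4) $C_2>0$, $0<\Sigma_0<\frac1{\sqrt{C_2}}$, $\lambda>\ell$, $1<\gamma<2$; (5) $C_2>1$, $-\frac1{\sqrt{C_2}}<\Sigma_0\le0$, $\lambda>\ell$,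 $\gamma_*<\gamma<2$; (6) $0<C_2\le1$, $-1<\Sigma_0\le0$, $\lambda>\ell$, $\gamma_*<\gamma<2$. *$L$ is a saddle* if one of the following holds: (1) $0<C_2\le\frac14$, $-2<\Sigma_0\le-1$, $\lambda>\ell$, $1<\gamma<2$; (2) $0<C_2\le\frac14$, $-1<\Sigma_0<0$, $\lambda>\ell$, $1<\gamma<\gamma_*$; (3) $\frac14<C_2\le1$, $\Sigma_0=-\frac1{\sqrt{C_2}}$, $\lambda>0$, $1<\gamma<2$; (4) $\frac14<C_2<1$, $-\frac1{\sqrt{C_2}}<\Sigma_0\le-1$, $\lambda>\ell$, $1<\gamma<2$; (5) $\frac14<C_2\le1$, $-1<\Sigma_0<0$, $\lambda>\ell$, $1<\gamma<\gamma_*$; (6) $C_2>1$, $\Sigma_0=-\frac1{\sqrt{C_2}}$, $\lambda>0$, $1<\gamma<\gamma_*$; (7) $C_2>1$, $-\frac1{\sqrt{C_2}}<\Sigma_0<0$, $\lambda>\ell$, $1<\gamma<\gamma_*$; (8) $0<C_2\le1$, $0<\Sigma_0<\frac1{\sqrt{C_2}}$, $0<\lambda<\ell$, $1<\gamma<2$;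 (9) $0<C_2\le1$, $-1<\Sigma_0\le0$, $0<\lambda<\ell$, $\gamma_*<\gamma<2$; (10) $C_2>1$, $0<\Sigma_0<\frac1{\sqrt{C_2}}$, $0<\lambda<\ell$, $1<\gamma<2$; (11) $C_2>1$, $-\frac1{\sqrt{C_2}}<\Sigma_0\le0$, $0<\lambda<\ell$, $\gamma_*<\gamma<2$; (12) $0<C_2<\frac14$, $-\frac1{\sqrt{C_2}}\le\Sigma_0\le-2$, $\lambda>0$, $1<\gamma<2$; (13) $0<C_2<\frac14$, $-1<\Sigma_0<0$, $0<\lambda<\ell$, $1<\gamma<\gamma_*$; (14) $0<C_2<\frac14$, $-2<\Sigma_0\le-1$, $0<\lambda<\ell$, $1<\gamma<2$; (15) $\frac14\le C_2<1$, $-\frac1{\sqrt{C_2}}<\Sigma_0\le-1$, $0<\lambda<\ell$, $1<\gamma<2$; (16) $\frac14\le C_2\le1$, $-1<\Sigma_0<0$, $0<\lambda<\ell$, $1<\gamma<\gamma_*$; (17) $C_2>1$, $-\frac1{\sqrt{C_2}}<\Sigma_0<0$, $0<\lambda<\ell$, $1<\gamma<\gamma_*$. *$L$ is non-hyperbolic*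 if one of the following holds: (1) $0<C_2<\frac14$, $-1<\Sigma_0<0$, $\gamma=\gamma_*$, $0<\lambda<\ell$; (2) $0<C_2<\frac14$, $-1<\Sigma_0<0$, $\gamma=\gamma_*$, $\lambda>\ell$; (3) $0<C_2<\frac14$, $-1<\Sigma_0<0$, $\lambda=\ell$, $1<\gamma<2$; (4) $0<C_2<\frac14$, $-2<\Sigma_0\le-1$, $\lambda=\ell$, $1<\gamma<2$; (5) $0<C_2<\frac14$, $0\le\Sigma_0<\frac1{\sqrt{C_2}}$, $\lambda=\ell$, $1<\gamma<2$; (6) $C_2=\frac14$, $-1<\Sigma_0<0$, $\gamma=\gamma_*$, $0<\lambda<\sqrt{\frac2{\Sigma_0+2}-\frac12}$; (7) $C_2=\frac14$, $-1<\Sigma_0<0$, $\gamma=\gamma_*$, $2\lambda>\sqrt{\frac8{\Sigma_0+2}-2}$; (8) $C_2=\frac14$, $-1<\Sigma_0<0$, $\gamma=\gamma_*$, $2\lambda=\sqrt{\frac8{\Sigma_0+2}-2}$, $1<\gamma<2$; (9) $C_2=\frac14$, $-2<\Sigma_0\le-1$, $2\lambda=\sqrt{\frac8{\Sigma_0+2}-2}$,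 $1<\gamma<2$; (10) $C_2=\frac14$, $0\le\Sigma_0<2$, $2\lambda=\sqrt{\frac8{\Sigma_0+2}-2}$, $1<\gamma<2$; (11) $C_2=\frac14$, $\Sigma_0=-2$, $\lambda>0$, $1<\gamma<2$; (12) $\frac14<C_2\le1$, $-1<\Sigma_0<0$, $\gamma=\gamma_*$, $0<\lambda<\ell$; (13) $\frac14<C_2\le1$, $-1<\Sigma_0<0$, $\gamma=\gamma_*$, $\lambda>\ell$; (14) $\frac14<C_2\le1$, $-1<\Sigma_0<0$, $\lambda=\ell$, $1<\gamma<2$; (15) $\frac14<C_2\le1$, $0\le\Sigma_0<\frac1{\sqrt{C_2}}$, $\lambda=\ell$, $1<\gamma<2$; (16) $\frac14<C_2\le1$, $-\frac1{\sqrt{C_2}}<\Sigma_0\le-1$, $\lambda=\ell$, $1<\gamma<2$; (17) $C_2>1$, $\Sigma_0=-\frac1{\sqrt{C_2}}$, $\gamma=\gamma_*$, $\lambda>0$; (18) $C_2>1$, $-\frac1{\sqrt{C_2}}<\Sigma_0<0$, $\gamma=\gamma_*$, $0<\lambda<\ell$; (19) $C_2>1$, $-\frac1{\sqrt{C_2}}<\Sigma_0<0$,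 $\gamma=\gamma_*$, $\lambda>\ell$; (20) $C_2>1$, $0\le\Sigma_0<\frac1{\sqrt{C_2}}$, $\lambda=\ell$, $1<\gamma<2$; (21) $C_2>1$, $-\frac1{\sqrt{C_2}}<\Sigma_0<0$, $\lambda=\ell$, $1<\gamma<2$. **$P_{13}=\bigl(\frac{2-3\gamma}{4(\gamma-1)C_2},0,0,0\bigr)$**: $\Omega_t=\frac1{\gamma-1}-\frac{(2-3\gamma)^2}{16(\gamma-1)^3C_2}$; eigenvalues $\frac{\gamma(3\gamma-2)}{8(\gamma-1)^2C_2}$, $\frac{(2-3\gamma)^2}{8(\gamma-1)^2C_2}-2$ (twice), $\frac{(2-3\gamma)^2}{4(\gamma-1)^2C_2}-2$. **$P_{14}=\bigl(-\frac{2(\gamma-1)}{3\gamma-2},1-\frac{8(\gamma-1)^2C_2}{(2-3\gamma)^2},0,0\bigr)$**: $\Omega_t=\frac{4(\gamma-1)C_2}{(2-3\gamma)^2}$; eigenvalues $-1$, $\frac{\gamma}{3\gamma-2}$, $-\frac12\pm\frac{\sqrt{64(\gamma-1)^2C_2-7(2-3\gamma)^2}}{2(3\gamma-2)}$. **$P_{13}(\lambda)$**.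 Put $D=8C_2(\gamma-1)^2+\gamma^2\lambda^2$ and $q=4-16C_2(\gamma-1)^2-\gamma(\gamma(2\lambda^2-9)+12)$. Then $$P_{13}(\lambda)=\Bigl(-\tfrac{2(\gamma-1)(3\gamma-2)}{D},\,0,\,\tfrac{\gamma(3\gamma-2)\lambda}{\sqrt2D},\,\tfrac{\sqrt\gamma\sqrt{3\gamma-2}\,\lambda\sqrt q}{\sqrt2D}\Bigr),\qquad \Omega_t=\tfrac{(\gamma\lambda^2-4(\gamma-1)C_2)\,q}{D^2}.$$ It tends to $P_{13}$ as $\lambda\to0^+$. Its eigenvalues are $-2+\frac{(2-3\gamma)^2}{D}$, $-2+\frac{2(2-3\gamma)^2}{D}$ and $\frac{(\gamma-1)C_2Dq\pm\sqrt\Delta}{2(\gamma-1)C_2D^2}$, where $$\Delta=-(\gamma-1)C_2D^2q\bigl(2\gamma^2(3\gamma-2)\lambda^2+(\gamma-1)C_2(-4+\gamma(28+\gamma(2\lambda^2-33))+16(\gamma-1)^2C_2)\bigr).$$ Write $\lambda_0=2\sqrt{\frac{(\gamma-1)C_2}{\gamma}}$, $\lambda_S=\sqrt{\frac{(2-3\gamma)^2-8(\gamma-1)^2C_2}{\gamma^2}}$,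 $\lambda_X=\frac12\sqrt{\frac{2(2-3\gamma)^2-32(\gamma-1)^2C_2}{\gamma^2}}$, $\gamma_4=\frac{4C_2-2}{4C_2-3}$, $\gamma_8=\frac{8C_2-2}{8C_2-3}$, $\gamma_T=\frac{2(4C_2-3)}{8C_2-9}+2\sqrt2\sqrt{\frac{C_2}{(8C_2-9)^2}}$, $\gamma_U=\frac{2(8C_2-3)}{16C_2-9}+4\sqrt{\frac{C_2}{(16C_2-9)^2}}$. *Sink* if one of: (1) $1<C_2\le2$, $\gamma_4<\gamma<2$, $\lambda_S<\lambda<\lambda_0$; (2) $C_2>2$, $\gamma_4<\gamma<\gamma_T$, $\lambda_S<\lambda<\lambda_0$; (3) $C_2>2$, $\gamma_T\le\gamma<2$, $0<\lambda<\lambda_0$. *Source* if one of: (1) $0<C_2\le\frac12$, $1<\gamma<2$, $\lambda_0<\lambda<\lambda_X$; (2) $C_2>\frac12$, $1<\gamma<\gamma_8$, $\lambda_0<\lambda<\lambda_X$. *Non-hyperbolic* if one of: (1) $C_2>\frac12$, $1<\gamma<\gamma_8$, $\lambda=\lambda_0$; (2) $C_2>\frac12$, $\gamma_8<\gamma<2$,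 $\lambda=\lambda_0$; (3) $C_2>1$, $1<\gamma<\gamma_U$, $\lambda=\lambda_S$; (4) $C_2>2$, $1<\gamma<\gamma_T$, $\lambda=\lambda_S$; (5) $0<C_2\le\frac12$, $1<\gamma<2$, $\lambda=\lambda_0$; (6) $0<C_2\le1$, $1<\gamma<2$, $\lambda=\lambda_S$; (7) $0<C_2\le2$, $1<\gamma<2$, $\lambda=\lambda_S$. *Saddle* if one of: (1) $0<C_2\le\frac12$, $1<\gamma<2$, $0<\lambda<\lambda_0$; (2) $0<C_2\le\frac12$, $1<\gamma<2$, $\lambda_X<\lambda<\lambda_S$; (3) $0<C_2\le\frac12$, $1<\gamma<2$, $\lambda>\lambda_S$; (4) $\frac12<C_2\le1$, $1<\gamma\le\gamma_8$, $0<\lambda<\lambda_0$; (5) $\frac12<C_2\le1$, $1<\gamma<\gamma_8$, $\lambda_X<\lambda<\lambda_S$; (6) $\frac12<C_2\le1$, $1<\gamma<\gamma_8$, $\lambda>\lambda_S$; (7) $\frac12<C_2\le1$, $\gamma_8<\gamma<2$, $0<\lambda<\lambda_S$, $\lambda\ne\lambda_X$, $\lambda\ne\lambda_0$; (8) $\frac12<C_2\le1$,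 $\gamma_8\le\gamma<2$, $\lambda>\lambda_0$, $\lambda\ne\lambda_S$; (9) $C_2>1$, $1<\gamma\le\gamma_8$, $0<\lambda<\lambda_0$; (10) $C_2>1$, $1<\gamma<\gamma_8$, $\lambda_X<\lambda<\lambda_S$; (11) $C_2>1$, $1<\gamma<\gamma_8$, $\lambda>\lambda_S$; (12) $C_2>1$, $\gamma_8<\gamma<\gamma_U$, $0<\lambda<\lambda_S$, $\lambda\ne\lambda_X$, $\lambda\ne\lambda_0$; (13) $C_2>1$, $\gamma_8\le\gamma<\gamma_U$, $\lambda>\lambda_0$, $\lambda\ne\lambda_S$; (14) $C_2>1$, $\gamma_U\le\gamma<2$, $\lambda>\lambda_0$. **$P_{14}(\lambda)=\Bigl(-\frac{2(\gamma-1)}{3\gamma-2},\frac{4-8C_2(\gamma-1)^2-\gamma(\gamma(\lambda^2-9)+12)}{(2-3\gamma)^2},\frac{\gamma\lambda}{\sqrt2(3\gamma-2)},\frac{\lambda}{\sqrt{4/\gamma-6}}\Bigr)$**: $\Omega_t=\frac{4(\gamma-1)C_2-\gamma\lambda^2}{(2-3\gamma)^2}$; it tends to $P_{14}$ as $\lambda\to0^+$.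 **$P_{15}(\lambda)=\Bigl(-\frac1{2C_2},0,\frac1{\sqrt2\lambda},\frac{\sqrt{\lambda^2+(2-4\lambda^2)C_2}}{2\lambda\sqrt{C_2}}\Bigr)$**: $\Omega_t=0$; eigenvalues $\frac1{C_2}+\frac2{\lambda^2}-2$, $\frac{\gamma}{2C_2-2\gamma C_2}+\frac2{\lambda^2}$, $\frac1{2C_2}+\frac1{\lambda^2}-2$ (twice). Write $\lambda_A=\sqrt2\sqrt{\frac{C_2}{2C_2-1}}$, $\lambda_B=\sqrt2\sqrt{\frac{C_2}{4C_2-1}}$. *Sink* if one of: (1) $\frac12<C_2\le1$, $1<\gamma<2$, $\lambda>\lambda_A$; (2) $C_2>1$, $1<\gamma\le\gamma_4$, $\lambda>\lambda_A$; (3) $C_2>1$, $\gamma_4<\gamma<2$, $\lambda>\lambda_0$. *Source* if one of: (1) $0<C_2\le\frac12$, $1<\gamma<2$, $0<\lambda<\lambda_0$; (2) $C_2>\frac12$, $1<\gamma\le\gamma_8$, $0<\lambda<\lambda_0$; (3) $C_2>\frac12$, $\gamma_8<\gamma<2$, $0<\lambda<\lambda_B$. *Non-hyperbolic* if one of: (1)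 $0<C_2\le\frac14$, $1<\gamma<2$, $\lambda=\lambda_0$; (2) $\frac14<C_2\le\frac12$, $1<\gamma<2$, $\lambda=\lambda_0$ or $\lambda=\lambda_B$; (3) $\frac12<C_2\le1$, $\gamma=\gamma_8$, $\lambda=\lambda_B$ or $\lambda=\lambda_A$; (4) $\frac12<C_2\le1$, $\gamma_8<\gamma<2$ or $1<\gamma<\gamma_8$, $\lambda=\lambda_0$ or $\lambda=\lambda_B$ or $\lambda=\lambda_A$; (5) $C_2>1$, $\gamma=\gamma_4$ or $\gamma=\gamma_8$, $\lambda=\lambda_B$ or $\lambda=\lambda_A$; (6) $C_2>1$, $\gamma_4<\gamma<2$ or $\gamma_8<\gamma<\gamma_4$ or $1<\gamma<\gamma_8$, $\lambda=\lambda_0$ or $\lambda=\lambda_B$ or $\lambda=\lambda_A$. *Saddle* if one of: (1) $\frac12<C_2\le1$, $\gamma_8<\gamma<2$, $\lambda_B<\lambda<\lambda_0$; (2) $C_2>1$, $\gamma_4<\gamma<2$, $\lambda_B<\lambda<\lambda_A$; (3) $C_2>1$, $\gamma_8<\gamma\le\gamma_4$, $\lambda_B<\lambda<\lambda_0$; (4)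 $0<C_2\le\frac14$, $1<\gamma<2$, $\lambda>\lambda_0$; (5) $\frac14<C_2\le\frac12$, $1<\gamma<2$, $\lambda_0<\lambda<\lambda_B$; (6) $C_2>\frac12$, $1<\gamma<\gamma_8$, $\lambda_0<\lambda<\lambda_B$; (7) $\frac14<C_2\le\frac12$, $1<\gamma<2$, $\lambda>\lambda_B$; (8) $\frac12<C_2\le1$, $\gamma_8<\gamma<2$, $\lambda_0<\lambda<\lambda_A$; (9) $\frac12<C_2\le1$, $1<\gamma\le\gamma_8$, $\lambda_B<\lambda<\lambda_A$; (10) $C_2>1$, $\gamma_8<\gamma<\gamma_4$, $\lambda_0<\lambda<\lambda_A$; (11) $C_2>1$, $1<\gamma\le\gamma_8$, $\lambda_B<\lambda<\lambda_A$; (12) $C_2>1$, $\gamma_4<\gamma<2$, $\lambda_A<\lambda<\lambda_0$. -/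

import Mathlib

open Filter Topology

namespace AetherScalar

noncomputable section

/-! ### The reduced dynamical system

Phase-space points are vectors `x = (Σ, K, u, w)`, i.e. `x 0 = Σ`, `x 1 = K`, `x 2 = u`, `x 3 = w`;
the parameters are `C = C₂`, `g = γ`, `l = λ`. -/

/-- The vector field of the reduced system over a field `𝕜`; `r` stands for `√2`. -/
def reducedField {𝕜 : Type*} [Field 𝕜] (r C g l : 𝕜) (x : Fin 4 → 𝕜) : Fin 4 → 𝕜 :=
  ![(3 * g - 2) * (C * x 0 ^ 2 + x 1 + x 2 ^ 2 - x 3 ^ 2 - 1) / (2 * (g - 1) * C)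
      + 2 * C * x 0 ^ 3 + x 3 ^ 2 / C + x 0 * (x 1 + 2 * x 2 ^ 2 - 2),
    2 * x 1 * (2 * C * x 0 ^ 2 + x 1 + 2 * x 2 ^ 2 - 1),
    x 2 * (2 * C * x 0 ^ 2 + x 1 + 2 * x 2 ^ 2 - 2) - r * x 3 ^ 2 / l,
    x 3 * (2 * C * x 0 ^ 2 + x 1 + x 0 + 2 * x 2 ^ 2 - r * x 2 / l)]

/-- The reduced system on real phase space. -/
def realField (C g l : ℝ) : (Fin 4 → ℝ) → (Fin 4 → ℝ) :=
  reducedField (√2) C g l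

/-- The same (polynomial) system on complexified phase space. It is needed because some of the
equilibrium points have a purely imaginary coordinate `w` for part of the parameter values. -/
def complexField (C g l : ℝ) : (Fin 4 → ℂ) → (Fin 4 → ℂ) :=
  reducedField ((√2 : ℝ) : ℂ) (C : ℂ) (g : ℂ) (l : ℂ)

/-- A real point viewed as a point of complexified phase space. -/
def toComplex (p : Fin 4 → ℝ) : Fin 4 → ℂ := fun i => (p i : ℂ)

/-- `Ω_t`, obtained by solving the constraint `C Σ² + K + u² - (1 - γ) Ω_t - w² = 1`. -/
def omegaT (C g : ℝ) (x : Fin 4 → ℂ) : ℂ :=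
  (1 - C * x 0 ^ 2 - x 1 - x 2 ^ 2 + x 3 ^ 2) / (g - 1)

/-! ### Linearization and classification of equilibrium points -/

/-- The linearization (Jacobian) matrix of a vector field at a point. -/
def jacobian {𝕜 : Type*} [NontriviallyNormedField 𝕜]
    (f : (Fin 4 → 𝕜) → (Fin 4 → 𝕜)) (p : Fin 4 → 𝕜) : Matrix (Fin 4) (Fin 4) 𝕜 :=
  LinearMap.toMatrix' (fderiv 𝕜 f p : (Fin 4 → 𝕜) →ₗ[𝕜] (Fin 4 → 𝕜))

/-- The Jacobian matrix of the reduced system, entry by entry. -/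
def reducedJacobian {𝕜 : Type*} [Field 𝕜] (r C g l : 𝕜) (x : Fin 4 → 𝕜) :
    Matrix (Fin 4) (Fin 4) 𝕜 :=
  !![(3 * g - 2) * (2 * C * x 0) / (2 * (g - 1) * C) + 6 * C * x 0 ^ 2 + x 1 + 2 * x 2 ^ 2 - 2,
      (3 * g - 2) / (2 * (g - 1) * C) + x 0,
      (3 * g - 2) * (2 * x 2) / (2 * (g - 1) * C) + 4 * x 0 * x 2,
      -((3 * g - 2) * (2 * x 3)) / (2 * (g - 1) * C) + 2 * x 3 / C;
    8 * C * x 0 * x 1, 4 * C * x 0 ^ 2 + 4 * x 1 + 4 * x 2 ^ 2 - 2, 8 * x 1 * x 2, 0;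
    4 * C * x 0 * x 2, x 2, 2 * C * x 0 ^ 2 + x 1 + 6 * x 2 ^ 2 - 2, -(2 * r * x 3) / l;
    x 3 * (4 * C * x 0 + 1), x 3, x 3 * (4 * x 2 - r / l),
      2 * C * x 0 ^ 2 + x 1 + x 0 + 2 * x 2 ^ 2 - r * x 2 / l]

theorem jacobian_reducedField {𝕜 : Type*} [RCLike 𝕜] (r C g l : 𝕜)
    (p : Fin 4 → 𝕜) :
    jacobian (reducedField r C g l) p = reducedJacobian r C g l p := by
  have hp : ∀ i : Fin 4, HasFDerivAt (fun x : Fin 4 → 𝕜 => x i)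
      (ContinuousLinearMap.proj (R := 𝕜) (φ := fun _ : Fin 4 => 𝕜) i) p :=
    fun i => hasFDerivAt_apply i p
  have h0 := hp 0
  have h1 := hp 1
  have h2 := hp 2
  have h3 := hp 3
  have key : HasFDerivAt (reducedField r C g l)
      (LinearMap.toContinuousLinearMap (Matrix.toLin' (reducedJacobian r C g l p))) p := by
    rw [hasFDerivAt_pi']
    intro i
    fin_cases i
    · refine HasFDerivAt.congr_fderiv (f := fun x : Fin 4 → 𝕜 => reducedField r C g l x 0) (by
        simp only [reducedField, Matrix.cons_val, div_eq_mul_inv]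
        exact (((((((((h0.pow 2).const_mul C).add h1).add (h2.pow 2)).sub (h3.pow 2)).sub_const 1).const_mul (3 * g - 2)).mul_const (2 * (g - 1) * C)⁻¹).add ((h0.pow 3).const_mul (2 * C))).add ((h3.pow 2).mul_const C⁻¹) |>.add (h0.mul ((h1.add ((h2.pow 2).const_mul 2)).sub_const 2))) ?_
      ext v
      simp [reducedJacobian, Matrix.toLin'_apply, dotProduct, Fin.sum_univ_four, div_eq_mul_inv,
        -mul_inv_rev]
      generalize (2 * (g - 1) * C)⁻¹ = q
      ring
    · refine HasFDerivAt.congr_fderiv (f := fun x : Fin 4 → 𝕜 => reducedField r C g l x 1) (by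
        simp only [reducedField, Matrix.cons_val, div_eq_mul_inv]
        exact (h1.const_mul 2).mul (((((h0.pow 2).const_mul (2 * C)).add h1).add ((h2.pow 2).const_mul 2)).sub_const 1)) ?_
      ext v
      simp [reducedJacobian, Matrix.toLin'_apply, dotProduct, Fin.sum_univ_four]
      ring
    · refine HasFDerivAt.congr_fderiv (f := fun x : Fin 4 → 𝕜 => reducedField r C g l x 2) (by
        simp only [reducedField, Matrix.cons_val, div_eq_mul_inv]
        exact (h2.mul (((((h0.pow 2).const_mul (2 * C)).add h1).add ((h2.pow 2).const_mul 2)).sub_const 2)).sub (((h3.pow 2).const_mul r).mul_const l⁻¹)) ?_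
      ext v
      simp [reducedJacobian, Matrix.toLin'_apply, dotProduct, Fin.sum_univ_four]
      ring
    · refine HasFDerivAt.congr_fderiv (f := fun x : Fin 4 → 𝕜 => reducedField r C g l x 3) (by
        simp only [reducedField, Matrix.cons_val, div_eq_mul_inv]
        exact h3.mul ((((((h0.pow 2).const_mul (2 * C)).add h1).add h0).add ((h2.pow 2).const_mul 2)).sub ((h2.const_mul r).mul_const l⁻¹))) ?_
      ext v
      simp [reducedJacobian, Matrix.toLin'_apply, dotProduct, Fin.sum_univ_four]
      ring
  rw [jacobian, key.fderiv]
  simp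

/-- At a real point the linearization of the complexified system is that of the real system. -/
theorem jacobian_toComplex (C g l : ℝ) (p : Fin 4 → ℝ) :
    jacobian (complexField C g l) (toComplex p) =
      (jacobian (realField C g l) p).map Complex.ofReal := by
  rw [complexField, realField, jacobian_reducedField, jacobian_reducedField]
  ext i j
  fin_cases i <;> fin_cases j <;> simp [reducedJacobian, toComplex]

/-- On real points the complexified system is the real one. -/
theorem complexField_toComplex (C g l : ℝ) (p : Fin 4 → ℝ) :
    complexField C g l (toComplex p) = toComplex (realField C g l p) := by
  ext i
  fin_cases i <;> simp [complexField, realField, reducedField, toComplex]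

/-- The eigenvalues, with algebraic multiplicity, of the linearization at `p`. -/
def eigenvalues (C g l : ℝ) (p : Fin 4 → ℂ) : Multiset ℂ :=
  (jacobian (complexField C g l) p).charpoly.roots

/-- Sink: an equilibrium at which all eigenvalues have negative real part. -/
def IsSink (C g l : ℝ) (p : Fin 4 → ℂ) : Prop :=
  complexField C g l p = 0 ∧ ∀ z ∈ eigenvalues C g l p, z.re < 0

/-- Source: an equilibrium at which all eigenvalues have positive real part. -/
def IsSource (C g l : ℝ) (p : Fin 4 → ℂ) : Prop :=
  complexField C g l p = 0 ∧ ∀ z ∈ eigenvalues C g l p, 0 < z.re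

/-- Saddle: a hyperbolic equilibrium with eigenvalues on both sides of the imaginary axis. -/
def IsSaddle (C g l : ℝ) (p : Fin 4 → ℂ) : Prop :=
  complexField C g l p = 0 ∧ (∀ z ∈ eigenvalues C g l p, z.re ≠ 0) ∧
    (∃ z ∈ eigenvalues C g l p, 0 < z.re) ∧ ∃ z ∈ eigenvalues C g l p, z.re < 0

/-- Non-hyperbolic: an equilibrium with an eigenvalue of zero real part. -/
def IsNonhyperbolic (C g l : ℝ) (p : Fin 4 → ℂ) : Prop :=
  complexField C g l p = 0 ∧ ∃ z ∈ eigenvalues C g l p, z.re = 0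

/-! For a point of a curve of equilibria, one eigenvalue `0` belongs to the tangent direction of the
curve; the classification uses the three remaining (transverse) eigenvalues. -/

/-- Eigenvalues that remain after removing one zero eigenvalue. -/
def transverseEigenvalues (C g l : ℝ) (p : Fin 4 → ℝ) : Multiset ℂ :=
  (eigenvalues C g l (toComplex p)).erase 0

/-- `t` is a non-zero vector in the kernel of the linearization at the real equilibrium `p`. -/
def IsTangentNullDirection (C g l : ℝ) (p t : Fin 4 → ℝ) : Prop :=
  realField C g l p = 0 ∧ t ≠ 0 ∧ (jacobian (realField C g l) p).mulVec t = 0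

/-- Normal hyperbolicity at the point `p` of a curve of equilibria with tangent direction `t`:
the direction `t` carries an eigenvalue `0`, and it accounts for all eigenvalues of
zero real part. -/
def IsNormallyHyperbolicAt (C g l : ℝ) (p t : Fin 4 → ℝ) : Prop :=
  IsTangentNullDirection C g l p t ∧ ∀ z ∈ transverseEigenvalues C g l p, z.re ≠ 0

/-- Point of a curve of equilibria with tangent direction `t` that is a (transverse) source. -/
def IsSourceOnCurve (C g l : ℝ) (p t : Fin 4 → ℝ) : Prop :=
  IsTangentNullDirection C g l p t ∧ ∀ z ∈ transverseEigenvalues C g l p, 0 < z.re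

/-- Point of a curve of equilibria with tangent direction `t` that is a (transverse) saddle. -/
def IsSaddleOnCurve (C g l : ℝ) (p t : Fin 4 → ℝ) : Prop :=
  IsNormallyHyperbolicAt C g l p t ∧
    (∃ z ∈ transverseEigenvalues C g l p, 0 < z.re) ∧
    ∃ z ∈ transverseEigenvalues C g l p, z.re < 0

/-- Point of a curve of equilibria with tangent direction `t` at which normal hyperbolicity fails
because a transverse eigenvalue has zero real part. -/
def IsNonhyperbolicOnCurve (C g l : ℝ) (p t : Fin 4 → ℝ) : Prop :=
  IsTangentNullDirection C g l p t ∧ ∃ z ∈ transverseEigenvalues C g l p, z.re = 0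

/-! ### The equilibrium points -/

def ptN1 : Fin 4 → ℝ := ![0, 1, 0, 0]

/-- The curve `L`, parametrized by `s = Σ₀`. -/
def curveL (C s : ℝ) : Fin 4 → ℝ := ![s, 0, √(1 - C * s ^ 2), 0]

/-- The velocity of the parametrization of `L` (for `C s² < 1`). -/
def velocityL (C s : ℝ) : Fin 4 → ℝ := ![1, 0, -(C * s) / √(1 - C * s ^ 2), 0]

/-- The eigenvector for the eigenvalue `0` along `L` (for `s ≠ 0`). -/
def nullVectorL (C s : ℝ) : Fin 4 → ℝ := ![-√(1 - C * s ^ 2) / (C * s), 0, 1, 0]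

/-- The tangent direction of `L`, rescaled so as to make sense on the whole of `L`. -/
def tangentL (C s : ℝ) : Fin 4 → ℝ := ![√(1 - C * s ^ 2), 0, -(C * s), 0]

def ptP11 (C : ℝ) : Fin 4 → ℝ := ![-(1 / √C), 0, 0, 0]

def ptP12 (C : ℝ) : Fin 4 → ℝ := ![1 / √C, 0, 0, 0]

def ptP13 (C g : ℝ) : Fin 4 → ℝ := ![(2 - 3 * g) / (4 * (g - 1) * C), 0, 0, 0]

def ptP14 (C g : ℝ) : Fin 4 → ℝ :=
  ![-(2 * (g - 1)) / (3 * g - 2), 1 - 8 * (g - 1) ^ 2 * C / (2 - 3 * g) ^ 2, 0, 0]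

/-- `8 C (γ - 1)² + γ² λ²`. -/
def dd (C g l : ℝ) : ℝ := 8 * C * (g - 1) ^ 2 + g ^ 2 * l ^ 2

/-- `4 - 16 C (γ - 1)² - γ (γ (2 λ² - 9) + 12)`. -/
def qq (C g l : ℝ) : ℝ := 4 - 16 * C * (g - 1) ^ 2 - g * (g * (2 * l ^ 2 - 9) + 12)

/-- `P₁₃(λ)`; the last coordinate is imaginary when `qq C g l < 0`. -/
def ptP13L (C g l : ℝ) : Fin 4 → ℂ :=
  ![((-(2 * (g - 1) * (3 * g - 2)) / dd C g l : ℝ) : ℂ), 0,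
    ((g * (3 * g - 2) * l / (√2 * dd C g l) : ℝ) : ℂ),
    ((√g * √(3 * g - 2) * l : ℝ) : ℂ) * Complex.sqrt ((qq C g l : ℝ) : ℂ) /
      ((√2 * dd C g l : ℝ) : ℂ)]

/-- `P₁₄(λ)`; for `γ > 1` the last coordinate is imaginary. -/
def ptP14L (C g l : ℝ) : Fin 4 → ℂ :=
  ![((-(2 * (g - 1)) / (3 * g - 2) : ℝ) : ℂ),
    (((4 - 8 * C * (g - 1) ^ 2 - g * (g * (l ^ 2 - 9) + 12)) / (2 - 3 * g) ^ 2 : ℝ) : ℂ),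
    ((g * l / (√2 * (3 * g - 2)) : ℝ) : ℂ),
    (l : ℂ) / Complex.sqrt ((4 / g - 6 : ℝ) : ℂ)]

/-- `P₁₅(λ)`; the last coordinate is imaginary when `λ² + (2 - 4 λ²) C < 0`. -/
def ptP15L (C l : ℝ) : Fin 4 → ℂ :=
  ![((-(1 / (2 * C)) : ℝ) : ℂ), 0, ((1 / (√2 * l) : ℝ) : ℂ),
    Complex.sqrt ((l ^ 2 + (2 - 4 * l ^ 2) * C : ℝ) : ℂ) / ((2 * l * √C : ℝ) : ℂ)]

/-- `(γ - 1) C D² (-q) (2 γ² (3γ - 2) λ² + (γ - 1) C (-4 + γ (28 + γ (-33 + 2λ²)) + 16 (γ - 1)² C))`,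
the radicand in the last two eigenvalues of `P₁₃(λ)`. -/
def radicandP13L (C g l : ℝ) : ℝ :=
  (g - 1) * C * dd C g l ^ 2 * (-qq C g l) *
    (2 * g ^ 2 * (3 * g - 2) * l ^ 2 +
      (g - 1) * C * (-4 + g * (28 + g * (-33 + 2 * l ^ 2)) + 16 * (g - 1) ^ 2 * C))

/-! ### Parameter regions -/

/-- `√2 √((1 - C Σ₀²) / (Σ₀ + 2)²)`. -/
def lamL (C s : ℝ) : ℝ := √2 * √((1 - C * s ^ 2) / (s + 2) ^ 2)

/-- `(2 Σ₀ + 4) / (3 Σ₀ + 4)`. -/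
def gamL (s : ℝ) : ℝ := (2 * s + 4) / (3 * s + 4)

/-- `2 √((γ - 1) C / γ)`. -/
def lamO (C g : ℝ) : ℝ := 2 * √((g - 1) * C / g)

/-- `√(((2 - 3γ)² - 8 (γ - 1)² C) / γ²)`. -/
def lamS (C g : ℝ) : ℝ := √(((2 - 3 * g) ^ 2 - 8 * (g - 1) ^ 2 * C) / g ^ 2)

/-- `½ √((2 (2 - 3γ)² - 32 (γ - 1)² C) / γ²)`. -/
def lamX (C g : ℝ) : ℝ := 1 / 2 * √((2 * (2 - 3 * g) ^ 2 - 32 * (g - 1) ^ 2 * C) / g ^ 2)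

/-- `√2 √(C / (2 C - 1))`. -/
def lamA (C : ℝ) : ℝ := √2 * √(C / (2 * C - 1))

/-- `√2 √(C / (4 C - 1))`. -/
def lamB (C : ℝ) : ℝ := √2 * √(C / (4 * C - 1))

/-- `(4 C - 2) / (4 C - 3)`. -/
def gam4 (C : ℝ) : ℝ := (4 * C - 2) / (4 * C - 3)

/-- `(8 C - 2) / (8 C - 3)`. -/
def gam8 (C : ℝ) : ℝ := (8 * C - 2) / (8 * C - 3)

/-- `2 (4 C - 3) / (8 C - 9) + 2 √2 √(C / (8 C - 9)²)`. -/
def gamT (C : ℝ) : ℝ := 2 * (4 * C - 3) / (8 * C - 9) + 2 * √2 * √(C / (8 * C - 9) ^ 2)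

/-- `2 (8 C - 3) / (16 C - 9) + 4 √(C / (16 C - 9)²)`. -/
def gamU (C : ℝ) : ℝ := 2 * (8 * C - 3) / (16 * C - 9) + 4 * √(C / (16 * C - 9) ^ 2)

/-- Parameters `(C, Σ₀, γ, λ)` for which `L` is a source. -/
def SourceL (C s g l : ℝ) : Prop :=
  (0 < C ∧ s = 1 / √C ∧ 0 < l ∧ 1 < g ∧ g < 2) ∨
  (1 < C ∧ s = -√(1 / C) ∧ 0 < l ∧ gamL s < g ∧ g < 2) ∨
  (1 < C ∧ 0 < s ∧ s < √(1 / C) ∧ lamL C s < l ∧ 1 < g ∧ g < 2) ∨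
  (0 < C ∧ 0 < s ∧ s < √(1 / C) ∧ lamL C s < l ∧ 1 < g ∧ g < 2) ∨
  (1 < C ∧ -√(1 / C) < s ∧ s ≤ 0 ∧ lamL C s < l ∧ gamL s < g ∧ g < 2) ∨
  (0 < C ∧ C ≤ 1 ∧ -1 < s ∧ s ≤ 0 ∧ lamL C s < l ∧ gamL s < g ∧ g < 2)

/-- Parameters `(C, Σ₀, γ, λ)` for which `L` is a saddle. -/
def SaddleL (C s g l : ℝ) : Prop :=
  (0 < C ∧ C ≤ 1 / 4 ∧ -2 < s ∧ s ≤ -1 ∧ lamL C s < l ∧ 1 < g ∧ g < 2) ∨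
  (0 < C ∧ C ≤ 1 / 4 ∧ -1 < s ∧ s < 0 ∧ lamL C s < l ∧ 1 < g ∧ g < gamL s) ∨
  (1 / 4 < C ∧ C ≤ 1 ∧ s = -(1 / √C) ∧ 0 < l ∧ 1 < g ∧ g < 2) ∨
  (1 / 4 < C ∧ C < 1 ∧ -√(1 / C) < s ∧ s ≤ -1 ∧ lamL C s < l ∧ 1 < g ∧ g < 2) ∨
  (1 / 4 < C ∧ C ≤ 1 ∧ -1 < s ∧ s < 0 ∧ lamL C s < l ∧ 1 < g ∧ g < gamL s) ∨
  (1 < C ∧ s = -√(1 / C) ∧ 0 < l ∧ 1 < g ∧ g < gamL s) ∨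
  (1 < C ∧ -√(1 / C) < s ∧ s < 0 ∧ lamL C s < l ∧ 1 < g ∧ g < gamL s) ∨
  (0 < C ∧ C ≤ 1 ∧ 0 < s ∧ s < √(1 / C) ∧ 0 < l ∧ l < lamL C s ∧ 1 < g ∧ g < 2) ∨
  (0 < C ∧ C ≤ 1 ∧ -1 < s ∧ s ≤ 0 ∧ 0 < l ∧ l < lamL C s ∧ gamL s < g ∧ g < 2) ∨
  (1 < C ∧ 0 < s ∧ s < √(1 / C) ∧ 0 < l ∧ l < lamL C s ∧ 1 < g ∧ g < 2) ∨
  (1 < C ∧ -√(1 / C) < s ∧ s ≤ 0 ∧ 0 < l ∧ l < lamL C s ∧ gamL s < g ∧ g < 2) ∨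
  (0 < C ∧ C < 1 / 4 ∧ -√(1 / C) ≤ s ∧ s ≤ -2 ∧ 0 < l ∧ 1 < g ∧ g < 2) ∨
  (0 < C ∧ C < 1 / 4 ∧ -1 < s ∧ s < 0 ∧ 0 < l ∧ l < lamL C s ∧ 1 < g ∧ g < gamL s) ∨
  (0 < C ∧ C < 1 / 4 ∧ -2 < s ∧ s ≤ -1 ∧ 0 < l ∧ l < lamL C s ∧ 1 < g ∧ g < 2) ∨
  (1 / 4 ≤ C ∧ C < 1 ∧ -√(1 / C) < s ∧ s ≤ -1 ∧ 0 < l ∧ l < lamL C s ∧ 1 < g ∧ g < 2) ∨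
  (1 / 4 ≤ C ∧ C ≤ 1 ∧ -1 < s ∧ s < 0 ∧ 0 < l ∧ l < lamL C s ∧ 1 < g ∧ g < gamL s) ∨
  (1 < C ∧ -√(1 / C) < s ∧ s < 0 ∧ 0 < l ∧ l < lamL C s ∧ 1 < g ∧ g < gamL s)

/-- Parameters `(C, Σ₀, γ, λ)` for which `L` is non-hyperbolic (transversally). -/
def NonhypL (C s g l : ℝ) : Prop :=
  (0 < C ∧ C < 1 / 4 ∧ -1 < s ∧ s < 0 ∧ g = gamL s ∧ 0 < l ∧ l < lamL C s) ∨
  (0 < C ∧ C < 1 / 4 ∧ -1 < s ∧ s < 0 ∧ g = gamL s ∧ lamL C s < l) ∨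
  (0 < C ∧ C < 1 / 4 ∧ -1 < s ∧ s < 0 ∧ l = lamL C s ∧ 1 < g ∧ g < 2) ∨
  (0 < C ∧ C < 1 / 4 ∧ -2 < s ∧ s ≤ -1 ∧ l = lamL C s ∧ 1 < g ∧ g < 2) ∨
  (0 < C ∧ C < 1 / 4 ∧ 0 ≤ s ∧ s < 1 / √C ∧ l = lamL C s ∧ 1 < g ∧ g < 2) ∨
  (C = 1 / 4 ∧ -1 < s ∧ s < 0 ∧ g = gamL s ∧ 0 < l ∧ l < √(2 / (s + 2) - 1 / 2)) ∨
  (C = 1 / 4 ∧ -1 < s ∧ s < 0 ∧ g = gamL s ∧ √(8 / (s + 2) - 2) < 2 * l) ∨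
  (C = 1 / 4 ∧ -1 < s ∧ s < 0 ∧ g = gamL s ∧ 2 * l = √(8 / (s + 2) - 2) ∧ 1 < g ∧ g < 2) ∨
  (C = 1 / 4 ∧ -2 < s ∧ s ≤ -1 ∧ 2 * l = √(8 / (s + 2) - 2) ∧ 1 < g ∧ g < 2) ∨
  (4 * C = 1 ∧ 0 ≤ s ∧ s < 2 ∧ 2 * l = √(8 / (s + 2) - 2) ∧ 1 < g ∧ g < 2) ∨
  (C = 1 / 4 ∧ s = -2 ∧ 0 < l ∧ 1 < g ∧ g < 2) ∨
  (1 / 4 < C ∧ C ≤ 1 ∧ -1 < s ∧ s < 0 ∧ g = gamL s ∧ 0 < l ∧ l < lamL C s) ∨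
  (1 / 4 < C ∧ C ≤ 1 ∧ -1 < s ∧ s < 0 ∧ g = gamL s ∧ lamL C s < l) ∨
  (1 / 4 < C ∧ C ≤ 1 ∧ -1 < s ∧ s < 0 ∧ l = lamL C s ∧ 1 < g ∧ g < 2) ∨
  (1 / 4 < C ∧ C ≤ 1 ∧ 0 ≤ s ∧ s < 1 / √C ∧ l = lamL C s ∧ 1 < g ∧ g < 2) ∨
  (1 / 4 < C ∧ C ≤ 1 ∧ -(1 / √C) < s ∧ s ≤ -1 ∧ l = lamL C s ∧ 1 < g ∧ g < 2) ∨
  (1 < C ∧ s = -(1 / √C) ∧ g = gamL s ∧ 0 < l) ∨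
  (1 < C ∧ -(1 / √C) < s ∧ s < 0 ∧ g = gamL s ∧ 0 < l ∧ l < lamL C s) ∨
  (1 < C ∧ -(1 / √C) < s ∧ s < 0 ∧ g = gamL s ∧ lamL C s < l) ∨
  (1 < C ∧ 0 ≤ s ∧ s < 1 / √C ∧ l = lamL C s ∧ 1 < g ∧ g < 2) ∨
  (1 < C ∧ -(1 / √C) < s ∧ s < 0 ∧ l = lamL C s ∧ 1 < g ∧ g < 2)

/-- Parameters for which `P₁₃(λ)` is a sink. -/
def SinkP13L (C g l : ℝ) : Prop :=
  (1 < C ∧ C ≤ 2 ∧ gam4 C < g ∧ g < 2 ∧ lamS C g < l ∧ l < lamO C g) ∨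
  (2 < C ∧ gam4 C < g ∧ g < gamT C ∧ lamS C g < l ∧ l < lamO C g) ∨
  (2 < C ∧ gamT C ≤ g ∧ g < 2 ∧ 0 < l ∧ l < lamO C g)

/-- Parameters for which `P₁₃(λ)` is a source. -/
def SourceP13L (C g l : ℝ) : Prop :=
  (0 < C ∧ C ≤ 1 / 2 ∧ 1 < g ∧ g < 2 ∧ lamO C g < l ∧ l < lamX C g) ∨
  (1 / 2 < C ∧ 1 < g ∧ g < gam8 C ∧ lamO C g < l ∧ l < lamX C g)

/-- Parameters for which `P₁₃(λ)` is non-hyperbolic. -/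
def NonhypP13L (C g l : ℝ) : Prop :=
  (1 / 2 < C ∧ 1 < g ∧ g < gam8 C ∧ l = lamO C g) ∨
  (1 / 2 < C ∧ gam8 C < g ∧ g < 2 ∧ l = lamO C g) ∨
  (1 < C ∧ 1 < g ∧ g < gamU C ∧ l = lamS C g) ∨
  (2 < C ∧ 1 < g ∧ g < gamT C ∧ l = lamS C g) ∨
  (0 < C ∧ C ≤ 1 / 2 ∧ 1 < g ∧ g < 2 ∧ l = lamO C g) ∨
  (0 < C ∧ C ≤ 1 ∧ 1 < g ∧ g < 2 ∧ l = lamS C g) ∨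
  (0 < C ∧ C ≤ 2 ∧ 1 < g ∧ g < 2 ∧ l = lamS C g)

/-- Parameters for which `P₁₃(λ)` is a saddle. -/
def SaddleP13L (C g l : ℝ) : Prop :=
  (0 < C ∧ C ≤ 1 / 2 ∧ 1 < g ∧ g < 2 ∧ 0 < l ∧ l < lamO C g) ∨
  (0 < C ∧ C ≤ 1 / 2 ∧ 1 < g ∧ g < 2 ∧ lamX C g < l ∧ l < lamS C g) ∨
  (0 < C ∧ C ≤ 1 / 2 ∧ 1 < g ∧ g < 2 ∧ lamS C g < l) ∨
  (1 / 2 < C ∧ C ≤ 1 ∧ 1 < g ∧ g ≤ gam8 C ∧ 0 < l ∧ l < lamO C g) ∨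
  (1 / 2 < C ∧ C ≤ 1 ∧ 1 < g ∧ g < gam8 C ∧ lamX C g < l ∧ l < lamS C g) ∨
  (1 / 2 < C ∧ C ≤ 1 ∧ 1 < g ∧ g < gam8 C ∧ lamS C g < l) ∨
  (1 / 2 < C ∧ C ≤ 1 ∧ gam8 C < g ∧ g < 2 ∧ 0 < l ∧ l < lamS C g ∧
    l ≠ lamX C g ∧ l ≠ lamO C g) ∨
  (1 / 2 < C ∧ C ≤ 1 ∧ gam8 C ≤ g ∧ g < 2 ∧ lamO C g < l ∧ l ≠ lamS C g) ∨
  (1 < C ∧ 1 < g ∧ g ≤ gam8 C ∧ 0 < l ∧ l < lamO C g) ∨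
  (1 < C ∧ 1 < g ∧ g < gam8 C ∧ lamX C g < l ∧ l < lamS C g) ∨
  (1 < C ∧ 1 < g ∧ g < gam8 C ∧ lamS C g < l) ∨
  (1 < C ∧ gam8 C < g ∧ g < gamU C ∧ 0 < l ∧ l < lamS C g ∧ l ≠ lamX C g ∧ l ≠ lamO C g) ∨
  (1 < C ∧ gam8 C ≤ g ∧ g < gamU C ∧ lamO C g < l ∧ l ≠ lamS C g) ∨
  (1 < C ∧ gamU C ≤ g ∧ g < 2 ∧ lamO C g < l)

/-- Parameters for which `P₁₅(λ)` is a sink. -/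
def SinkP15L (C g l : ℝ) : Prop :=
  (1 / 2 < C ∧ C ≤ 1 ∧ 1 < g ∧ g < 2 ∧ lamA C < l) ∨
  (1 < C ∧ 1 < g ∧ g ≤ gam4 C ∧ lamA C < l) ∨
  (1 < C ∧ gam4 C < g ∧ g < 2 ∧ lamO C g < l)

/-- Parameters for which `P₁₅(λ)` is a source. -/
def SourceP15L (C g l : ℝ) : Prop :=
  (0 < C ∧ C ≤ 1 / 2 ∧ 1 < g ∧ g < 2 ∧ 0 < l ∧ l < lamO C g) ∨
  (1 / 2 < C ∧ 1 < g ∧ g ≤ gam8 C ∧ 0 < l ∧ l < lamO C g) ∨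
  (1 / 2 < C ∧ gam8 C < g ∧ g < 2 ∧ 0 < l ∧ l < lamB C)

/-- Parameters for which `P₁₅(λ)` is non-hyperbolic. -/
def NonhypP15L (C g l : ℝ) : Prop :=
  (0 < C ∧ C ≤ 1 / 4 ∧ 1 < g ∧ g < 2 ∧ l = lamO C g) ∨
  (1 / 4 < C ∧ C ≤ 1 / 2 ∧ 1 < g ∧ g < 2 ∧ l = lamO C g) ∨
  (1 / 4 < C ∧ C ≤ 1 / 2 ∧ 1 < g ∧ g < 2 ∧ l = lamB C) ∨
  (1 / 2 < C ∧ C ≤ 1 ∧ g = gam8 C ∧ l = lamB C) ∨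
  (1 / 2 < C ∧ C ≤ 1 ∧ g = gam8 C ∧ l = lamA C) ∨
  (1 / 2 < C ∧ C ≤ 1 ∧ gam8 C < g ∧ g < 2 ∧ l = lamO C g) ∨
  (1 / 2 < C ∧ C ≤ 1 ∧ 1 < g ∧ g < gam8 C ∧ l = lamO C g) ∨
  (1 / 2 < C ∧ C ≤ 1 ∧ gam8 C < g ∧ g < 2 ∧ l = lamB C) ∨
  (1 / 2 < C ∧ C ≤ 1 ∧ 1 < g ∧ g < gam8 C ∧ l = lamB C) ∨
  (1 / 2 < C ∧ C ≤ 1 ∧ gam8 C < g ∧ g < 2 ∧ l = lamA C) ∨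
  (1 / 2 < C ∧ C ≤ 1 ∧ 1 < g ∧ g < gam8 C ∧ l = lamA C) ∨
  (1 < C ∧ gam4 C < g ∧ g < 2 ∧ l = lamO C g) ∨
  (1 < C ∧ gam8 C < g ∧ g < gam4 C ∧ l = lamO C g) ∨
  (1 < C ∧ 1 < g ∧ g < gam8 C ∧ l = lamO C g) ∨
  (1 < C ∧ g = gam4 C ∧ l = lamB C) ∨
  (1 < C ∧ g = gam8 C ∧ l = lamB C) ∨
  (1 < C ∧ gam4 C < g ∧ g < 2 ∧ l = lamB C) ∨
  (1 < C ∧ gam8 C < g ∧ g < gam4 C ∧ l = lamB C) ∨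
  (1 < C ∧ 1 < g ∧ g < gam8 C ∧ l = lamB C) ∨
  (1 < C ∧ g = gam4 C ∧ l = lamA C) ∨
  (1 < C ∧ g = gam8 C ∧ l = lamA C) ∨
  (1 < C ∧ gam4 C < g ∧ g < 2 ∧ l = lamA C) ∨
  (1 < C ∧ gam8 C < g ∧ g < gam4 C ∧ l = lamA C) ∨
  (1 < C ∧ 1 < g ∧ g < gam8 C ∧ l = lamA C)

/-- Parameters for which `P₁₅(λ)` is a saddle. -/
def SaddleP15L (C g l : ℝ) : Prop :=
  (1 / 2 < C ∧ C ≤ 1 ∧ gam8 C < g ∧ g < 2 ∧ lamB C < l ∧ l < lamO C g) ∨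
  (1 < C ∧ gam4 C < g ∧ g < 2 ∧ lamB C < l ∧ l < lamA C) ∨
  (1 < C ∧ gam8 C < g ∧ g ≤ gam4 C ∧ lamB C < l ∧ l < lamO C g) ∨
  (0 < C ∧ C ≤ 1 / 4 ∧ 1 < g ∧ g < 2 ∧ lamO C g < l) ∨
  (1 / 4 < C ∧ C ≤ 1 / 2 ∧ 1 < g ∧ g < 2 ∧ lamO C g < l ∧ l < lamB C) ∨
  (1 / 2 < C ∧ 1 < g ∧ g < gam8 C ∧ lamO C g < l ∧ l < lamB C) ∨
  (1 / 4 < C ∧ C ≤ 1 / 2 ∧ 1 < g ∧ g < 2 ∧ lamB C < l) ∨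
  (1 / 2 < C ∧ C ≤ 1 ∧ gam8 C < g ∧ g < 2 ∧ lamO C g < l ∧ l < lamA C) ∨
  (1 / 2 < C ∧ C ≤ 1 ∧ 1 < g ∧ g ≤ gam8 C ∧ lamB C < l ∧ l < lamA C) ∨
  (1 < C ∧ gam8 C < g ∧ g < gam4 C ∧ lamO C g < l ∧ l < lamA C) ∨
  (1 < C ∧ 1 < g ∧ g ≤ gam8 C ∧ lamB C < l ∧ l < lamA C) ∨
  (1 < C ∧ gam4 C < g ∧ g < 2 ∧ lamA C < l ∧ l < lamO C g)

end

end AetherScalar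

open AetherScalar

/-!
Why the classification holds.

At every equilibrium whose eigenvalues are listed, the characteristic polynomial factors far enough
to be solved explicitly. If `u = w = 0` the linearization is a `2 × 2` block in `(Σ, K)` and two
diagonal entries (`det_scalar_sub_reducedJacobian_of_no_scalar`). If `K = 0` the direction `K` splits off, and the
remaining cubic contains `u` and `w` only through `v = √2 u` and `W = w²`
(`det_scalar_sub_reducedJacobian_of_K_eq_zero`). Hence neither the factor `√2` nor the possibly
imaginary coordinate `w` enters, and all eigenvalue formulas become identities of rational functions
in `C`, `γ`, `λ`. At `P₁₃(λ)` a quadratic factor remains; with `D = dd C γ λ` and `q = qq C γ λ` its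
roots have sum `q / D` and product a positive multiple of `q (γ λ² - 4 (γ - 1) C)`
(`exists_eigenvalues_ptP13L`), so that the signs of their real parts can be read off without the
square root.

The stability regions then reduce to signs of polynomials. The thresholds `lamO`, `lamX`, `lamS`,
`lamA`, `lamB` are the positive zeros in `λ` of `γ λ² - 4 (γ - 1) C`, of `q`, of
`(3γ - 2)² - D` and of the numerators of two eigenvalues of `P₁₅(λ)`. Linear relations between these polynomials
(`qq_eq_sub_mul`, `lamA_lamO_identity`, `lamB_lamO_identity`) show that the order of the thresholds
is decided by the signs of `3γ - 2 - 8 C (γ - 1)` and `3γ - 2 - 4 C (γ - 1)`, which is what the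
bounds `gam8` and `gam4` for `γ` encode; `gamT` and `gamU` are the points where `lamS` and `lamX`
vanish.

For the enumeration, `w = 0` leaves products of linear and quadratic factors. If `w > 0` and `u ≥ 0`,
the equation `u' = 0` gives `2 C Σ² + K + 2 u² > 2`, hence `K = 0`; after division by this positive
excess over `2` the equation `Σ' = 0` is linear in `(Σ, v)`, and inserted into `w' = 0` it gives the
factorization `(2 C Σ + 1) (D Σ + 2 (γ - 1) (3γ - 2)) = 0`, whose factors belong to `P₁₅(λ)` and
`P₁₃(λ)`. The coordinate `w` of `P₁₄(λ)` is never real.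
-/

namespace AetherScalar

/-! ### Eigenvalues of the linearization -/

theorem roots_charpoly_of_det_eq (A : Matrix (Fin 4) (Fin 4) ℂ) (a b c d : ℂ)
    (h : ∀ t : ℂ, (Matrix.scalar (Fin 4) t - A).det = (t - a) * (t - b) * (t - c) * (t - d)) :
    A.charpoly.roots = {a, b, c, d} := by
  have key : A.charpoly =
      (Multiset.map (fun z : ℂ => Polynomial.X - Polynomial.C z) {a, b, c, d}).prod := by
    refine Polynomial.funext fun t => ?_
    rw [Matrix.eval_charpoly, h]
    simp [Polynomial.eval_mul, mul_assoc]
  rw [key, Polynomial.roots_multiset_prod_X_sub_C]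

theorem eigenvalues_eq_of_det_eq {C g l : ℝ} {p : Fin 4 → ℂ} (a b c d : ℂ)
    (h : ∀ t : ℂ, (Matrix.scalar (Fin 4) t - reducedJacobian ((√2 : ℝ) : ℂ) C g l p).det =
      (t - a) * (t - b) * (t - c) * (t - d)) :
    eigenvalues C g l p = {a, b, c, d} := by
  rw [eigenvalues, complexField, jacobian_reducedField]
  exact roots_charpoly_of_det_eq _ a b c d h

theorem det_scalar_sub_block (t a b c d e f : ℂ) :
    (Matrix.scalar (Fin 4) t - !![a, b, 0, 0; c, d, 0, 0; 0, 0, e, 0; 0, 0, 0, f]).det =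
      ((t - a) * (t - d) - b * c) * (t - e) * (t - f) := by
  simp [Matrix.det_succ_row_zero, Fin.sum_univ_succ, Fin.succAbove, Matrix.scalar_apply]
  ring

theorem det_scalar_sub_invariant_row (t a₁ a₂ a₃ a₄ k c₁ c₂ c₃ c₄ d₁ d₂ d₃ d₄ : ℂ) :
    (Matrix.scalar (Fin 4) t -
      !![a₁, a₂, a₃, a₄; 0, k, 0, 0; c₁, c₂, c₃, c₄; d₁, d₂, d₃, d₄]).det =
      (t - k) * ((t - a₁) * ((t - c₃) * (t - d₄) - c₄ * d₃)
        - a₃ * (c₁ * (t - d₄) + c₄ * d₁) - a₄ * (c₁ * d₃ + (t - c₃) * d₁)) := by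
  simp [Matrix.det_succ_row_zero, Fin.sum_univ_succ, Fin.succAbove, Matrix.scalar_apply]
  ring

theorem complexSqrt_sq (z : ℂ) : Complex.sqrt z ^ 2 = z :=
  Complex.cpow_nat_inv_pow z two_ne_zero

theorem norm_complexSqrt_ofReal (x : ℝ) : ‖Complex.sqrt (x : ℂ)‖ = √|x| := by
  have h : ‖Complex.sqrt (x : ℂ)‖ ^ 2 = |x| := by
    rw [← norm_pow, complexSqrt_sq, Complex.norm_real, Real.norm_eq_abs]
  rw [← h, Real.sqrt_sq (norm_nonneg _)]

theorem ofReal_sqrt_two_sq : ((√2 : ℝ) : ℂ) ^ 2 = 2 := by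
  rw [← Complex.ofReal_pow, Real.sq_sqrt (by norm_num)]
  norm_num

/-- With no scalar field (`u = w = 0`) the linearization splits into a block in `(Σ, K)` and two
diagonal entries. -/
theorem det_scalar_sub_reducedJacobian_of_no_scalar (r C g l S K t : ℂ) :
    (Matrix.scalar (Fin 4) t - reducedJacobian r C g l ![S, K, 0, 0]).det =
      ((t - ((3 * g - 2) * (2 * C * S) / (2 * (g - 1) * C) + 6 * C * S ^ 2 + K - 2)) *
        (t - (4 * C * S ^ 2 + 4 * K - 2)) -
        ((3 * g - 2) / (2 * (g - 1) * C) + S) * (8 * C * S * K)) *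
      (t - (2 * C * S ^ 2 + K - 2)) * (t - (2 * C * S ^ 2 + K + S)) := by
  rw [← det_scalar_sub_block]
  congr 2
  ext i j
  fin_cases i <;> fin_cases j <;> simp [reducedJacobian]

/-- On `K = 0` the direction `K` splits off. The remaining cubic factor contains `u` and `w` only
through `v = √2 u` and `W = w²`. -/
theorem det_scalar_sub_reducedJacobian_of_K_eq_zero (r C g l S u w v W t : ℂ)
    (hC : C ≠ 0) (hg : g - 1 ≠ 0) (hr : r ^ 2 = 2) (hv : v = r * u) (hW : W = w ^ 2) :
    (Matrix.scalar (Fin 4) t - reducedJacobian r C g l ![S, 0, u, w]).det =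
      (t - (4 * C * S ^ 2 + 2 * v ^ 2 - 2)) *
      ((t - ((3 * g - 2) * S / (g - 1) + 6 * C * S ^ 2 + v ^ 2 - 2)) *
          ((t - (2 * C * S ^ 2 + 3 * v ^ 2 - 2)) * (t - (2 * C * S ^ 2 + S + v ^ 2 - v / l))
            + 2 * W / l * (4 * v - 2 / l))
        - v * ((3 * g - 2) / ((g - 1) * C) + 4 * S) *
          (2 * C * S * v * (t - (2 * C * S ^ 2 + S + v ^ 2 - v / l))
            - 2 * W / l * (4 * C * S + 1))
        + W * (g / ((g - 1) * C)) * (4 * C * S * (2 * v ^ 2 - v / l)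
          + (t - (2 * C * S ^ 2 + 3 * v ^ 2 - 2)) * (4 * C * S + 1))) := by
  have hu : u = r * v / 2 := by rw [hv]; linear_combination (-u / 2) * hr
  have hu2 : u ^ 2 = v ^ 2 / 2 := by rw [hu]; linear_combination (v ^ 2 / 4) * hr
  have hJ : reducedJacobian r C g l ![S, 0, u, w] =
      !![(3 * g - 2) * S / (g - 1) + 6 * C * S ^ 2 + v ^ 2 - 2,
          (3 * g - 2) / (2 * (g - 1) * C) + S,
          u * ((3 * g - 2) / ((g - 1) * C) + 4 * S), -(w * (g / ((g - 1) * C)));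
        0, 4 * C * S ^ 2 + 2 * v ^ 2 - 2, 0, 0;
        u * (4 * C * S), u, 2 * C * S ^ 2 + 3 * v ^ 2 - 2, -(w * (r * (2 / l)));
        w * (4 * C * S + 1), w, w * (4 * u - r / l),
          2 * C * S ^ 2 + S + v ^ 2 - v / l] := by
    ext i j
    fin_cases i <;> fin_cases j <;> simp [reducedJacobian, hu2]
    · field_simp
    · field_simp
    · field_simp; ring
    · ring
    · ring
    · rw [hv]; ring
    · ring
    · rw [hv]; ring
  have e1 : r * (4 * u - r / l) = 4 * v - 2 / l := by rw [hv]; linear_combination (-1 / l) * hr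
  have e2 : u * (4 * u - r / l) = 2 * v ^ 2 - v / l := by
    rw [hv]; linear_combination (4 : ℂ) * hu2 + 2 * (v + r * u) * hv
  rw [hJ, det_scalar_sub_invariant_row, ← e1, ← e2]
  generalize (3 * g - 2) * S / (g - 1) + 6 * C * S ^ 2 + v ^ 2 - 2 = a
  generalize (3 * g - 2) / ((g - 1) * C) + 4 * S = b
  generalize g / ((g - 1) * C) = c
  generalize 2 * C * S ^ 2 + 3 * v ^ 2 - 2 = d
  generalize 2 * C * S ^ 2 + S + v ^ 2 - v / l = e
  generalize 4 * u - r / l = f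
  generalize 4 * C * S ^ 2 + 2 * v ^ 2 - 2 = k
  rw [hW]
  linear_combination (-(t - k) * b * (4 * C * S) * (t - e)) * hu2
    - ((t - k) * b * (2 / l) * w ^ 2 * (4 * C * S + 1)) * hv

/-! ### The points without scalar field -/

theorem toComplex_cons (a b c d : ℝ) :
    toComplex ![a, b, c, d] = ![(a : ℂ), (b : ℂ), (c : ℂ), (d : ℂ)] := by
  ext i
  fin_cases i <;> simp [toComplex]

theorem ofReal_sub_one_ne_zero {g : ℝ} (hg1 : 1 < g) : (g : ℂ) - 1 ≠ 0 := by
  exact_mod_cast (sub_pos.2 hg1).ne'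

theorem realField_ptN1 (C g l : ℝ) : realField C g l ptN1 = 0 := by
  ext i
  fin_cases i <;> simp [realField, reducedField, ptN1]

theorem omegaT_ptN1 (C g : ℝ) : omegaT C g (toComplex ptN1) = 0 := by
  simp [omegaT, toComplex, ptN1]

theorem eigenvalues_ptN1 (C g l : ℝ) : eigenvalues C g l (toComplex ptN1) = {-1, -1, 1, 2} := by
  have hp : toComplex ptN1 = ![0, 1, 0, 0] := by simp [ptN1, toComplex_cons]
  have h := eigenvalues_eq_of_det_eq (C := C) (g := g) (l := l) (p := toComplex ptN1)
    (-1) (-1) 1 2 fun t => by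
      rw [hp, det_scalar_sub_reducedJacobian_of_no_scalar]
      ring
  exact h

theorem isSaddle_ptN1 (C g l : ℝ) : IsSaddle C g l (toComplex ptN1) := by
  rw [IsSaddle, eigenvalues_ptN1, complexField_toComplex, realField_ptN1]
  refine ⟨by ext i; simp [toComplex], ?_, ⟨2, by simp, by norm_num⟩, ⟨-1, by simp, by norm_num⟩⟩
  intro z hz
  simp only [Multiset.insert_eq_cons, Multiset.mem_cons, Multiset.mem_singleton] at hz
  rcases hz with rfl | rfl | rfl | rfl <;> norm_num

theorem realField_ptP13 {C g : ℝ} (l : ℝ) (hC : 0 < C) (hg1 : 1 < g) :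
    realField C g l (ptP13 C g) = 0 := by
  have hg : g - 1 ≠ 0 := (sub_pos.2 hg1).ne'
  ext i
  fin_cases i <;> simp [realField, reducedField, ptP13]
  field_simp
  ring

theorem omegaT_ptP13 {C g : ℝ} (hC : 0 < C) (hg1 : 1 < g) :
    omegaT C g (toComplex (ptP13 C g)) =
      ((1 / (g - 1) - (2 - 3 * g) ^ 2 / (16 * (g - 1) ^ 3 * C) : ℝ) : ℂ) := by
  have hg := ofReal_sub_one_ne_zero hg1
  have hC' : (C : ℂ) ≠ 0 := by exact_mod_cast hC.ne'
  simp [omegaT, toComplex, ptP13]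
  field_simp
  ring

theorem eigenvalues_ptP13 {C g : ℝ} (l : ℝ) (hC : 0 < C) (hg1 : 1 < g) :
    eigenvalues C g l (toComplex (ptP13 C g)) =
      Multiset.map Complex.ofReal
        {g * (3 * g - 2) / (8 * (g - 1) ^ 2 * C),
          (2 - 3 * g) ^ 2 / (8 * (g - 1) ^ 2 * C) - 2,
          (2 - 3 * g) ^ 2 / (8 * (g - 1) ^ 2 * C) - 2,
          (2 - 3 * g) ^ 2 / (4 * (g - 1) ^ 2 * C) - 2} := by
  have hg := ofReal_sub_one_ne_zero hg1
  have hC' : (C : ℂ) ≠ 0 := by exact_mod_cast hC.ne'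
  simp only [Multiset.insert_eq_cons, Multiset.map_cons, Multiset.map_singleton]
  refine eigenvalues_eq_of_det_eq _ _ _ _ fun t => ?_
  rw [ptP13, toComplex_cons, Complex.ofReal_zero, det_scalar_sub_reducedJacobian_of_no_scalar]
  push_cast
  have h1 : (4 : ℂ) * C * ((2 - 3 * g) / (4 * (g - 1) * C)) ^ 2 =
      (2 - 3 * g) ^ 2 / (4 * (g - 1) ^ 2 * C) := by field_simp
  have h2 : (2 : ℂ) * C * ((2 - 3 * g) / (4 * (g - 1) * C)) ^ 2 =
      (2 - 3 * g) ^ 2 / (8 * (g - 1) ^ 2 * C) := by field_simp; ring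
  have h3 : (3 * (g : ℂ) - 2) * (2 * C * ((2 - 3 * g) / (4 * (g - 1) * C))) / (2 * (g - 1) * C) +
      6 * C * ((2 - 3 * g) / (4 * (g - 1) * C)) ^ 2 =
      (2 - 3 * g) ^ 2 / (8 * (g - 1) ^ 2 * C) := by field_simp; ring
  have h4 : (2 - 3 * (g : ℂ)) ^ 2 / (8 * (g - 1) ^ 2 * C) + (2 - 3 * g) / (4 * (g - 1) * C) =
      g * (3 * g - 2) / (8 * (g - 1) ^ 2 * C) := by field_simp; ring
  rw [h1, h2, h3, add_zero, h4]
  ring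

theorem realField_ptP14 {C g : ℝ} (l : ℝ) (hC : 0 < C) (hg1 : 1 < g) :
    realField C g l (ptP14 C g) = 0 := by
  have hg : g - 1 ≠ 0 := (sub_pos.2 hg1).ne'
  have hh : 3 * g - 2 ≠ 0 := by linarith
  have hs : (2 - 3 * g) ^ 2 = (3 * g - 2) ^ 2 := by ring
  ext i
  fin_cases i <;> simp [realField, reducedField, ptP14, hs]
  · field_simp
    ring
  · right
    field_simp
    ring

theorem omegaT_ptP14 {C g : ℝ} (hg1 : 1 < g) :
    omegaT C g (toComplex (ptP14 C g)) = ((4 * (g - 1) * C / (2 - 3 * g) ^ 2 : ℝ) : ℂ) := by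
  have hg := ofReal_sub_one_ne_zero hg1
  have hh : 3 * (g : ℂ) - 2 ≠ 0 := by
    have : 3 * g - 2 ≠ 0 := by linarith
    exact_mod_cast this
  have hs : (2 - 3 * (g : ℂ)) ^ 2 = (3 * g - 2) ^ 2 := by ring
  simp [omegaT, toComplex, ptP14, hs]
  field_simp
  ring

theorem eigenvalues_ptP14 {C g : ℝ} (l : ℝ) (hC : 0 < C) (hg1 : 1 < g) :
    eigenvalues C g l (toComplex (ptP14 C g)) =
      {-1, ((g / (3 * g - 2) : ℝ) : ℂ),
        -(1 / 2) - Complex.sqrt ((64 * (g - 1) ^ 2 * C - 7 * (2 - 3 * g) ^ 2 : ℝ) : ℂ) /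
          ((2 * (3 * g - 2) : ℝ) : ℂ),
        -(1 / 2) + Complex.sqrt ((64 * (g - 1) ^ 2 * C - 7 * (2 - 3 * g) ^ 2 : ℝ) : ℂ) /
          ((2 * (3 * g - 2) : ℝ) : ℂ)} := by
  have hg := ofReal_sub_one_ne_zero hg1
  have hC' : (C : ℂ) ≠ 0 := by exact_mod_cast hC.ne'
  have hh : 3 * (g : ℂ) - 2 ≠ 0 := by
    have : 3 * g - 2 ≠ 0 := by linarith
    exact_mod_cast this
  have hs : (2 - 3 * (g : ℂ)) ^ 2 = (3 * g - 2) ^ 2 := by ring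
  refine eigenvalues_eq_of_det_eq _ _ _ _ fun t => ?_
  have hq := complexSqrt_sq ((64 * (g - 1) ^ 2 * C - 7 * (2 - 3 * g) ^ 2 : ℝ) : ℂ)
  set σ := Complex.sqrt ((64 * (g - 1) ^ 2 * C - 7 * (2 - 3 * g) ^ 2 : ℝ) : ℂ)
  push_cast at hq
  rw [ptP14, toComplex_cons, Complex.ofReal_zero, det_scalar_sub_reducedJacobian_of_no_scalar]
  push_cast
  have hpair : (t - (-(1 / 2) - σ / (2 * (3 * g - 2)))) *
      (t - (-(1 / 2) + σ / (2 * (3 * g - 2)))) =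
      t ^ 2 + t + 2 - 16 * (g - 1) ^ 2 * C / (3 * g - 2) ^ 2 := by
    have : (t - (-(1 / 2) - σ / (2 * (3 * g - 2)))) *
      (t - (-(1 / 2) + σ / (2 * (3 * g - 2)))) =
      (t + 1 / 2) ^ 2 - σ ^ 2 / (4 * (3 * (g : ℂ) - 2) ^ 2) := by field_simp; ring
    rw [this, hq, hs]
    generalize 3 * (g : ℂ) - 2 = h at hh ⊢
    field_simp
    ring
  rw [mul_assoc _ (t - (-(1 / 2) - σ / (2 * (3 * (g : ℂ) - 2)))), hpair, hs]
  field_simp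
  ring

/-! ### The curve `L` -/

section CurveL

variable {C g l s : ℝ}

theorem realField_curveL (g l : ℝ) (hs : C * s ^ 2 ≤ 1) : realField C g l (curveL C s) = 0 := by
  have hu : √(1 - C * s ^ 2) ^ 2 = 1 - C * s ^ 2 := Real.sq_sqrt (by linarith)
  ext i
  fin_cases i <;> simp [realField, reducedField, curveL, hu]
  · ring
  · right; ring

theorem omegaT_curveL (g : ℝ) (hs : C * s ^ 2 ≤ 1) : omegaT C g (toComplex (curveL C s)) = 0 := by
  have hu : ((√(1 - C * s ^ 2) : ℝ) : ℂ) ^ 2 = 1 - C * s ^ 2 := by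
    rw [← Complex.ofReal_pow, Real.sq_sqrt (by linarith)]
    push_cast
    ring
  simp [omegaT, curveL, toComplex_cons, hu]

theorem eigenvalues_curveL (hC : 0 < C) (hg1 : 1 < g) (hl : 0 < l) (hs : C * s ^ 2 ≤ 1) :
    eigenvalues C g l (toComplex (curveL C s)) =
      Multiset.map Complex.ofReal
        {0, (3 * g - 2) * s / (g - 1) + 4, -(√(2 - 2 * C * s ^ 2) / l) + s + 2, 2} := by
  have hg := ofReal_sub_one_ne_zero hg1
  have hC' : (C : ℂ) ≠ 0 := by exact_mod_cast hC.ne'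
  have hl' : (l : ℂ) ≠ 0 := by exact_mod_cast hl.ne'
  simp only [Multiset.insert_eq_cons, Multiset.map_cons, Multiset.map_singleton]
  refine eigenvalues_eq_of_det_eq _ _ _ _ fun t => ?_
  have hv : ((√(2 - 2 * C * s ^ 2) : ℝ) : ℂ) =
      ((√2 : ℝ) : ℂ) * ((√(1 - C * s ^ 2) : ℝ) : ℂ) := by
    rw [← Complex.ofReal_mul, ← Real.sqrt_mul (by norm_num)]
    congr 2
    ring
  have hv2 : ((√(2 - 2 * C * s ^ 2) : ℝ) : ℂ) ^ 2 = 2 - 2 * C * s ^ 2 := by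
    rw [← Complex.ofReal_pow, Real.sq_sqrt (by linarith)]
    push_cast
    ring
  rw [curveL, toComplex_cons, Complex.ofReal_zero,
    det_scalar_sub_reducedJacobian_of_K_eq_zero _ _ _ _ _ _ _ _ 0 _ hC' hg
      ofReal_sqrt_two_sq hv (by simp)]
  push_cast
  generalize ((√(2 - 2 * C * s ^ 2) : ℝ) : ℂ) = v at hv2 ⊢
  have hB : ((3 * (g : ℂ) - 2) / ((g - 1) * C) + 4 * s) * (C * s) =
      (3 * (g : ℂ) - 2) * s / (g - 1) + 4 * C * s ^ 2 := by
    field_simp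
  calc
    _ = (t - (4 * C * s ^ 2 + 2 * v ^ 2 - 2)) * (t - (2 * C * s ^ 2 + s + v ^ 2 - v / l)) *
        ((t - ((3 * (g : ℂ) - 2) * s / (g - 1) + 6 * C * s ^ 2 + v ^ 2 - 2)) *
            (t - (2 * C * s ^ 2 + 3 * v ^ 2 - 2)) -
          2 * v ^ 2 * ((3 * (g : ℂ) - 2) * s / (g - 1) + 4 * C * s ^ 2)) := by
      rw [← hB]
      ring
    _ = _ := by
      rw [hv2]
      ring

theorem tangentL_eq_smul_velocityL (hs : C * s ^ 2 < 1) :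
    tangentL C s = √(1 - C * s ^ 2) • velocityL C s := by
  have h : √(1 - C * s ^ 2) ≠ 0 := (Real.sqrt_pos.2 (by linarith)).ne'
  ext i
  fin_cases i <;> simp [tangentL, velocityL]
  field_simp

theorem tangentL_eq_smul_nullVectorL (hC : 0 < C) (hs : s ≠ 0) :
    tangentL C s = (-(C * s)) • nullVectorL C s := by
  ext i
  fin_cases i <;> simp [tangentL, nullVectorL]
  field_simp

theorem hasDerivAt_curveL (hs : C * s ^ 2 < 1) : HasDerivAt (curveL C) (velocityL C s) s := by
  have h : 1 - C * s ^ 2 ≠ 0 := by linarith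
  have hd : HasDerivAt (fun x : ℝ => 1 - C * x ^ 2) (-(C * (2 * s))) s := by
    simpa using ((hasDerivAt_pow 2 s).const_mul C).const_sub 1
  have hu := hd.sqrt h
  rw [hasDerivAt_pi]
  intro i
  fin_cases i
  · simpa [curveL, velocityL] using hasDerivAt_id' s
  · simpa [curveL, velocityL] using hasDerivAt_const s (0 : ℝ)
  · refine (hu.congr_deriv ?_)
    have h' : √(1 - C * s ^ 2) ≠ 0 := (Real.sqrt_pos.2 (by linarith)).ne'
    simp [velocityL]
    field_simp
  · simpa [curveL, velocityL] using hasDerivAt_const s (0 : ℝ)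

theorem tangentL_ne_zero (hC : 0 < C) (hs : C * s ^ 2 ≤ 1) : tangentL C s ≠ 0 := by
  intro h
  have h0 : √(1 - C * s ^ 2) = 0 := by simpa [tangentL] using congrFun h 0
  have h2 : C = 0 ∨ s = 0 := by simpa [tangentL] using congrFun h 2
  rcases h2 with h2 | rfl
  · exact hC.ne' h2
  · simp at h0

theorem jacobian_mulVec_tangentL (g l : ℝ) (hC : 0 < C) (hg1 : 1 < g) (hs : C * s ^ 2 ≤ 1) :
    (jacobian (realField C g l) (curveL C s)).mulVec (tangentL C s) = 0 := by
  have hg : g - 1 ≠ 0 := (sub_pos.2 hg1).ne'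
  have hu : √(1 - C * s ^ 2) ^ 2 = 1 - C * s ^ 2 := Real.sq_sqrt (by linarith)
  rw [realField, jacobian_reducedField]
  generalize hv : √(1 - C * s ^ 2) = u at hu
  ext i
  fin_cases i <;>
    simp [reducedJacobian, curveL, tangentL, Matrix.mulVec, dotProduct, Fin.sum_univ_four, hv, hu]
  · field_simp
    ring
  · linear_combination (4 * C * s) * hu

theorem isTangentNullDirection_tangentL (g l : ℝ) (hC : 0 < C) (hg1 : 1 < g)
    (hs : C * s ^ 2 ≤ 1) : IsTangentNullDirection C g l (curveL C s) (tangentL C s) :=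
  ⟨realField_curveL g l hs, tangentL_ne_zero hC hs, jacobian_mulVec_tangentL g l hC hg1 hs⟩

theorem jacobian_mulVec_nullVectorL (g l : ℝ) (hC : 0 < C) (hg1 : 1 < g) (hs : C * s ^ 2 ≤ 1)
    (hs0 : s ≠ 0) :
    (jacobian (realField C g l) (curveL C s)).mulVec (nullVectorL C s) = 0 := by
  have h := jacobian_mulVec_tangentL g l hC hg1 hs
  rw [tangentL_eq_smul_nullVectorL hC hs0, Matrix.mulVec_smul] at h
  exact (smul_eq_zero.1 h).resolve_left (neg_ne_zero.2 (mul_ne_zero hC.ne' hs0))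

theorem transverseEigenvalues_curveL (hC : 0 < C) (hg1 : 1 < g) (hl : 0 < l)
    (hs : C * s ^ 2 ≤ 1) :
    transverseEigenvalues C g l (curveL C s) =
      Multiset.map Complex.ofReal
        {(3 * g - 2) * s / (g - 1) + 4, -(√(2 - 2 * C * s ^ 2) / l) + s + 2, 2} := by
  rw [transverseEigenvalues, eigenvalues_curveL hC hg1 hl hs]
  simp only [Multiset.insert_eq_cons, Multiset.map_cons, Complex.ofReal_zero,
    Multiset.erase_cons_head]

end CurveL

/-! ### Stability along the curve `L` -/

section CurveLStability

variable {C g l s : ℝ}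

theorem sqrt_one_div (C : ℝ) : √(1 / C) = 1 / √C := by
  rw [Real.sqrt_div zero_le_one, Real.sqrt_one]

theorem inv_sqrt_pos (hC : 0 < C) : 0 < 1 / √C := one_div_pos.2 (Real.sqrt_pos.2 hC)

theorem mul_inv_sqrt_sq (hC : 0 < C) : C * (1 / √C) ^ 2 = 1 := by
  rw [div_pow, one_pow, Real.sq_sqrt hC.le]
  field_simp

theorem mul_sq_le_one_iff (hC : 0 < C) : C * s ^ 2 ≤ 1 ↔ -(1 / √C) ≤ s ∧ s ≤ 1 / √C := by
  rw [← abs_le, ← abs_of_pos (inv_sqrt_pos hC), ← sq_le_sq,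
    ← mul_le_mul_iff_right₀ (b := s ^ 2) hC, mul_inv_sqrt_sq hC]

theorem inv_sqrt_lt_iff {x : ℝ} (hC : 0 < C) (hx : 0 < x) : 1 / √C < x ↔ 1 < C * x ^ 2 := by
  rw [← sq_lt_sq₀ (inv_sqrt_pos hC).le hx.le, ← mul_lt_mul_iff_right₀ hC, mul_inv_sqrt_sq hC]

theorem fluidEigenvalueL_pos_iff (hg1 : 1 < g) :
    0 < (3 * g - 2) * s / (g - 1) + 4 ↔ 0 < g * (3 * s + 4) - (2 * s + 4) := by
  have hg : 0 < g - 1 := sub_pos.2 hg1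
  have h : (3 * g - 2) * s / (g - 1) + 4 = (g * (3 * s + 4) - (2 * s + 4)) / (g - 1) := by
    field_simp
    ring
  rw [h, div_pos_iff_of_pos_right hg]

theorem fluidEigenvalueL_neg_iff (hg1 : 1 < g) :
    (3 * g - 2) * s / (g - 1) + 4 < 0 ↔ g * (3 * s + 4) - (2 * s + 4) < 0 := by
  have hg : 0 < g - 1 := sub_pos.2 hg1
  have h : (3 * g - 2) * s / (g - 1) + 4 = (g * (3 * s + 4) - (2 * s + 4)) / (g - 1) := by
    field_simp
    ring
  rw [h, div_lt_iff₀ hg, zero_mul]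

theorem fluidEigenvalueL_pos_of_nonneg (hg1 : 1 < g) (hs : 0 ≤ s) :
    0 < (3 * g - 2) * s / (g - 1) + 4 := by
  rw [fluidEigenvalueL_pos_iff hg1]
  nlinarith

theorem fluidEigenvalueL_pos_of_gamL_lt (hg1 : 1 < g) (hs : -1 ≤ s) (h : gamL s < g) :
    0 < (3 * g - 2) * s / (g - 1) + 4 := by
  rw [gamL, div_lt_iff₀ (by linarith)] at h
  rw [fluidEigenvalueL_pos_iff hg1]
  linarith

theorem fluidEigenvalueL_neg_of_lt_gamL (hg1 : 1 < g) (hs : -1 ≤ s) (h : g < gamL s) :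
    (3 * g - 2) * s / (g - 1) + 4 < 0 := by
  rw [gamL, lt_div_iff₀ (by linarith)] at h
  rw [fluidEigenvalueL_neg_iff hg1]
  linarith

theorem fluidEigenvalueL_eq_zero_of_eq_gamL (hg1 : 1 < g) (hs : -1 ≤ s) (h : g = gamL s) :
    (3 * g - 2) * s / (g - 1) + 4 = 0 := by
  have hg : g - 1 ≠ 0 := (sub_pos.2 hg1).ne'
  rw [gamL, eq_div_iff (by linarith)] at h
  field_simp
  linarith

theorem fluidEigenvalueL_neg_of_le_neg_one (hg1 : 1 < g) (hg2 : g < 2) (hs : s ≤ -1) :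
    (3 * g - 2) * s / (g - 1) + 4 < 0 := by
  rw [fluidEigenvalueL_neg_iff hg1]
  nlinarith

theorem lamL_mul (hs : -2 < s) : lamL C s * (s + 2) = √(2 - 2 * C * s ^ 2) := by
  have h2 : 0 < s + 2 := by linarith
  rw [lamL, Real.sqrt_div' _ (sq_nonneg _), Real.sqrt_sq h2.le, mul_div_assoc',
    div_mul_cancel₀ _ h2.ne', ← Real.sqrt_mul (by norm_num)]
  congr 1
  ring

theorem scalarEigenvalueL_eq (hl : 0 < l) (hs : -2 < s) :
    -(√(2 - 2 * C * s ^ 2) / l) + s + 2 = (l - lamL C s) * (s + 2) / l := by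
  rw [← lamL_mul hs]
  field_simp
  ring

theorem scalarEigenvalueL_pos (hl : 0 < l) (hs : -2 < s) (h : lamL C s < l) :
    0 < -(√(2 - 2 * C * s ^ 2) / l) + s + 2 := by
  rw [scalarEigenvalueL_eq hl hs]
  exact div_pos (mul_pos (by linarith) (by linarith)) hl

theorem scalarEigenvalueL_neg (hl : 0 < l) (hs : -2 < s) (h : l < lamL C s) :
    -(√(2 - 2 * C * s ^ 2) / l) + s + 2 < 0 := by
  rw [scalarEigenvalueL_eq hl hs]
  exact div_neg_of_neg_of_pos (mul_neg_of_neg_of_pos (by linarith) (by linarith)) hl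

theorem scalarEigenvalueL_eq_zero (hl : 0 < l) (hs : -2 < s) (h : l = lamL C s) :
    -(√(2 - 2 * C * s ^ 2) / l) + s + 2 = 0 := by
  rw [scalarEigenvalueL_eq hl hs, ← h]
  simp

/-- At the ends `Σ₀² = 1 / C` of the curve the scalar field vanishes. -/
theorem scalarEigenvalueL_of_mul_sq_eq_one (h : C * s ^ 2 = 1) :
    -(√(2 - 2 * C * s ^ 2) / l) + s + 2 = s + 2 := by
  have : 2 - 2 * C * s ^ 2 = 0 := by linear_combination (-2 : ℝ) * h
  rw [this]
  simp

theorem lamL_one_fourth (hs : -2 < s) : 2 * lamL (1 / 4) s = √(8 / (s + 2) - 2) := by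
  have h2 : 0 < s + 2 := by linarith
  have h : (8 : ℝ) / (s + 2) - 2 = 2 ^ 2 * (2 * ((1 - 1 / 4 * s ^ 2) / (s + 2) ^ 2)) := by
    field_simp
    ring
  rw [h, Real.sqrt_mul (by norm_num), Real.sqrt_sq (by norm_num), Real.sqrt_mul (by norm_num),
    lamL]

theorem isNormallyHyperbolicAt_curveL_iff (hC : 0 < C) (hg1 : 1 < g) (hl : 0 < l)
    (hs : C * s ^ 2 ≤ 1) :
    IsNormallyHyperbolicAt C g l (curveL C s) (tangentL C s) ↔
      (3 * g - 2) * s / (g - 1) + 4 ≠ 0 ∧ -(√(2 - 2 * C * s ^ 2) / l) + s + 2 ≠ 0 := by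
  rw [IsNormallyHyperbolicAt, transverseEigenvalues_curveL hC hg1 hl hs]
  simp only [Multiset.mem_map, forall_exists_index, and_imp, forall_apply_eq_imp_iff₂,
    Complex.ofReal_re, isTangentNullDirection_tangentL g l hC hg1 hs, true_and]
  simp

theorem isSourceOnCurve_curveL (hC : 0 < C) (hg1 : 1 < g) (hl : 0 < l) (hs : C * s ^ 2 ≤ 1)
    (h1 : 0 < (3 * g - 2) * s / (g - 1) + 4) (h2 : 0 < -(√(2 - 2 * C * s ^ 2) / l) + s + 2) :
    C * s ^ 2 ≤ 1 ∧ IsSourceOnCurve C g l (curveL C s) (tangentL C s) := by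
  refine ⟨hs, isTangentNullDirection_tangentL g l hC hg1 hs, ?_⟩
  rw [transverseEigenvalues_curveL hC hg1 hl hs]
  simp only [Multiset.mem_map, forall_exists_index, and_imp, forall_apply_eq_imp_iff₂,
    Complex.ofReal_re]
  simp [h1, h2]

/-- One transverse eigenvalue on `L` is always `2`, so one negative eigenvalue makes a saddle. -/
theorem isSaddleOnCurve_curveL (hC : 0 < C) (hg1 : 1 < g) (hl : 0 < l) (hs : C * s ^ 2 ≤ 1)
    (h1 : (3 * g - 2) * s / (g - 1) + 4 ≠ 0) (h2 : -(√(2 - 2 * C * s ^ 2) / l) + s + 2 ≠ 0)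
    (h : (3 * g - 2) * s / (g - 1) + 4 < 0 ∨ -(√(2 - 2 * C * s ^ 2) / l) + s + 2 < 0) :
    C * s ^ 2 ≤ 1 ∧ IsSaddleOnCurve C g l (curveL C s) (tangentL C s) := by
  refine ⟨hs, (isNormallyHyperbolicAt_curveL_iff hC hg1 hl hs).2 ⟨h1, h2⟩, ?_, ?_⟩ <;>
    rw [transverseEigenvalues_curveL hC hg1 hl hs]
  · exact ⟨_, Multiset.mem_map_of_mem _ (a := 2) (by simp), by simp⟩
  · rcases h with h | h
    · exact ⟨_, Multiset.mem_map_of_mem _ (Multiset.mem_cons_self _ _), by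
        simpa only [Complex.ofReal_re] using h⟩
    · exact ⟨_, Multiset.mem_map_of_mem _
        (Multiset.mem_cons_of_mem (Multiset.mem_cons_self _ _)), by
        simpa only [Complex.ofReal_re] using h⟩

theorem isNonhyperbolicOnCurve_curveL (hC : 0 < C) (hg1 : 1 < g) (hl : 0 < l)
    (hs : C * s ^ 2 ≤ 1)
    (h : (3 * g - 2) * s / (g - 1) + 4 = 0 ∨ -(√(2 - 2 * C * s ^ 2) / l) + s + 2 = 0) :
    C * s ^ 2 ≤ 1 ∧ IsNonhyperbolicOnCurve C g l (curveL C s) (tangentL C s) := by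
  refine ⟨hs, isTangentNullDirection_tangentL g l hC hg1 hs, ?_⟩
  rw [transverseEigenvalues_curveL hC hg1 hl hs]
  rcases h with h | h
  · exact ⟨_, Multiset.mem_map_of_mem _ (Multiset.mem_cons_self _ _), by
      simpa only [Complex.ofReal_re] using h⟩
  · exact ⟨_, Multiset.mem_map_of_mem _
      (Multiset.mem_cons_of_mem (Multiset.mem_cons_self _ _)), by
      simpa only [Complex.ofReal_re] using h⟩

theorem mul_sq_le_one_of_abs_le {b : ℝ} (hC : 0 < C) (hCb : C * b ^ 2 ≤ 1)
    (h1 : -b ≤ s) (h2 : s ≤ b) : C * s ^ 2 ≤ 1 :=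
  (mul_le_mul_of_nonneg_left (sq_le_sq' h1 h2) hC.le).trans hCb

theorem neg_inv_sqrt_lt_neg {x : ℝ} (hC : 0 < C) (hx : 0 < x) (h : 1 < C * x ^ 2) :
    -x < -(1 / √C) := neg_lt_neg ((inv_sqrt_lt_iff hC hx).2 h)

theorem SourceL.isSourceOnCurve (h : SourceL C s g l) (hC : 0 < C) (hg1 : 1 < g) (hl : 0 < l) :
    C * s ^ 2 ≤ 1 ∧ IsSourceOnCurve C g l (curveL C s) (tangentL C s) := by
  have ha := inv_sqrt_pos hC
  have hCa := mul_inv_sqrt_sq hC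
  have hiff := @mul_sq_le_one_iff C s hC
  rw [SourceL, sqrt_one_div] at h
  rcases h with ⟨-, rfl, -⟩ | ⟨hC1, rfl, -, hg, -⟩ | ⟨-, h1, h2, h3, -⟩ | ⟨-, h1, h2, h3, -⟩ |
    ⟨hC1, h1, h2, h3, h4, -⟩ | ⟨-, hC1, h1, h2, h3, h4, -⟩
  · refine isSourceOnCurve_curveL hC hg1 hl hCa.le
      (fluidEigenvalueL_pos_of_nonneg hg1 ha.le) ?_
    rw [scalarEigenvalueL_of_mul_sq_eq_one hCa]
    linarith
  · have h1 := neg_inv_sqrt_lt_neg (x := 1) hC one_pos (by linarith)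
    have hCa' : C * (-(1 / √C)) ^ 2 = 1 := by rw [neg_sq, hCa]
    refine isSourceOnCurve_curveL hC hg1 hl hCa'.le
      (fluidEigenvalueL_pos_of_gamL_lt hg1 h1.le hg) ?_
    rw [scalarEigenvalueL_of_mul_sq_eq_one hCa']
    linarith
  · exact isSourceOnCurve_curveL hC hg1 hl (hiff.2 ⟨by linarith, h2.le⟩)
      (fluidEigenvalueL_pos_of_nonneg hg1 h1.le) (scalarEigenvalueL_pos hl (by linarith) h3)
  · exact isSourceOnCurve_curveL hC hg1 hl (hiff.2 ⟨by linarith, h2.le⟩)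
      (fluidEigenvalueL_pos_of_nonneg hg1 h1.le) (scalarEigenvalueL_pos hl (by linarith) h3)
  · have h0 := neg_inv_sqrt_lt_neg (x := 1) hC one_pos (by linarith)
    exact isSourceOnCurve_curveL hC hg1 hl (hiff.2 ⟨h1.le, by linarith⟩)
      (fluidEigenvalueL_pos_of_gamL_lt hg1 (by linarith) h4)
      (scalarEigenvalueL_pos hl (by linarith) h3)
  · exact isSourceOnCurve_curveL hC hg1 hl
      (mul_sq_le_one_of_abs_le hC (by linarith) h1.le (by linarith))
      (fluidEigenvalueL_pos_of_gamL_lt hg1 h1.le h4)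
      (scalarEigenvalueL_pos hl (by linarith) h3)

theorem isSaddleOnCurve_of_fluid_neg_scalar_pos (hC : 0 < C) (hg1 : 1 < g) (hl : 0 < l)
    (hs : C * s ^ 2 ≤ 1)
    (h1 : (3 * g - 2) * s / (g - 1) + 4 < 0) (h2 : 0 < -(√(2 - 2 * C * s ^ 2) / l) + s + 2) :
    C * s ^ 2 ≤ 1 ∧ IsSaddleOnCurve C g l (curveL C s) (tangentL C s) :=
  isSaddleOnCurve_curveL hC hg1 hl hs h1.ne h2.ne' (Or.inl h1)

theorem isSaddleOnCurve_of_fluid_pos_scalar_neg (hC : 0 < C) (hg1 : 1 < g) (hl : 0 < l)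
    (hs : C * s ^ 2 ≤ 1)
    (h1 : 0 < (3 * g - 2) * s / (g - 1) + 4) (h2 : -(√(2 - 2 * C * s ^ 2) / l) + s + 2 < 0) :
    C * s ^ 2 ≤ 1 ∧ IsSaddleOnCurve C g l (curveL C s) (tangentL C s) :=
  isSaddleOnCurve_curveL hC hg1 hl hs h1.ne' h2.ne (Or.inr h2)

theorem isSaddleOnCurve_of_fluid_neg_scalar_neg (hC : 0 < C) (hg1 : 1 < g) (hl : 0 < l)
    (hs : C * s ^ 2 ≤ 1)
    (h1 : (3 * g - 2) * s / (g - 1) + 4 < 0) (h2 : -(√(2 - 2 * C * s ^ 2) / l) + s + 2 < 0) :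
    C * s ^ 2 ≤ 1 ∧ IsSaddleOnCurve C g l (curveL C s) (tangentL C s) :=
  isSaddleOnCurve_curveL hC hg1 hl hs h1.ne h2.ne (Or.inl h1)

theorem SaddleL.isSaddleOnCurve (h : SaddleL C s g l) (hC : 0 < C) (hg1 : 1 < g) (hl : 0 < l) :
    C * s ^ 2 ≤ 1 ∧ IsSaddleOnCurve C g l (curveL C s) (tangentL C s) := by
  have ha := inv_sqrt_pos hC
  have hCa := mul_inv_sqrt_sq hC
  have hCa' : C * (-(1 / √C)) ^ 2 = 1 := by rw [neg_sq, hCa]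
  have hiff := @mul_sq_le_one_iff C s hC
  -- lower bounds for the left end `-1 / √C` of the curve
  have hend2 : 1 / 4 < C → -2 < -(1 / √C) := fun h =>
    neg_inv_sqrt_lt_neg hC two_pos (by linarith)
  have hend1 : 1 < C → -1 < -(1 / √C) := fun h =>
    neg_inv_sqrt_lt_neg hC one_pos (by linarith)
  -- sufficient conditions for `s` to lie on the curve
  have hin2 : C ≤ 1 / 4 → -2 ≤ s → s ≤ 0 → C * s ^ 2 ≤ 1 := fun h h1 h2 =>
    mul_sq_le_one_of_abs_le hC (by linarith) h1 (by linarith)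
  have hin1 : C ≤ 1 → -1 ≤ s → s ≤ 0 → C * s ^ 2 ≤ 1 := fun h h1 h2 =>
    mul_sq_le_one_of_abs_le hC (by linarith) h1 (by linarith)
  rw [SaddleL, sqrt_one_div] at h
  rcases h with ⟨-, c, h1, h2, h3, -, h4⟩ | ⟨-, c, h1, h2, h3, -, h4⟩ | ⟨c, c', rfl, -, -, h4⟩ |
    ⟨c, -, h1, h2, h3, -, h4⟩ | ⟨-, c, h1, h2, h3, -, h4⟩ | ⟨c, rfl, -, -, h4⟩ |
    ⟨c, h1, h2, h3, -, h4⟩ | ⟨-, -, h1, h2, -, h3, -⟩ | ⟨-, c, h1, h2, -, h3, h4, -⟩ |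
    ⟨-, h1, h2, -, h3, -⟩ | ⟨c, h1, h2, -, h3, h4, -⟩ | ⟨-, c, h1, h2, -, -, h4⟩ |
    ⟨-, c, h1, h2, -, h3, -, h4⟩ | ⟨-, c, h1, h2, -, h3, -, h4⟩ | ⟨c, -, h1, h2, -, h3, -, h4⟩ |
    ⟨-, c, h1, h2, -, h3, -, h4⟩ | ⟨c, h1, h2, -, h3, -, h4⟩
  · exact isSaddleOnCurve_of_fluid_neg_scalar_pos hC hg1 hl (hin2 c h1.le (by linarith))
      (fluidEigenvalueL_neg_of_le_neg_one hg1 h4 h2) (scalarEigenvalueL_pos hl h1 h3)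
  · exact isSaddleOnCurve_of_fluid_neg_scalar_pos hC hg1 hl (hin2 c (by linarith) h2.le)
      (fluidEigenvalueL_neg_of_lt_gamL hg1 h1.le h4) (scalarEigenvalueL_pos hl (by linarith) h3)
  · have h1 : -(1 / √C) ≤ -1 := by
      by_contra! hlt
      have := (inv_sqrt_lt_iff hC one_pos).1 (neg_lt_neg_iff.1 hlt)
      linarith
    refine isSaddleOnCurve_of_fluid_neg_scalar_pos hC hg1 hl hCa'.le
      (fluidEigenvalueL_neg_of_le_neg_one hg1 h4 h1) ?_
    rw [scalarEigenvalueL_of_mul_sq_eq_one hCa']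
    linarith [hend2 c]
  · exact isSaddleOnCurve_of_fluid_neg_scalar_pos hC hg1 hl (hiff.2 ⟨h1.le, by linarith⟩)
      (fluidEigenvalueL_neg_of_le_neg_one hg1 h4 h2)
      (scalarEigenvalueL_pos hl ((hend2 c).trans h1) h3)
  · exact isSaddleOnCurve_of_fluid_neg_scalar_pos hC hg1 hl (hin1 c h1.le h2.le)
      (fluidEigenvalueL_neg_of_lt_gamL hg1 h1.le h4) (scalarEigenvalueL_pos hl (by linarith) h3)
  · have h1 := hend1 c
    refine isSaddleOnCurve_of_fluid_neg_scalar_pos hC hg1 hl hCa'.le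
      (fluidEigenvalueL_neg_of_lt_gamL hg1 h1.le h4) ?_
    rw [scalarEigenvalueL_of_mul_sq_eq_one hCa']
    linarith
  · have h0 := hend1 c
    exact isSaddleOnCurve_of_fluid_neg_scalar_pos hC hg1 hl (hiff.2 ⟨h1.le, by linarith⟩)
      (fluidEigenvalueL_neg_of_lt_gamL hg1 (by linarith) h4)
      (scalarEigenvalueL_pos hl (by linarith) h3)
  · exact isSaddleOnCurve_of_fluid_pos_scalar_neg hC hg1 hl (hiff.2 ⟨by linarith, h2.le⟩)
      (fluidEigenvalueL_pos_of_nonneg hg1 h1.le) (scalarEigenvalueL_neg hl (by linarith) h3)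
  · exact isSaddleOnCurve_of_fluid_pos_scalar_neg hC hg1 hl (hin1 c h1.le h2)
      (fluidEigenvalueL_pos_of_gamL_lt hg1 h1.le h4) (scalarEigenvalueL_neg hl (by linarith) h3)
  · exact isSaddleOnCurve_of_fluid_pos_scalar_neg hC hg1 hl (hiff.2 ⟨by linarith, h2.le⟩)
      (fluidEigenvalueL_pos_of_nonneg hg1 h1.le) (scalarEigenvalueL_neg hl (by linarith) h3)
  · have h0 := hend1 c
    exact isSaddleOnCurve_of_fluid_pos_scalar_neg hC hg1 hl (hiff.2 ⟨h1.le, by linarith⟩)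
      (fluidEigenvalueL_pos_of_gamL_lt hg1 (by linarith) h4)
      (scalarEigenvalueL_neg hl (by linarith) h3)
  · have hs : C * s ^ 2 ≤ 1 := hiff.2 ⟨h1, by linarith⟩
    refine isSaddleOnCurve_of_fluid_neg_scalar_neg hC hg1 hl hs
      (fluidEigenvalueL_neg_of_le_neg_one hg1 h4 (by linarith)) ?_
    rcases h2.lt_or_eq with h2 | rfl
    · have : 0 ≤ √(2 - 2 * C * s ^ 2) / l := by positivity
      linarith
    · have : 0 < √(2 - 2 * C * (-2) ^ 2) / l := div_pos (Real.sqrt_pos.2 (by linarith)) hl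
      linarith
  · exact isSaddleOnCurve_of_fluid_neg_scalar_neg hC hg1 hl (hin2 c.le (by linarith) h2.le)
      (fluidEigenvalueL_neg_of_lt_gamL hg1 h1.le h4) (scalarEigenvalueL_neg hl (by linarith) h3)
  · exact isSaddleOnCurve_of_fluid_neg_scalar_neg hC hg1 hl (hin2 c.le h1.le (by linarith))
      (fluidEigenvalueL_neg_of_le_neg_one hg1 h4 h2) (scalarEigenvalueL_neg hl h1 h3)
  · have h0 : -2 < s := by
      rcases c.lt_or_eq with c | rfl
      · exact (hend2 c).trans h1
      · refine lt_of_le_of_lt (neg_le_neg ?_) h1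
        by_contra! hlt
        nlinarith
    exact isSaddleOnCurve_of_fluid_neg_scalar_neg hC hg1 hl (hiff.2 ⟨h1.le, by linarith⟩)
      (fluidEigenvalueL_neg_of_le_neg_one hg1 h4 h2) (scalarEigenvalueL_neg hl h0 h3)
  · exact isSaddleOnCurve_of_fluid_neg_scalar_neg hC hg1 hl (hin1 c h1.le h2.le)
      (fluidEigenvalueL_neg_of_lt_gamL hg1 h1.le h4) (scalarEigenvalueL_neg hl (by linarith) h3)
  · have h0 := hend1 c
    exact isSaddleOnCurve_of_fluid_neg_scalar_neg hC hg1 hl (hiff.2 ⟨h1.le, by linarith⟩)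
      (fluidEigenvalueL_neg_of_lt_gamL hg1 (by linarith) h4)
      (scalarEigenvalueL_neg hl (by linarith) h3)

theorem NonhypL.isNonhyperbolicOnCurve (h : NonhypL C s g l) (hC : 0 < C) (hg1 : 1 < g)
    (hl : 0 < l) :
    C * s ^ 2 ≤ 1 ∧ IsNonhyperbolicOnCurve C g l (curveL C s) (tangentL C s) := by
  have ha := inv_sqrt_pos hC
  have hCa := mul_inv_sqrt_sq hC
  have hiff := @mul_sq_le_one_iff C s hC
  have hend2 : 1 / 4 < C → -2 < -(1 / √C) := fun h =>
    neg_inv_sqrt_lt_neg hC two_pos (by linarith)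
  have hend1 : 1 < C → -1 < -(1 / √C) := fun h =>
    neg_inv_sqrt_lt_neg hC one_pos (by linarith)
  have hin2 : C ≤ 1 / 4 → -2 ≤ s → s ≤ 2 → C * s ^ 2 ≤ 1 := fun h h1 h2 =>
    mul_sq_le_one_of_abs_le hC (by linarith) h1 h2
  have hin1 : C ≤ 1 → -1 ≤ s → s ≤ 1 → C * s ^ 2 ≤ 1 := fun h h1 h2 =>
    mul_sq_le_one_of_abs_le hC (by linarith) h1 h2
  -- the two ways in which normal hyperbolicity fails
  have hfluid : C * s ^ 2 ≤ 1 → -1 ≤ s → g = gamL s → C * s ^ 2 ≤ 1 ∧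
      IsNonhyperbolicOnCurve C g l (curveL C s) (tangentL C s) := fun h1 h2 h3 =>
    isNonhyperbolicOnCurve_curveL hC hg1 hl h1
      (Or.inl (fluidEigenvalueL_eq_zero_of_eq_gamL hg1 h2 h3))
  have hscalar : C * s ^ 2 ≤ 1 → -2 < s → l = lamL C s → C * s ^ 2 ≤ 1 ∧
      IsNonhyperbolicOnCurve C g l (curveL C s) (tangentL C s) := fun h1 h2 h3 =>
    isNonhyperbolicOnCurve_curveL hC hg1 hl h1 (Or.inr (scalarEigenvalueL_eq_zero hl h2 h3))
  -- at `C = 1 / 4` the threshold `lamL` has the simpler form used in the region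
  have hquarter : C = 1 / 4 → -2 < s → 2 * l = √(8 / (s + 2) - 2) → l = lamL C s := by
    rintro rfl h2 h3
    rw [← lamL_one_fourth h2] at h3
    linarith
  rcases h with ⟨-, c, h1, h2, h3, -⟩ | ⟨-, c, h1, h2, h3, -⟩ | ⟨-, c, h1, h2, h3, -⟩ |
    ⟨-, c, h1, h2, h3, -⟩ | ⟨-, c, h1, h2, h3, -⟩ | ⟨c, h1, h2, h3, -⟩ | ⟨c, h1, h2, h3, -⟩ |
    ⟨c, h1, h2, h3, -⟩ | ⟨c, h1, h2, h3, -⟩ | ⟨c, h1, h2, h3, -⟩ | ⟨c, rfl, -⟩ |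
    ⟨-, c, h1, h2, h3, -⟩ | ⟨-, c, h1, h2, h3, -⟩ | ⟨-, c, h1, h2, h3, -⟩ |
    ⟨-, c, h1, h2, h3, -⟩ | ⟨c, -, h1, h2, h3, -⟩ | ⟨c, rfl, h3, -⟩ | ⟨c, h1, h2, h3, -⟩ |
    ⟨c, h1, h2, h3, -⟩ | ⟨c, h1, h2, h3, -⟩ | ⟨c, h1, h2, h3, -⟩
  · exact hfluid (hin2 c.le (by linarith) (by linarith)) h1.le h3
  · exact hfluid (hin2 c.le (by linarith) (by linarith)) h1.le h3
  · exact hscalar (hin2 c.le (by linarith) (by linarith)) (by linarith) h3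
  · exact hscalar (hin2 c.le (by linarith) (by linarith)) h1 h3
  · exact hscalar (hiff.2 ⟨by linarith, h2.le⟩) (by linarith) h3
  · exact hfluid (hin2 c.le (by linarith) (by linarith)) h1.le h3
  · exact hfluid (hin2 c.le (by linarith) (by linarith)) h1.le h3
  · exact hfluid (hin2 c.le (by linarith) (by linarith)) h1.le h3
  · exact hscalar (hin2 c.le (by linarith) (by linarith)) h1 (hquarter c h1 h3)
  · have c' : C = 1 / 4 := by linarith
    have h0 : -2 < s := by linarith
    exact hscalar (hin2 c'.le h0.le (by linarith)) h0 (hquarter c' h0 h3)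
  · have hs : C * (-2) ^ 2 = 1 := by linarith
    refine isNonhyperbolicOnCurve_curveL hC hg1 hl hs.le (Or.inr ?_)
    rw [scalarEigenvalueL_of_mul_sq_eq_one hs]
    norm_num
  · exact hfluid (hin1 c h1.le (by linarith)) h1.le h3
  · exact hfluid (hin1 c h1.le (by linarith)) h1.le h3
  · exact hscalar (hin1 c h1.le (by linarith)) (by linarith) h3
  · exact hscalar (hiff.2 ⟨by linarith, h2.le⟩) (by linarith) h3
  · exact hscalar (hiff.2 ⟨h1.le, by linarith⟩) ((hend2 c).trans h1) h3
  · exact hfluid (by rw [neg_sq, hCa]) (hend1 c).le h3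
  · exact hfluid (hiff.2 ⟨h1.le, by linarith⟩) (by linarith [hend1 c]) h3
  · exact hfluid (hiff.2 ⟨h1.le, by linarith⟩) (by linarith [hend1 c]) h3
  · exact hscalar (hiff.2 ⟨by linarith, h2.le⟩) (by linarith) h3
  · exact hscalar (hiff.2 ⟨h1.le, by linarith⟩) (by linarith [hend1 c]) h3

end CurveLStability

/-! ### The points with scalar field -/

/-- The equations for an equilibrium, with `w' = 0` divided by `w`, contain `u` and `w` only
through `v = √2 u` and `W = w²`. -/
theorem complexField_eq_zero_of_sq {C g l : ℝ} {S K u w v W : ℂ}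
    (hv : v = ((√2 : ℝ) : ℂ) * u) (hW : W = w ^ 2)
    (h0 : (3 * (g : ℂ) - 2) * (C * S ^ 2 + K + v ^ 2 / 2 - W - 1) / (2 * (g - 1) * C)
      + 2 * C * S ^ 3 + W / C + S * (K + v ^ 2 - 2) = 0)
    (h1 : K * (2 * C * S ^ 2 + K + v ^ 2 - 1) = 0)
    (h2 : v * (2 * C * S ^ 2 + K + v ^ 2 - 2) = 2 * W / l)
    (h3 : 2 * C * S ^ 2 + K + S + v ^ 2 - v / l = 0) :
    complexField C g l ![S, K, u, w] = 0 := by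
  have hr := ofReal_sqrt_two_sq
  rw [complexField]
  generalize ((√2 : ℝ) : ℂ) = r at hv hr ⊢
  have hu : u = r * v / 2 := by rw [hv]; linear_combination (-u / 2) * hr
  have hu2 : u ^ 2 = v ^ 2 / 2 := by rw [hu]; linear_combination (v ^ 2 / 4) * hr
  ext i
  fin_cases i <;> simp only [reducedField, Fin.zero_eta, Fin.mk_one, Fin.reduceFinMk,
    Matrix.cons_val, Pi.zero_apply]
  · rw [hu2, ← hW, ← h0]
    ring
  · rw [hu2]
    linear_combination 2 * h1
  · rw [hu2, ← hW]
    linear_combination (r / 2) * h2 + (2 * C * S ^ 2 + K + v ^ 2 - 2) * hu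
  · rw [hu2, ← hv]
    linear_combination w * h3

theorem omegaT_eq_of_sq {C g : ℝ} {S K u w v W : ℂ}
    (hv : v = ((√2 : ℝ) : ℂ) * u) (hW : W = w ^ 2) :
    omegaT C g ![S, K, u, w] = (1 - C * S ^ 2 - K - v ^ 2 / 2 + W) / (g - 1) := by
  have hr := ofReal_sqrt_two_sq
  generalize ((√2 : ℝ) : ℂ) = r at hv hr ⊢
  have hu2 : u ^ 2 = v ^ 2 / 2 := by rw [hv]; linear_combination (-u ^ 2 / 2) * hr
  simp [omegaT, hu2, hW]

theorem sqrt_two_ofReal_ne_zero : ((√2 : ℝ) : ℂ) ≠ 0 := by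
  exact_mod_cast (Real.sqrt_pos.2 two_pos).ne'

theorem dd_pos {C g : ℝ} (l : ℝ) (hC : 0 < C) (hg1 : 1 < g) : 0 < dd C g l := by
  have : 0 < g - 1 := sub_pos.2 hg1
  rw [dd]
  positivity

theorem qq_eq (C g l : ℝ) : qq C g l = (3 * g - 2) ^ 2 - 2 * dd C g l := by
  rw [qq, dd]
  ring

section P13L

variable {C g l : ℝ}

theorem ptP13L_eq (C g l : ℝ) : ptP13L C g l =
    ![-(2 * ((g : ℂ) - 1) * (3 * g - 2)) / dd C g l, 0,
      g * (3 * g - 2) * l / (((√2 : ℝ) : ℂ) * dd C g l), ptP13L C g l 3] := by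
  ext i
  fin_cases i <;> simp [ptP13L]

theorem ptP13L_w_sq (C l : ℝ) (hg1 : 1 < g) :
    (g * (3 * g - 2) * l ^ 2 * qq C g l / (2 * (dd C g l : ℂ) ^ 2)) = (ptP13L C g l 3) ^ 2 := by
  have h1 : ((√g : ℝ) : ℂ) ^ 2 = g := by
    rw [← Complex.ofReal_pow, Real.sq_sqrt (by linarith)]
  have h2 : ((√(3 * g - 2) : ℝ) : ℂ) ^ 2 = 3 * g - 2 := by
    rw [← Complex.ofReal_pow, Real.sq_sqrt (by linarith)]
    push_cast
    rfl
  simp only [ptP13L, Matrix.cons_val, div_pow, mul_pow, complexSqrt_sq, Complex.ofReal_mul, h1, h2,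
    ofReal_sqrt_two_sq]

theorem ptP13L_v : (g : ℂ) * (3 * g - 2) * l / dd C g l =
    ((√2 : ℝ) : ℂ) * (g * (3 * g - 2) * l / (((√2 : ℝ) : ℂ) * dd C g l)) := by
  have := sqrt_two_ofReal_ne_zero
  field_simp

theorem ofReal_dd (C g l : ℝ) :
    ((dd C g l : ℝ) : ℂ) = 8 * C * ((g : ℂ) - 1) ^ 2 + (g : ℂ) ^ 2 * (l : ℂ) ^ 2 := by
  simp [dd]

theorem ofReal_qq (C g l : ℝ) : ((qq C g l : ℝ) : ℂ) = (3 * (g : ℂ) - 2) ^ 2 - 2 * dd C g l := by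
  rw [qq_eq]
  push_cast
  rfl

theorem complexField_ptP13L (hC : 0 < C) (hg1 : 1 < g) (hl : 0 < l) :
    complexField C g l (ptP13L C g l) = 0 := by
  have hg := ofReal_sub_one_ne_zero hg1
  have hC' : (C : ℂ) ≠ 0 := by exact_mod_cast hC.ne'
  have hl' : (l : ℂ) ≠ 0 := by exact_mod_cast hl.ne'
  have hD : ((dd C g l : ℝ) : ℂ) ≠ 0 := by exact_mod_cast (dd_pos l hC hg1).ne'
  have hDe := ofReal_dd C g l
  rw [ptP13L_eq]
  refine complexField_eq_zero_of_sq ptP13L_v (ptP13L_w_sq C l hg1) ?_ (zero_mul _) ?_ ?_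
  all_goals
    try rw [ofReal_qq]
    generalize ((dd C g l : ℝ) : ℂ) = D at hD hDe ⊢
    field_simp
    rw [hDe]
    ring

theorem omegaT_ptP13L (hC : 0 < C) (hg1 : 1 < g) :
    omegaT C g (ptP13L C g l) =
      (((g * l ^ 2 - 4 * (g - 1) * C) * qq C g l / dd C g l ^ 2 : ℝ) : ℂ) := by
  have hg := ofReal_sub_one_ne_zero hg1
  have hD : ((dd C g l : ℝ) : ℂ) ≠ 0 := by exact_mod_cast (dd_pos l hC hg1).ne'
  have hDe := ofReal_dd C g l
  rw [ptP13L_eq, omegaT_eq_of_sq ptP13L_v (ptP13L_w_sq C l hg1)]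
  push_cast
  rw [ofReal_qq]
  generalize ((dd C g l : ℝ) : ℂ) = D at hD hDe ⊢
  field_simp
  rw [hDe]
  ring

theorem det_scalar_sub_reducedJacobian_ptP13L (hC : 0 < C) (hg1 : 1 < g) (hl : 0 < l) (t : ℂ) :
    (Matrix.scalar (Fin 4) t - reducedJacobian ((√2 : ℝ) : ℂ) C g l (ptP13L C g l)).det =
      (t - (-2 + (2 - 3 * g) ^ 2 / dd C g l)) * (t - (-2 + 2 * (2 - 3 * g) ^ 2 / dd C g l)) *
      (t ^ 2 - qq C g l / dd C g l * t + qq C g l * (g * (3 * g - 2) *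
        (g * l ^ 2 - 4 * (g - 1) * C)) / (2 * (g - 1) * C * dd C g l ^ 2)) := by
  have hg := ofReal_sub_one_ne_zero hg1
  have hC' : (C : ℂ) ≠ 0 := by exact_mod_cast hC.ne'
  have hl' : (l : ℂ) ≠ 0 := by exact_mod_cast hl.ne'
  have hD : ((dd C g l : ℝ) : ℂ) ≠ 0 := by exact_mod_cast (dd_pos l hC hg1).ne'
  have hDe := ofReal_dd C g l
  rw [ptP13L_eq, det_scalar_sub_reducedJacobian_of_K_eq_zero _ _ _ _ _ _ _ _ _ _ hC' hg
      ofReal_sqrt_two_sq ptP13L_v (ptP13L_w_sq C l hg1), ofReal_qq]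
  generalize ((dd C g l : ℝ) : ℂ) = D at hD hDe ⊢
  -- the equation `w' = 0` makes one diagonal entry vanish
  have h0 : 2 * (C : ℂ) * (-(2 * ((g : ℂ) - 1) * (3 * g - 2)) / D) ^ 2 +
      -(2 * ((g : ℂ) - 1) * (3 * g - 2)) / D + (g * (3 * g - 2) * l / D) ^ 2 -
      g * (3 * g - 2) * l / D / l = 0 := by
    field_simp
    rw [hDe]
    ring
  have hk : 4 * (C : ℂ) * (-(2 * ((g : ℂ) - 1) * (3 * g - 2)) / D) ^ 2 +
      2 * (g * (3 * g - 2) * l / D) ^ 2 - 2 = -2 + 2 * (2 - 3 * g) ^ 2 / D := by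
    field_simp
    rw [hDe]
    ring
  have ha : (3 * (g : ℂ) - 2) * (-(2 * (g - 1) * (3 * g - 2)) / D) / (g - 1) +
      6 * C * (-(2 * (g - 1) * (3 * g - 2)) / D) ^ 2 + (g * (3 * g - 2) * l / D) ^ 2 - 2 =
      -2 + (3 * g - 2) ^ 2 / D - 2 * (3 * g - 2) ^ 2 * g ^ 2 * l ^ 2 / D ^ 2 := by
    field_simp
    rw [hDe]
    ring
  have hc : 2 * (C : ℂ) * (-(2 * (g - 1) * (3 * g - 2)) / D) ^ 2 +
      3 * (g * (3 * g - 2) * l / D) ^ 2 - 2 =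
      -2 + (3 * g - 2) ^ 2 / D + 2 * (3 * g - 2) ^ 2 * g ^ 2 * l ^ 2 / D ^ 2 := by
    field_simp
    rw [hDe]
    ring
  rw [h0, hk, ha, hc, sub_zero, mul_comm (t - (-2 + (2 - 3 * (g : ℂ)) ^ 2 / D)),
    mul_assoc (t - (-2 + 2 * (2 - 3 * (g : ℂ)) ^ 2 / D))]
  congr 1
  field_simp
  rw [hDe]
  ring

end P13L

section P13LSpectrum

variable {C g l : ℝ}

theorem radicandP13L_eq (C g l : ℝ) : radicandP13L C g l =
    (g - 1) * C * dd C g l ^ 2 * qq C g l *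
      ((g - 1) * C * qq C g l - 2 * (g * (3 * g - 2) * (g * l ^ 2 - 4 * (g - 1) * C))) := by
  have h : (g - 1) * C * qq C g l - 2 * (g * (3 * g - 2) * (g * l ^ 2 - 4 * (g - 1) * C)) =
      -(2 * g ^ 2 * (3 * g - 2) * l ^ 2 +
      (g - 1) * C * (-4 + g * (28 + g * (-33 + 2 * l ^ 2)) + 16 * (g - 1) ^ 2 * C)) := by
    rw [qq]
    ring
  rw [h, radicandP13L]
  ring

theorem pairP13L_sub_mul_sub (hC : 0 < C) (hg1 : 1 < g) (l : ℝ) (t : ℂ) :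
    (t - -((((g - 1) * C * dd C g l * (-qq C g l) : ℝ) : ℂ) +
        Complex.sqrt ((radicandP13L C g l : ℝ) : ℂ)) /
          ((2 * (g - 1) * C * dd C g l ^ 2 : ℝ) : ℂ)) *
      (t - (-(((g - 1) * C * dd C g l * (-qq C g l) : ℝ) : ℂ) +
        Complex.sqrt ((radicandP13L C g l : ℝ) : ℂ)) /
          ((2 * (g - 1) * C * dd C g l ^ 2 : ℝ) : ℂ)) =
      t ^ 2 - qq C g l / dd C g l * t + qq C g l * (g * (3 * g - 2) *
        (g * l ^ 2 - 4 * (g - 1) * C)) / (2 * (g - 1) * C * dd C g l ^ 2) := by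
  have hg := ofReal_sub_one_ne_zero hg1
  have hC' : (C : ℂ) ≠ 0 := by exact_mod_cast hC.ne'
  have hD : ((dd C g l : ℝ) : ℂ) ≠ 0 := by exact_mod_cast (dd_pos l hC hg1).ne'
  have hq := complexSqrt_sq ((radicandP13L C g l : ℝ) : ℂ)
  generalize Complex.sqrt ((radicandP13L C g l : ℝ) : ℂ) = σ at hq ⊢
  rw [radicandP13L_eq] at hq
  push_cast at hq ⊢
  generalize ((dd C g l : ℝ) : ℂ) = D at hD hq ⊢
  generalize ((qq C g l : ℝ) : ℂ) = q at hq ⊢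
  have hx : (2 * ((g : ℂ) - 1) * C * D ^ 2) ^ 2 ≠ 0 := by simp [hg, hC', hD]
  rw [← mul_right_inj' hx]
  transitivity (2 * ((g : ℂ) - 1) * C * D ^ 2 * t - (g - 1) * C * D * q) ^ 2 - σ ^ 2
  · field_simp
    ring
  · rw [hq]
    field_simp
    ring

theorem eigenvalues_ptP13L (hC : 0 < C) (hg1 : 1 < g) (hl : 0 < l) :
    eigenvalues C g l (ptP13L C g l) =
      {((-2 + (2 - 3 * g) ^ 2 / dd C g l : ℝ) : ℂ),
        ((-2 + 2 * (2 - 3 * g) ^ 2 / dd C g l : ℝ) : ℂ),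
        -((((g - 1) * C * dd C g l * (-qq C g l) : ℝ) : ℂ) +
            Complex.sqrt ((radicandP13L C g l : ℝ) : ℂ)) /
          ((2 * (g - 1) * C * dd C g l ^ 2 : ℝ) : ℂ),
        (-(((g - 1) * C * dd C g l * (-qq C g l) : ℝ) : ℂ) +
            Complex.sqrt ((radicandP13L C g l : ℝ) : ℂ)) /
          ((2 * (g - 1) * C * dd C g l ^ 2 : ℝ) : ℂ)} := by
  refine eigenvalues_eq_of_det_eq _ _ _ _ fun t => ?_
  rw [det_scalar_sub_reducedJacobian_ptP13L hC hg1 hl,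
    ← pairP13L_sub_mul_sub hC hg1 l t, ← mul_assoc]
  push_cast
  rfl

/-- The eigenvalues of the linearization at `P₁₃(λ)`, with the last two described by their sum and
product, which have a simpler form than the square root in the explicit formula. -/
theorem exists_eigenvalues_ptP13L (hC : 0 < C) (hg1 : 1 < g) (hl : 0 < l) :
    ∃ z w : ℂ, eigenvalues C g l (ptP13L C g l) =
      {((qq C g l / dd C g l : ℝ) : ℂ),
        ((2 * ((3 * g - 2) ^ 2 - dd C g l) / dd C g l : ℝ) : ℂ), z, w} ∧
      z + w = ((qq C g l / dd C g l : ℝ) : ℂ) ∧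
      z * w = ((qq C g l * (g * l ^ 2 - 4 * (g - 1) * C) *
        (g * (3 * g - 2) / (2 * (g - 1) * C * dd C g l ^ 2)) : ℝ) : ℂ) := by
  have hD := (dd_pos l hC hg1).ne'
  have h := pairP13L_sub_mul_sub hC hg1 l
  have hE := eigenvalues_ptP13L hC hg1 hl
  have h1 : -2 + (2 - 3 * g) ^ 2 / dd C g l = qq C g l / dd C g l := by
    rw [qq_eq]
    field_simp
    ring
  have h2 : -2 + 2 * (2 - 3 * g) ^ 2 / dd C g l =
      2 * ((3 * g - 2) ^ 2 - dd C g l) / dd C g l := by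
    field_simp
    ring
  rw [h1, h2] at hE
  refine ⟨_, _, hE, ?_, ?_⟩
  · rw [Complex.ofReal_div]
    linear_combination h 0 - h 1
  · push_cast at h ⊢
    linear_combination h 0

theorem tendsto_ptP13L (hC : 0 < C) (hg1 : 1 < g) :
    Tendsto (fun t : ℝ => ptP13L C g t) (𝓝[>] 0) (𝓝 (toComplex (ptP13 C g))) := by
  have hg : g - 1 ≠ 0 := (sub_pos.2 hg1).ne'
  have hD0 : dd C g 0 ≠ 0 := (dd_pos 0 hC hg1).ne'
  have hD : Continuous fun t : ℝ => dd C g t := by unfold dd; fun_prop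
  have hq : Continuous fun t : ℝ => qq C g t := by unfold qq; fun_prop
  have h2 : √2 * dd C g 0 ≠ 0 := mul_ne_zero (Real.sqrt_pos.2 two_pos).ne' hD0
  refine Tendsto.mono_left ?_ nhdsWithin_le_nhds
  rw [tendsto_pi_nhds]
  intro i
  fin_cases i
  · have h : (2 - 3 * g) / (4 * (g - 1) * C) = -(2 * (g - 1) * (3 * g - 2)) / dd C g 0 := by
      rw [dd]
      field_simp
      ring
    have hc : ContinuousAt (fun t : ℝ => -(2 * (g - 1) * (3 * g - 2)) / dd C g t) 0 :=
      continuousAt_const.div hD.continuousAt hD0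
    simp only [toComplex, ptP13, Matrix.cons_val_zero, Fin.zero_eta, h]
    exact (Complex.continuous_ofReal.tendsto _).comp hc.tendsto
  · simp [ptP13L, toComplex, ptP13]
  · have hc : ContinuousAt (fun t : ℝ => g * (3 * g - 2) * t / (√2 * dd C g t)) 0 :=
      ContinuousAt.div (by fun_prop) (by fun_prop) h2
    simpa [toComplex, ptP13, ptP13L, Function.comp_def] using
      (Complex.continuous_ofReal.tendsto _).comp hc.tendsto
  -- the principal square root may jump, but its norm is continuous
  · have hc : ContinuousAt (fun t : ℝ =>
        |√g * √(3 * g - 2) * t| * √|qq C g t| / |√2 * dd C g t|) 0 :=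
      ContinuousAt.div (by fun_prop) (by fun_prop) (abs_ne_zero.2 h2)
    have h0 := hc.tendsto
    simp only [mul_zero, abs_zero, zero_mul, zero_div] at h0
    have : toComplex (ptP13 C g) 3 = 0 := by simp [toComplex, ptP13]
    simp only [Fin.reduceFinMk, this]
    refine tendsto_zero_iff_norm_tendsto_zero.2 (h0.congr fun t => ?_)
    simp only [ptP13L, Matrix.cons_val, norm_div, norm_mul, norm_complexSqrt_ofReal,
      Complex.norm_real, Real.norm_eq_abs, abs_mul]

end P13LSpectrum

/-! ### The points `P₁₄(λ)` and `P₁₅(λ)` -/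

section P14L

variable {C g l : ℝ}

theorem three_mul_ofReal_sub_two_ne_zero (hg1 : 1 < g) : 3 * (g : ℂ) - 2 ≠ 0 := by
  have : 3 * g - 2 ≠ 0 := by linarith
  exact_mod_cast this

theorem ptP14L_eq (C g l : ℝ) : ptP14L C g l =
    ![-(2 * ((g : ℂ) - 1)) / (3 * g - 2),
      (4 - 8 * C * (g - 1) ^ 2 - g * (g * (l ^ 2 - 9) + 12)) / (3 * (g : ℂ) - 2) ^ 2,
      g * l / (((√2 : ℝ) : ℂ) * (3 * g - 2)), ptP14L C g l 3] := by
  have h : (2 - 3 * (g : ℂ)) ^ 2 = (3 * g - 2) ^ 2 := by ring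
  ext i
  fin_cases i <;> simp [ptP14L, h]

theorem ptP14L_v : (g : ℂ) * l / (3 * g - 2) =
    ((√2 : ℝ) : ℂ) * (g * l / (((√2 : ℝ) : ℂ) * (3 * g - 2))) := by
  have := sqrt_two_ofReal_ne_zero
  field_simp

theorem ptP14L_w_sq (C l : ℝ) (hg1 : 1 < g) :
    -(g * l ^ 2) / (2 * (3 * (g : ℂ) - 2)) = (ptP14L C g l 3) ^ 2 := by
  have hg0 : (g : ℂ) ≠ 0 := by
    have : g ≠ 0 := by linarith
    exact_mod_cast this
  have hh := three_mul_ofReal_sub_two_ne_zero hg1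
  have h : (4 : ℂ) / g - 6 = -(2 * (3 * g - 2)) / g := by
    field_simp
    ring
  simp only [ptP14L, Matrix.cons_val, div_pow, complexSqrt_sq]
  push_cast
  rw [h]
  field_simp

theorem complexField_ptP14L (hC : 0 < C) (hg1 : 1 < g) (hl : 0 < l) :
    complexField C g l (ptP14L C g l) = 0 := by
  have hg := ofReal_sub_one_ne_zero hg1
  have hh := three_mul_ofReal_sub_two_ne_zero hg1
  have hC' : (C : ℂ) ≠ 0 := by exact_mod_cast hC.ne'
  have hl' : (l : ℂ) ≠ 0 := by exact_mod_cast hl.ne'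
  rw [ptP14L_eq]
  refine complexField_eq_zero_of_sq ptP14L_v (ptP14L_w_sq C l hg1) ?_ ?_ ?_ ?_
  all_goals
    generalize he : 3 * (g : ℂ) - 2 = h at hh ⊢
    field_simp
    rw [← he]
    ring

theorem omegaT_ptP14L (hg1 : 1 < g) :
    omegaT C g (ptP14L C g l) =
      (((4 * (g - 1) * C - g * l ^ 2) / (2 - 3 * g) ^ 2 : ℝ) : ℂ) := by
  have hg := ofReal_sub_one_ne_zero hg1
  have hh := three_mul_ofReal_sub_two_ne_zero hg1
  have h : (2 - 3 * (g : ℂ)) ^ 2 = (3 * g - 2) ^ 2 := by ring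
  rw [ptP14L_eq, omegaT_eq_of_sq ptP14L_v (ptP14L_w_sq C l hg1)]
  push_cast
  rw [h]
  generalize he : 3 * (g : ℂ) - 2 = h at hh ⊢
  field_simp
  rw [← he]
  ring

theorem tendsto_ptP14L (hg1 : 1 < g) :
    Tendsto (fun t : ℝ => ptP14L C g t) (𝓝[>] 0) (𝓝 (toComplex (ptP14 C g))) := by
  have hh : 2 - 3 * g ≠ 0 := by linarith
  have hc : Continuous fun t : ℝ => ptP14L C g t := by
    rw [continuous_pi_iff]
    intro i
    fin_cases i <;> simp only [ptP14L, Fin.zero_eta, Fin.mk_one, Fin.reduceFinMk,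
      Matrix.cons_val] <;> fun_prop
  have h0 : ptP14L C g 0 = toComplex (ptP14 C g) := by
    rw [ptP14, toComplex_cons]
    ext i
    fin_cases i
    · simp [ptP14L]
    · simp only [ptP14L, Fin.mk_one, Matrix.cons_val]
      congr 1
      generalize he : 2 - 3 * g = h at hh ⊢
      field_simp
      rw [← he]
      ring
    · simp [ptP14L]
    · simp [ptP14L]
  rw [← h0]
  exact hc.continuousAt.tendsto.mono_left nhdsWithin_le_nhds

end P14L

section P15L

variable {C g l : ℝ}

theorem ptP15L_eq (C l : ℝ) : ptP15L C l =
    ![-(1 / (2 * (C : ℂ))), 0, 1 / (((√2 : ℝ) : ℂ) * l), ptP15L C l 3] := by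
  ext i
  fin_cases i <;> simp [ptP15L]

theorem ptP15L_v (l : ℝ) : (1 : ℂ) / l = ((√2 : ℝ) : ℂ) * (1 / (((√2 : ℝ) : ℂ) * l)) := by
  have := sqrt_two_ofReal_ne_zero
  field_simp

theorem ptP15L_w_sq (l : ℝ) (hC : 0 < C) :
    ((l : ℂ) ^ 2 + (2 - 4 * l ^ 2) * C) / (4 * l ^ 2 * C) = (ptP15L C l 3) ^ 2 := by
  have h1 : ((√C : ℝ) : ℂ) ^ 2 = C := by
    rw [← Complex.ofReal_pow, Real.sq_sqrt hC.le]
  simp only [ptP15L, Matrix.cons_val, div_pow, complexSqrt_sq, Complex.ofReal_mul, mul_pow, h1]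
  push_cast
  ring

theorem complexField_ptP15L (hC : 0 < C) (hg1 : 1 < g) (hl : 0 < l) :
    complexField C g l (ptP15L C l) = 0 := by
  have hg := ofReal_sub_one_ne_zero hg1
  have hC' : (C : ℂ) ≠ 0 := by exact_mod_cast hC.ne'
  have hl' : (l : ℂ) ≠ 0 := by exact_mod_cast hl.ne'
  rw [ptP15L_eq]
  refine complexField_eq_zero_of_sq (ptP15L_v l) (ptP15L_w_sq l hC) ?_ (zero_mul _) ?_ ?_
  · field_simp
    ring
  · field_simp
    ring
  · field_simp
    ring

theorem omegaT_ptP15L (g : ℝ) (hC : 0 < C) (hl : 0 < l) : omegaT C g (ptP15L C l) = 0 := by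
  have hC' : (C : ℂ) ≠ 0 := by exact_mod_cast hC.ne'
  have hl' : (l : ℂ) ≠ 0 := by exact_mod_cast hl.ne'
  rw [ptP15L_eq, omegaT_eq_of_sq (ptP15L_v l) (ptP15L_w_sq l hC), div_eq_zero_iff]
  left
  field_simp
  ring

theorem eigenvalues_ptP15L (hC : 0 < C) (hg1 : 1 < g) (hl : 0 < l) :
    eigenvalues C g l (ptP15L C l) =
      Multiset.map Complex.ofReal
        {1 / C + 2 / l ^ 2 - 2, g / (2 * C - 2 * g * C) + 2 / l ^ 2,
          1 / (2 * C) + 1 / l ^ 2 - 2, 1 / (2 * C) + 1 / l ^ 2 - 2} := by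
  have hg := ofReal_sub_one_ne_zero hg1
  have hC' : (C : ℂ) ≠ 0 := by exact_mod_cast hC.ne'
  have hl' : (l : ℂ) ≠ 0 := by exact_mod_cast hl.ne'
  have hgC : 2 * (C : ℂ) - 2 * g * C = -(2 * (g - 1) * C) := by ring
  simp only [Multiset.insert_eq_cons, Multiset.map_cons, Multiset.map_singleton]
  refine eigenvalues_eq_of_det_eq _ _ _ _ fun t => ?_
  rw [ptP15L_eq, det_scalar_sub_reducedJacobian_of_K_eq_zero _ _ _ _ _ _ _ _ _ _ hC' hg
      ofReal_sqrt_two_sq (ptP15L_v l) (ptP15L_w_sq l hC)]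
  push_cast
  rw [hgC]
  field_simp
  ring

end P15L

/-! ### The thresholds as polynomial inequalities -/

section Thresholds

variable {C g l : ℝ}

theorem lamO_eq (C g : ℝ) : lamO C g = √(4 * (g - 1) * C / g) := by
  have h : 4 * (g - 1) * C / g = 2 ^ 2 * ((g - 1) * C / g) := by ring
  rw [lamO, h, Real.sqrt_mul (by norm_num), Real.sqrt_sq (by norm_num)]

theorem lamX_eq (C g : ℝ) :
    lamX C g = √(((3 * g - 2) ^ 2 - 16 * (g - 1) ^ 2 * C) / (2 * g ^ 2)) := by
  have h : ((3 * g - 2) ^ 2 - 16 * (g - 1) ^ 2 * C) / (2 * g ^ 2) =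
      (1 / 2) ^ 2 * ((2 * (2 - 3 * g) ^ 2 - 32 * (g - 1) ^ 2 * C) / g ^ 2) := by
    field_simp
    ring
  rw [lamX, h, Real.sqrt_mul (by norm_num), Real.sqrt_sq (by norm_num)]

theorem lamA_eq (C : ℝ) : lamA C = √(2 * C / (2 * C - 1)) := by
  rw [lamA, ← Real.sqrt_mul (by norm_num), mul_div_assoc]

theorem lamB_eq (C : ℝ) : lamB C = √(2 * C / (4 * C - 1)) := by
  rw [lamB, ← Real.sqrt_mul (by norm_num), mul_div_assoc]

theorem lt_lamO_iff (hg1 : 1 < g) (hl : 0 < l) :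
    l < lamO C g ↔ g * l ^ 2 - 4 * (g - 1) * C < 0 := by
  rw [lamO_eq, Real.lt_sqrt hl.le, lt_div_iff₀ (by linarith), sub_neg, mul_comm g]

theorem lamO_lt_iff (hg1 : 1 < g) (hl : 0 < l) :
    lamO C g < l ↔ 0 < g * l ^ 2 - 4 * (g - 1) * C := by
  rw [lamO_eq, Real.sqrt_lt' hl, div_lt_iff₀ (by linarith), sub_pos, mul_comm g]

theorem lt_lamX_iff (hg1 : 1 < g) (hl : 0 < l) : l < lamX C g ↔ 0 < qq C g l := by
  have h : qq C g l = ((3 * g - 2) ^ 2 - 16 * (g - 1) ^ 2 * C) - l ^ 2 * (2 * g ^ 2) := by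
    rw [qq]
    ring
  rw [lamX_eq, Real.lt_sqrt hl.le, lt_div_iff₀ (by positivity), h, sub_pos]

theorem lamX_lt_iff (hg1 : 1 < g) (hl : 0 < l) : lamX C g < l ↔ qq C g l < 0 := by
  have h : qq C g l = ((3 * g - 2) ^ 2 - 16 * (g - 1) ^ 2 * C) - l ^ 2 * (2 * g ^ 2) := by
    rw [qq]
    ring
  rw [lamX_eq, Real.sqrt_lt' hl, div_lt_iff₀ (by positivity), h, sub_neg]

theorem lt_lamS_iff (hg1 : 1 < g) (hl : 0 < l) :
    l < lamS C g ↔ dd C g l < (3 * g - 2) ^ 2 := by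
  have h : dd C g l < (3 * g - 2) ^ 2 ↔
      l ^ 2 * g ^ 2 < (2 - 3 * g) ^ 2 - 8 * (g - 1) ^ 2 * C := by
    rw [dd]
    constructor <;> intro h <;> linarith
  rw [lamS, Real.lt_sqrt hl.le, lt_div_iff₀ (by positivity), h]

theorem lamS_lt_iff (hg1 : 1 < g) (hl : 0 < l) :
    lamS C g < l ↔ (3 * g - 2) ^ 2 < dd C g l := by
  have h : (3 * g - 2) ^ 2 < dd C g l ↔
      (2 - 3 * g) ^ 2 - 8 * (g - 1) ^ 2 * C < l ^ 2 * g ^ 2 := by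
    rw [dd]
    constructor <;> intro h <;> linarith
  rw [lamS, Real.sqrt_lt' hl, div_lt_iff₀ (by positivity), h]

theorem lt_lamA_iff (hC : 1 / 2 < C) (hl : 0 < l) :
    l < lamA C ↔ 0 < 2 * C - (2 * C - 1) * l ^ 2 := by
  rw [lamA_eq, Real.lt_sqrt hl.le, lt_div_iff₀ (by linarith), sub_pos, mul_comm (l ^ 2)]

theorem lamA_lt_iff (hC : 1 / 2 < C) (hl : 0 < l) :
    lamA C < l ↔ 2 * C - (2 * C - 1) * l ^ 2 < 0 := by
  rw [lamA_eq, Real.sqrt_lt' hl, div_lt_iff₀ (by linarith), sub_neg, mul_comm (l ^ 2)]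

theorem lt_lamB_iff (hC : 1 / 4 < C) (hl : 0 < l) :
    l < lamB C ↔ 0 < 2 * C - (4 * C - 1) * l ^ 2 := by
  rw [lamB_eq, Real.lt_sqrt hl.le, lt_div_iff₀ (by linarith), sub_pos, mul_comm (l ^ 2)]

theorem lamB_lt_iff (hC : 1 / 4 < C) (hl : 0 < l) :
    lamB C < l ↔ 2 * C - (4 * C - 1) * l ^ 2 < 0 := by
  rw [lamB_eq, Real.sqrt_lt' hl, div_lt_iff₀ (by linarith), sub_neg, mul_comm (l ^ 2)]

theorem eq_lamO_imp (hg1 : 1 < g) (hl : 0 < l) (h : l = lamO C g) :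
    g * l ^ 2 - 4 * (g - 1) * C = 0 :=
  le_antisymm (not_lt.1 fun h' => ((lamO_lt_iff hg1 hl).2 h').ne' h)
    (not_lt.1 fun h' => ((lt_lamO_iff hg1 hl).2 h').ne h)

theorem eq_lamS_imp (hg1 : 1 < g) (hl : 0 < l) (h : l = lamS C g) :
    (3 * g - 2) ^ 2 = dd C g l :=
  le_antisymm (not_lt.1 fun h' => ((lt_lamS_iff hg1 hl).2 h').ne h)
    (not_lt.1 fun h' => ((lamS_lt_iff hg1 hl).2 h').ne' h)

theorem eq_lamA_imp (hC : 1 / 2 < C) (hl : 0 < l) (h : l = lamA C) :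
    2 * C - (2 * C - 1) * l ^ 2 = 0 :=
  le_antisymm (not_lt.1 fun h' => ((lt_lamA_iff hC hl).2 h').ne h)
    (not_lt.1 fun h' => ((lamA_lt_iff hC hl).2 h').ne' h)

theorem eq_lamB_imp (hC : 1 / 4 < C) (hl : 0 < l) (h : l = lamB C) :
    2 * C - (4 * C - 1) * l ^ 2 = 0 :=
  le_antisymm (not_lt.1 fun h' => ((lt_lamB_iff hC hl).2 h').ne h)
    (not_lt.1 fun h' => ((lamB_lt_iff hC hl).2 h').ne' h)

theorem gam4_lt_iff (hC : 1 < C) : gam4 C < g ↔ 3 * g - 2 < 4 * C * (g - 1) := by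
  rw [gam4, div_lt_iff₀ (by linarith)]
  constructor <;> intro h <;> linarith

theorem lt_gam8_iff (hC : 1 / 2 < C) : g < gam8 C ↔ 8 * C * (g - 1) < 3 * g - 2 := by
  rw [gam8, lt_div_iff₀ (by linarith)]
  constructor <;> intro h <;> linarith

theorem gam8_lt_iff (hC : 1 / 2 < C) : gam8 C < g ↔ 3 * g - 2 < 8 * C * (g - 1) := by
  rw [gam8, div_lt_iff₀ (by linarith)]
  constructor <;> intro h <;> linarith

theorem le_gam4_iff (hC : 1 < C) : g ≤ gam4 C ↔ 4 * C * (g - 1) ≤ 3 * g - 2 := by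
  rw [← not_lt, gam4_lt_iff hC, not_lt]

theorem le_gam8_iff (hC : 1 / 2 < C) : g ≤ gam8 C ↔ 8 * C * (g - 1) ≤ 3 * g - 2 := by
  rw [← not_lt, gam8_lt_iff hC, not_lt]

theorem gam8_le_iff (hC : 1 / 2 < C) : gam8 C ≤ g ↔ 3 * g - 2 ≤ 8 * C * (g - 1) := by
  rw [← not_lt, lt_gam8_iff hC, not_lt]

/-- `gamT C` is the value of `γ` at which `lamS C γ` vanishes: with `d = 2√2√C` it is
`(d - 2) / (d - 3)`. -/
theorem sq_le_of_gamT_le (hC : 2 < C) (hg1 : 1 < g) (h : gamT C ≤ g) :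
    (3 * g - 2) ^ 2 ≤ 8 * C * (g - 1) ^ 2 := by
  have hC0 : 0 < 8 * C - 9 := by linarith
  have hd : (2 * √2 * √C) ^ 2 = 8 * C := by
    rw [mul_pow, mul_pow, Real.sq_sqrt (by norm_num), Real.sq_sqrt (by linarith)]
    ring
  rw [gamT, Real.sqrt_div' _ (sq_nonneg _), Real.sqrt_sq hC0.le, mul_div_assoc', ← add_div,
    div_le_iff₀ hC0] at h
  have hd0 : 0 ≤ 2 * √2 * √C := by positivity
  generalize 2 * √2 * √C = d at hd hd0 h
  have hd3 : 3 < d := by nlinarith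
  -- the numerator and the denominator of the threshold share the factor `d + 3`
  have hfac : (d - 2) * (d + 3) ≤ g * (d - 3) * (d + 3) := by nlinarith
  have hlin : 3 * g - 2 ≤ d * (g - 1) := by
    have := le_of_mul_le_mul_right hfac (by linarith)
    linarith
  calc (3 * g - 2) ^ 2 ≤ (d * (g - 1)) ^ 2 := pow_le_pow_left₀ (by linarith) hlin 2
    _ = 8 * C * (g - 1) ^ 2 := by rw [mul_pow, hd]

/-- `gamU C` is the value of `γ` at which `lamX C γ` vanishes: with `d = 4√C` it is
`(d - 2) / (d - 3)`. -/
theorem sq_le_of_gamU_le (hC : 1 < C) (hg1 : 1 < g) (h : gamU C ≤ g) :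
    (3 * g - 2) ^ 2 ≤ 16 * C * (g - 1) ^ 2 := by
  have hC0 : 0 < 16 * C - 9 := by linarith
  have hd : (4 * √C) ^ 2 = 16 * C := by
    rw [mul_pow, Real.sq_sqrt (by linarith)]
    ring
  rw [gamU, Real.sqrt_div' _ (sq_nonneg _), Real.sqrt_sq hC0.le, mul_div_assoc', ← add_div,
    div_le_iff₀ hC0] at h
  have hd0 : 0 ≤ 4 * √C := by positivity
  generalize 4 * √C = d at hd hd0 h
  have hd3 : 3 < d := by nlinarith
  -- the numerator and the denominator of the threshold share the factor `d + 3`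
  have hfac : (d - 2) * (d + 3) ≤ g * (d - 3) * (d + 3) := by nlinarith
  have hlin : 3 * g - 2 ≤ d * (g - 1) := by
    have := le_of_mul_le_mul_right hfac (by linarith)
    linarith
  calc (3 * g - 2) ^ 2 ≤ (d * (g - 1)) ^ 2 := pow_le_pow_left₀ (by linarith) hlin 2
    _ = 16 * C * (g - 1) ^ 2 := by rw [mul_pow, hd]

end Thresholds

/-! ### Pairs of complex numbers with real sum and product -/

section Pairs

variable {z w : ℂ} {a b : ℝ}

theorem re_im_of_add_mul_ofReal (hs : z + w = a) (hp : z * w = b) :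
    z.re + w.re = a ∧ z.re * w.re + z.im ^ 2 = b ∧ (z.im = 0 ∨ z.re = w.re) := by
  have h1 : z.re + w.re = a := by simpa using congrArg Complex.re hs
  have h2 : z.im + w.im = 0 := by simpa using congrArg Complex.im hs
  have h3 : z.re * w.re - z.im * w.im = b := by simpa using congrArg Complex.re hp
  have h4 : z.re * w.im + z.im * w.re = 0 := by simpa using congrArg Complex.im hp
  have h5 : w.im = -z.im := by linarith
  rw [h5] at h3 h4
  refine ⟨h1, by linarith, ?_⟩
  have h6 : z.im * (z.re - w.re) = 0 := by linarith
  rcases mul_eq_zero.1 h6 with h | h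
  · exact Or.inl h
  · exact Or.inr (by linarith)

theorem re_pos_of_add_pos_of_mul_pos (hs : z + w = a) (hp : z * w = b) (ha : 0 < a)
    (hb : 0 < b) : 0 < z.re ∧ 0 < w.re := by
  obtain ⟨h1, h2, h | h⟩ := re_im_of_add_mul_ofReal hs hp
  · have h3 : 0 < z.re * w.re := by rw [h] at h2; linarith
    rcases pos_and_pos_or_neg_and_neg_of_mul_pos h3 with h4 | h4
    · exact h4
    · linarith
  · constructor <;> linarith

theorem re_neg_of_add_neg_of_mul_pos (hs : z + w = a) (hp : z * w = b) (ha : a < 0)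
    (hb : 0 < b) : z.re < 0 ∧ w.re < 0 := by
  have h := re_pos_of_add_pos_of_mul_pos (z := -z) (w := -w) (a := -a) (b := b)
    (by push_cast; linear_combination -hs) (by linear_combination hp) (by linarith) hb
  simpa using h

theorem re_pos_and_re_neg_of_mul_neg (hs : z + w = a) (hp : z * w = b) (hb : b < 0) :
    (0 < z.re ∧ w.re < 0) ∨ (z.re < 0 ∧ 0 < w.re) := by
  obtain ⟨-, h2, h⟩ := re_im_of_add_mul_ofReal hs hp
  have h3 : z.re * w.re < 0 := by nlinarith [sq_nonneg z.im]
  exact mul_neg_iff.1 h3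

end Pairs

/-! ### Stability of `P₁₃(λ)` -/

section P13LStability

variable {C g l : ℝ}

theorem isSink_ptP13L (hC : 0 < C) (hg1 : 1 < g) (hl : 0 < l)
    (hD : (3 * g - 2) ^ 2 < dd C g l) (hb : g * l ^ 2 - 4 * (g - 1) * C < 0) :
    IsSink C g l (ptP13L C g l) := by
  refine ⟨complexField_ptP13L hC hg1 hl, ?_⟩
  obtain ⟨z, w, hE, hs, hp⟩ := exists_eigenvalues_ptP13L hC hg1 hl
  have hD0 := dd_pos l hC hg1
  have hg : 0 < g - 1 := sub_pos.2 hg1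
  have hh : 0 < 3 * g - 2 := by linarith
  have hc : 0 < g * (3 * g - 2) / (2 * (g - 1) * C * dd C g l ^ 2) := by positivity
  have hq : qq C g l < 0 := by rw [qq_eq]; linarith
  have h1 : qq C g l / dd C g l < 0 := div_neg_of_neg_of_pos hq hD0
  obtain ⟨h3, h4⟩ := re_neg_of_add_neg_of_mul_pos hs hp h1
    (mul_pos (mul_pos_of_neg_of_neg hq hb) hc)
  have h2 : 2 * ((3 * g - 2) ^ 2 - dd C g l) / dd C g l < 0 :=
    div_neg_of_neg_of_pos (by linarith) hD0
  intro x hx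
  rw [hE] at hx
  simp only [Multiset.insert_eq_cons, Multiset.mem_cons, Multiset.mem_singleton] at hx
  rcases hx with rfl | rfl | rfl | rfl
  · exact h1
  · exact h2
  · exact h3
  · exact h4

theorem isSource_ptP13L (hC : 0 < C) (hg1 : 1 < g) (hl : 0 < l)
    (hq : 0 < qq C g l) (hb : 0 < g * l ^ 2 - 4 * (g - 1) * C) :
    IsSource C g l (ptP13L C g l) := by
  refine ⟨complexField_ptP13L hC hg1 hl, ?_⟩
  obtain ⟨z, w, hE, hs, hp⟩ := exists_eigenvalues_ptP13L hC hg1 hl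
  have hD0 := dd_pos l hC hg1
  have hg : 0 < g - 1 := sub_pos.2 hg1
  have hh : 0 < 3 * g - 2 := by linarith
  have hc : 0 < g * (3 * g - 2) / (2 * (g - 1) * C * dd C g l ^ 2) := by positivity
  have h1 : 0 < qq C g l / dd C g l := div_pos hq hD0
  obtain ⟨h3, h4⟩ := re_pos_of_add_pos_of_mul_pos hs hp h1 (mul_pos (mul_pos hq hb) hc)
  have h2 : 0 < 2 * ((3 * g - 2) ^ 2 - dd C g l) / dd C g l := by
    rw [qq_eq] at hq
    exact div_pos (by linarith) hD0
  intro x hx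
  rw [hE] at hx
  simp only [Multiset.insert_eq_cons, Multiset.mem_cons, Multiset.mem_singleton] at hx
  rcases hx with rfl | rfl | rfl | rfl
  · exact h1
  · exact h2
  · exact h3
  · exact h4

theorem isNonhyperbolic_ptP13L (hC : 0 < C) (hg1 : 1 < g) (hl : 0 < l)
    (h : g * l ^ 2 - 4 * (g - 1) * C = 0 ∨ (3 * g - 2) ^ 2 = dd C g l) :
    IsNonhyperbolic C g l (ptP13L C g l) := by
  refine ⟨complexField_ptP13L hC hg1 hl, ?_⟩
  obtain ⟨z, w, hE, -, hp⟩ := exists_eigenvalues_ptP13L hC hg1 hl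
  rw [hE]
  rcases h with h | h
  · rw [h, mul_zero, zero_mul, Complex.ofReal_zero] at hp
    rcases mul_eq_zero.1 hp with rfl | rfl
    · exact ⟨0, by simp, by simp⟩
    · exact ⟨0, by simp, by simp⟩
  · exact ⟨_, Multiset.mem_cons_of_mem (Multiset.mem_cons_self _ _), by
      rw [h, sub_self, mul_zero, zero_div, Complex.ofReal_re]⟩

/-- If the product of the last two eigenvalues is negative, these are real of opposite signs. -/
theorem isSaddle_ptP13L_of_mul_neg (hC : 0 < C) (hg1 : 1 < g) (hl : 0 < l)
    (hD : (3 * g - 2) ^ 2 ≠ dd C g l) (h : qq C g l * (g * l ^ 2 - 4 * (g - 1) * C) < 0) :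
    IsSaddle C g l (ptP13L C g l) := by
  refine ⟨complexField_ptP13L hC hg1 hl, ?_⟩
  obtain ⟨z, w, hE, hs, hp⟩ := exists_eigenvalues_ptP13L hC hg1 hl
  have hD0 := dd_pos l hC hg1
  have hg : 0 < g - 1 := sub_pos.2 hg1
  have hh : 0 < 3 * g - 2 := by linarith
  have hc : 0 < g * (3 * g - 2) / (2 * (g - 1) * C * dd C g l ^ 2) := by positivity
  have hq : qq C g l ≠ 0 := fun h0 => by simp [h0] at h
  have h1 : qq C g l / dd C g l ≠ 0 := div_ne_zero hq hD0.ne'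
  have h2 : 2 * ((3 * g - 2) ^ 2 - dd C g l) / dd C g l ≠ 0 :=
    div_ne_zero (mul_ne_zero two_ne_zero (sub_ne_zero.2 hD)) hD0.ne'
  have h34 := re_pos_and_re_neg_of_mul_neg hs hp (mul_neg_of_neg_of_pos h hc)
  have h3 : z.re ≠ 0 := by rcases h34 with h | h <;> [exact h.1.ne'; exact h.1.ne]
  have h4 : w.re ≠ 0 := by rcases h34 with h | h <;> [exact h.2.ne; exact h.2.ne']
  rw [hE]
  refine ⟨?_, ?_⟩
  · intro x hx
    simp only [Multiset.insert_eq_cons, Multiset.mem_cons, Multiset.mem_singleton] at hx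
    rcases hx with rfl | rfl | rfl | rfl
    · exact h1
    · exact h2
    · exact h3
    · exact h4
  · rcases h34 with h | h
    · exact ⟨⟨z, by simp, h.1⟩, ⟨w, by simp, h.2⟩⟩
    · exact ⟨⟨w, by simp, h.2⟩, ⟨z, by simp, h.1⟩⟩

theorem isSaddle_ptP13L_of_neg (hC : 0 < C) (hg1 : 1 < g) (hl : 0 < l)
    (hD : dd C g l < (3 * g - 2) ^ 2) (hq : qq C g l < 0)
    (hb : g * l ^ 2 - 4 * (g - 1) * C < 0) :
    IsSaddle C g l (ptP13L C g l) := by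
  refine ⟨complexField_ptP13L hC hg1 hl, ?_⟩
  obtain ⟨z, w, hE, hs, hp⟩ := exists_eigenvalues_ptP13L hC hg1 hl
  have hD0 := dd_pos l hC hg1
  have hg : 0 < g - 1 := sub_pos.2 hg1
  have hh : 0 < 3 * g - 2 := by linarith
  have hc : 0 < g * (3 * g - 2) / (2 * (g - 1) * C * dd C g l ^ 2) := by positivity
  have h1 : qq C g l / dd C g l < 0 := div_neg_of_neg_of_pos hq hD0
  have h2 : 0 < 2 * ((3 * g - 2) ^ 2 - dd C g l) / dd C g l := div_pos (by linarith) hD0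
  obtain ⟨h3, h4⟩ := re_neg_of_add_neg_of_mul_pos hs hp h1
    (mul_pos (mul_pos_of_neg_of_neg hq hb) hc)
  rw [hE]
  refine ⟨?_, ⟨_, Multiset.mem_cons_of_mem (Multiset.mem_cons_self _ _), h2⟩,
    ⟨_, Multiset.mem_cons_self _ _, h1⟩⟩
  intro x hx
  simp only [Multiset.insert_eq_cons, Multiset.mem_cons, Multiset.mem_singleton] at hx
  rcases hx with rfl | rfl | rfl | rfl
  · exact h1.ne
  · exact h2.ne'
  · exact h3.ne
  · exact h4.ne

theorem SinkP13L.isSink (h : SinkP13L C g l) (hC : 0 < C) (hg1 : 1 < g) (hl : 0 < l) :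
    IsSink C g l (ptP13L C g l) := by
  rw [SinkP13L, lt_lamO_iff hg1 hl, lamS_lt_iff hg1 hl] at h
  rcases h with ⟨-, -, -, -, h1, h2⟩ | ⟨-, -, -, h1, h2⟩ | ⟨c, h1, -, -, h2⟩
  · exact isSink_ptP13L hC hg1 hl h1 h2
  · exact isSink_ptP13L hC hg1 hl h1 h2
  · refine isSink_ptP13L hC hg1 hl ((sq_le_of_gamT_le c hg1 h1).trans_lt ?_) h2
    rw [dd]
    exact lt_add_of_pos_right _ (by positivity)

theorem SourceP13L.isSource (h : SourceP13L C g l) (hC : 0 < C) (hg1 : 1 < g) (hl : 0 < l) :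
    IsSource C g l (ptP13L C g l) := by
  rw [SourceP13L, lamO_lt_iff hg1 hl, lt_lamX_iff hg1 hl] at h
  rcases h with ⟨-, -, -, -, h1, h2⟩ | ⟨-, -, -, h1, h2⟩
  · exact isSource_ptP13L hC hg1 hl h2 h1
  · exact isSource_ptP13L hC hg1 hl h2 h1

theorem NonhypP13L.isNonhyperbolic (h : NonhypP13L C g l) (hC : 0 < C) (hg1 : 1 < g)
    (hl : 0 < l) : IsNonhyperbolic C g l (ptP13L C g l) := by
  have h' : l = lamO C g ∨ l = lamS C g := by
    rw [NonhypP13L] at h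
    tauto
  exact isNonhyperbolic_ptP13L hC hg1 hl
    (h'.imp (eq_lamO_imp hg1 hl) (eq_lamS_imp hg1 hl))

/-- The identity that orders `lamX` and `lamO`: the sign of `3γ - 2 - 8C(γ - 1)` decides. -/
theorem qq_eq_sub_mul (C g l : ℝ) : qq C g l =
    (3 * g - 2) * (3 * g - 2 - 8 * C * (g - 1)) - 2 * g * (g * l ^ 2 - 4 * (g - 1) * C) := by
  rw [qq]
  ring

theorem SaddleP13L.isSaddle (h : SaddleP13L C g l) (hC : 0 < C) (hg1 : 1 < g) (hl : 0 < l) :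
    IsSaddle C g l (ptP13L C g l) := by
  have hh : 0 < 3 * g - 2 := by linarith
  have hg0 : 0 < g := by linarith
  have hD0 := dd_pos l hC hg1
  have hqb := qq_eq_sub_mul C g l
  have hqD := qq_eq C g l
  -- left of `lamO`, when `lamO ≤ lamX`
  have left : 8 * C * (g - 1) ≤ 3 * g - 2 → g * l ^ 2 - 4 * (g - 1) * C < 0 →
      IsSaddle C g l (ptP13L C g l) := fun h1 h2 => by
    have hq : 0 < qq C g l := by
      rw [hqb]
      nlinarith [mul_nonneg hh.le (sub_nonneg.2 h1), mul_neg_of_pos_of_neg hg0 h2]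
    refine isSaddle_ptP13L_of_mul_neg hC hg1 hl (by intro h; linarith)
      (mul_neg_of_pos_of_neg hq h2)
  -- right of `lamX` and off `lamS`, when `lamO < lamX`
  have right : 8 * C * (g - 1) < 3 * g - 2 → qq C g l < 0 → (3 * g - 2) ^ 2 ≠ dd C g l →
      IsSaddle C g l (ptP13L C g l) := fun h1 h2 h3 => by
    have hb : 0 < g * l ^ 2 - 4 * (g - 1) * C := by
      by_contra! hb
      nlinarith [mul_pos hh (sub_pos.2 h1), mul_nonneg hg0.le (sub_nonneg.2 hb)]
    exact isSaddle_ptP13L_of_mul_neg hC hg1 hl h3 (mul_neg_of_neg_of_pos h2 hb)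
  -- left of `lamS`, when `lamX < lamO`
  have middle : 3 * g - 2 < 8 * C * (g - 1) → dd C g l < (3 * g - 2) ^ 2 → l ≠ lamX C g →
      l ≠ lamO C g → IsSaddle C g l (ptP13L C g l) := fun h1 h2 h3 h4 => by
    rcases h3.lt_or_gt with h3 | h3
    · rw [lt_lamX_iff hg1 hl] at h3
      have hb : g * l ^ 2 - 4 * (g - 1) * C < 0 := by
        by_contra! hb
        nlinarith [mul_pos hh (sub_pos.2 h1), mul_nonneg hg0.le hb]
      exact isSaddle_ptP13L_of_mul_neg hC hg1 hl h2.ne' (mul_neg_of_pos_of_neg h3 hb)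
    · rw [lamX_lt_iff hg1 hl] at h3
      rcases h4.lt_or_gt with h4 | h4
      · exact isSaddle_ptP13L_of_neg hC hg1 hl h2 h3 ((lt_lamO_iff hg1 hl).1 h4)
      · exact isSaddle_ptP13L_of_mul_neg hC hg1 hl h2.ne'
          (mul_neg_of_neg_of_pos h3 ((lamO_lt_iff hg1 hl).1 h4))
  -- right of `lamO` and off `lamS`, when `lamX ≤ lamO`
  have far : 3 * g - 2 ≤ 8 * C * (g - 1) → 0 < g * l ^ 2 - 4 * (g - 1) * C →
      (3 * g - 2) ^ 2 ≠ dd C g l → IsSaddle C g l (ptP13L C g l) := fun h1 h2 h3 => by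
    have hq : qq C g l < 0 := by
      rw [hqb]
      nlinarith [mul_nonneg hh.le (sub_nonneg.2 h1), mul_pos hg0 h2]
    exact isSaddle_ptP13L_of_mul_neg hC hg1 hl h3 (mul_neg_of_neg_of_pos hq h2)
  have offS : l ≠ lamS C g → (3 * g - 2) ^ 2 ≠ dd C g l := fun h h' => by
    rcases h.lt_or_gt with h | h
    · exact ((lt_lamS_iff hg1 hl).1 h).ne' h'
    · exact ((lamS_lt_iff hg1 hl).1 h).ne h'
  have small : C ≤ 1 / 2 → g < 2 → 8 * C * (g - 1) < 3 * g - 2 := fun h1 h2 => by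
    nlinarith [mul_nonneg (sub_nonneg.2 h1) (sub_pos.2 hg1).le]
  have hneg : (3 * g - 2) ^ 2 < dd C g l → qq C g l < 0 := fun h => by linarith
  rw [SaddleP13L, lt_lamO_iff hg1 hl, lamO_lt_iff hg1 hl, lamX_lt_iff hg1 hl, lt_lamS_iff hg1 hl,
    lamS_lt_iff hg1 hl] at h
  rcases h with ⟨-, c, -, h2, -, h3⟩ | ⟨-, c, -, h2, h3, h4⟩ | ⟨-, c, -, h2, h3⟩ |
    ⟨c, -, -, h2, -, h3⟩ | ⟨c, -, -, h2, h3, h4⟩ | ⟨c, -, -, h2, h3⟩ |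
    ⟨c, -, h1, -, -, h2, h3, h4⟩ | ⟨c, -, h1, -, h2, h3⟩ | ⟨c, -, h2, -, h3⟩ |
    ⟨c, -, h2, h3, h4⟩ | ⟨c, -, h2, h3⟩ | ⟨c, h1, -, -, h2, h3, h4⟩ | ⟨c, h1, -, h2, h3⟩ |
    ⟨c, h1, -, h2⟩
  · exact left (small c h2).le h3
  · exact right (small c h2) h3 h4.ne'
  · exact right (small c h2) (hneg h3) h3.ne
  · exact left ((le_gam8_iff c).1 h2) h3
  · exact right ((lt_gam8_iff c).1 h2) h3 h4.ne'
  · exact right ((lt_gam8_iff c).1 h2) (hneg h3) h3.ne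
  · exact middle ((gam8_lt_iff c).1 h1) h2 h3 h4
  · exact far ((gam8_le_iff c).1 h1) h2 (offS h3)
  · exact left ((le_gam8_iff (by linarith)).1 h2) h3
  · exact right ((lt_gam8_iff (by linarith)).1 h2) h3 h4.ne'
  · exact right ((lt_gam8_iff (by linarith)).1 h2) (hneg h3) h3.ne
  · exact middle ((gam8_lt_iff (by linarith)).1 h1) h2 h3 h4
  · exact far ((gam8_le_iff (by linarith)).1 h1) h2 (offS h3)
  -- here `lamX = 0`, and `lamS < lamO < λ`
  · have h3 := sq_le_of_gamU_le c hg1 h1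
    have hg : 0 < g - 1 := sub_pos.2 hg1
    have h4 : 3 * g - 2 < 4 * C * (g - 1) := by
      refine lt_of_pow_lt_pow_left₀ 2 (by positivity) (h3.trans_lt ?_)
      nlinarith [mul_pos (mul_pos hC (sub_pos.2 c)) (pow_pos hg 2)]
    have h5 : (3 * g - 2) ^ 2 < dd C g l := by
      rw [dd]
      nlinarith [mul_pos hh (sub_pos.2 h4), mul_pos hg0 h2]
    exact isSaddle_ptP13L_of_mul_neg hC hg1 hl h5.ne (mul_neg_of_neg_of_pos (hneg h5) h2)

end P13LStability

/-! ### Stability of `P₁₅(λ)` -/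

section P15LStability

variable {C g l : ℝ}

theorem curvatureEigenvalueP15L_eq (hC : 0 < C) (hl : 0 < l) :
    1 / C + 2 / l ^ 2 - 2 = (2 * C - (2 * C - 1) * l ^ 2) / (C * l ^ 2) := by
  field_simp
  ring

theorem fluidEigenvalueP15L_eq (hC : 0 < C) (hg1 : 1 < g) (hl : 0 < l) :
    g / (2 * C - 2 * g * C) + 2 / l ^ 2 =
      -(g * l ^ 2 - 4 * (g - 1) * C) / (2 * (g - 1) * C * l ^ 2) := by
  have hg : g - 1 ≠ 0 := (sub_pos.2 hg1).ne'
  have h : 2 * C - 2 * g * C = -(2 * (g - 1) * C) := by ring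
  rw [h]
  field_simp
  ring

theorem scalarEigenvalueP15L_eq (hC : 0 < C) (hl : 0 < l) :
    1 / (2 * C) + 1 / l ^ 2 - 2 = (2 * C - (4 * C - 1) * l ^ 2) / (2 * C * l ^ 2) := by
  field_simp
  ring

/-- The eigenvalues at `P₁₅(λ)` as quotients of the polynomials that define the thresholds `lamA`,
`lamO`, `lamB` by positive numbers. -/
theorem eigenvalues_ptP15L_eq_div (hC : 0 < C) (hg1 : 1 < g) (hl : 0 < l) :
    eigenvalues C g l (ptP15L C l) =
      Multiset.map Complex.ofReal
        {(2 * C - (2 * C - 1) * l ^ 2) / (C * l ^ 2),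
          -(g * l ^ 2 - 4 * (g - 1) * C) / (2 * (g - 1) * C * l ^ 2),
          (2 * C - (4 * C - 1) * l ^ 2) / (2 * C * l ^ 2),
          (2 * C - (4 * C - 1) * l ^ 2) / (2 * C * l ^ 2)} := by
  rw [eigenvalues_ptP15L hC hg1 hl, curvatureEigenvalueP15L_eq hC hl,
    fluidEigenvalueP15L_eq hC hg1 hl, scalarEigenvalueP15L_eq hC hl]

theorem isSink_ptP15L (hC : 0 < C) (hg1 : 1 < g) (hl : 0 < l)
    (hA : 2 * C - (2 * C - 1) * l ^ 2 < 0) (hO : 0 < g * l ^ 2 - 4 * (g - 1) * C) :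
    IsSink C g l (ptP15L C l) := by
  refine ⟨complexField_ptP15L hC hg1 hl, ?_⟩
  have hg : 0 < g - 1 := sub_pos.2 hg1
  have hB : 2 * C - (4 * C - 1) * l ^ 2 < 0 := by
    have : 0 < 2 * C * l ^ 2 := by positivity
    linarith
  rw [eigenvalues_ptP15L_eq_div hC hg1 hl]
  simp only [Multiset.mem_map, forall_exists_index, and_imp, forall_apply_eq_imp_iff₂,
    Complex.ofReal_re, Multiset.insert_eq_cons, Multiset.mem_cons, Multiset.mem_singleton]
  rintro x (rfl | rfl | rfl | rfl)
  · exact div_neg_of_neg_of_pos hA (by positivity)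
  · exact div_neg_of_neg_of_pos (neg_neg_of_pos hO) (by positivity)
  · exact div_neg_of_neg_of_pos hB (by positivity)
  · exact div_neg_of_neg_of_pos hB (by positivity)

theorem isSource_ptP15L (hC : 0 < C) (hg1 : 1 < g) (hl : 0 < l)
    (hB : 0 < 2 * C - (4 * C - 1) * l ^ 2) (hO : g * l ^ 2 - 4 * (g - 1) * C < 0) :
    IsSource C g l (ptP15L C l) := by
  refine ⟨complexField_ptP15L hC hg1 hl, ?_⟩
  have hg : 0 < g - 1 := sub_pos.2 hg1
  have hA : 0 < 2 * C - (2 * C - 1) * l ^ 2 := by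
    have : 0 < 2 * C * l ^ 2 := by positivity
    linarith
  rw [eigenvalues_ptP15L_eq_div hC hg1 hl]
  simp only [Multiset.mem_map, forall_exists_index, and_imp, forall_apply_eq_imp_iff₂,
    Complex.ofReal_re, Multiset.insert_eq_cons, Multiset.mem_cons, Multiset.mem_singleton]
  rintro x (rfl | rfl | rfl | rfl)
  · exact div_pos hA (by positivity)
  · exact div_pos (neg_pos.2 hO) (by positivity)
  · exact div_pos hB (by positivity)
  · exact div_pos hB (by positivity)

theorem isNonhyperbolic_ptP15L (hC : 0 < C) (hg1 : 1 < g) (hl : 0 < l)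
    (h : 2 * C - (2 * C - 1) * l ^ 2 = 0 ∨ g * l ^ 2 - 4 * (g - 1) * C = 0 ∨
      2 * C - (4 * C - 1) * l ^ 2 = 0) :
    IsNonhyperbolic C g l (ptP15L C l) := by
  refine ⟨complexField_ptP15L hC hg1 hl, 0, ?_, Complex.zero_re⟩
  rw [eigenvalues_ptP15L_eq_div hC hg1 hl, Multiset.mem_map]
  refine ⟨0, ?_, Complex.ofReal_zero⟩
  rcases h with h | h | h <;> simp [h]

theorem isSaddle_ptP15L (hC : 0 < C) (hg1 : 1 < g) (hl : 0 < l)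
    (hA : 2 * C - (2 * C - 1) * l ^ 2 ≠ 0) (hO : g * l ^ 2 - 4 * (g - 1) * C ≠ 0)
    (hB : 2 * C - (4 * C - 1) * l ^ 2 ≠ 0)
    (hpos : 0 < 2 * C - (2 * C - 1) * l ^ 2 ∨ g * l ^ 2 - 4 * (g - 1) * C < 0)
    (hneg : 2 * C - (4 * C - 1) * l ^ 2 < 0 ∨ 0 < g * l ^ 2 - 4 * (g - 1) * C) :
    IsSaddle C g l (ptP15L C l) := by
  refine ⟨complexField_ptP15L hC hg1 hl, ?_⟩
  have hg : 0 < g - 1 := sub_pos.2 hg1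
  have hdA : 0 < C * l ^ 2 := by positivity
  have hdO : 0 < 2 * (g - 1) * C * l ^ 2 := by positivity
  have hdB : 0 < 2 * C * l ^ 2 := by positivity
  rw [eigenvalues_ptP15L_eq_div hC hg1 hl]
  refine ⟨?_, ?_, ?_⟩
  · simp only [Multiset.mem_map, forall_exists_index, and_imp, forall_apply_eq_imp_iff₂,
      Complex.ofReal_re, Multiset.insert_eq_cons, Multiset.mem_cons, Multiset.mem_singleton]
    rintro x (rfl | rfl | rfl | rfl)
    · exact div_ne_zero hA hdA.ne'
    · exact div_ne_zero (neg_ne_zero.2 hO) hdO.ne'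
    · exact div_ne_zero hB hdB.ne'
    · exact div_ne_zero hB hdB.ne'
  · rcases hpos with h | h
    · exact ⟨_, Multiset.mem_map_of_mem _ (Multiset.mem_cons_self _ _), div_pos h hdA⟩
    · exact ⟨_, Multiset.mem_map_of_mem _ (Multiset.mem_cons_of_mem (Multiset.mem_cons_self _ _)),
        div_pos (neg_pos.2 h) hdO⟩
  · rcases hneg with h | h
    · exact ⟨_, Multiset.mem_map_of_mem _ (Multiset.mem_cons_of_mem
        (Multiset.mem_cons_of_mem (Multiset.mem_cons_self _ _))), div_neg_of_neg_of_pos h hdB⟩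
    · exact ⟨_, Multiset.mem_map_of_mem _ (Multiset.mem_cons_of_mem (Multiset.mem_cons_self _ _)),
        div_neg_of_neg_of_pos (neg_neg_of_pos h) hdO⟩

/-- The identity that orders `lamA` and `lamO`: the sign of `3γ - 2 - 4C(γ - 1)` decides. -/
theorem lamA_lamO_identity (C g l : ℝ) :
    g * (2 * C - (2 * C - 1) * l ^ 2) + (2 * C - 1) * (g * l ^ 2 - 4 * (g - 1) * C) =
      2 * C * (3 * g - 2 - 4 * C * (g - 1)) := by
  ring

/-- The identity that orders `lamB` and `lamO`: the sign of `3γ - 2 - 8C(γ - 1)` decides. -/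
theorem lamB_lamO_identity (C g l : ℝ) :
    g * (2 * C - (4 * C - 1) * l ^ 2) + (4 * C - 1) * (g * l ^ 2 - 4 * (g - 1) * C) =
      2 * C * (3 * g - 2 - 8 * C * (g - 1)) := by
  ring

theorem four_mul_lt_of_le_one (hC1 : C ≤ 1) (hg1 : 1 < g) (hg2 : g < 2) :
    4 * C * (g - 1) < 3 * g - 2 := by
  nlinarith [mul_nonneg (sub_nonneg.2 hC1) (sub_pos.2 hg1).le]

theorem eight_mul_lt_of_le_half (hC1 : C ≤ 1 / 2) (hg1 : 1 < g) (hg2 : g < 2) :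
    8 * C * (g - 1) < 3 * g - 2 := by
  nlinarith [mul_nonneg (sub_nonneg.2 hC1) (sub_pos.2 hg1).le]

theorem pos_of_weighted_add_nonneg {a b x y c : ℝ} (h : a * x + b * y = c) (ha : 0 < a)
    (hb : 0 ≤ b) (hc : 0 ≤ c) (hx : x < 0) : 0 < y := by
  by_contra! hy
  linarith [mul_neg_of_pos_of_neg ha hx, mul_nonpos_of_nonneg_of_nonpos hb hy]

theorem neg_of_weighted_add_nonpos {a b x y c : ℝ} (h : a * x + b * y = c) (ha : 0 < a)
    (hb : 0 ≤ b) (hc : c ≤ 0) (hx : 0 < x) : y < 0 :=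
  neg_pos.1 (pos_of_weighted_add_nonneg (a := a) (b := b) (x := -x) (c := -c) (by linarith) ha hb
    (by linarith) (by linarith))

theorem SinkP15L.isSink (h : SinkP15L C g l) (hC : 0 < C) (hg1 : 1 < g) (hl : 0 < l) :
    IsSink C g l (ptP15L C l) := by
  have hg0 : 0 < g := by linarith
  have hA := lamA_lamO_identity C g l
  rcases h with ⟨c, c', -, h2, h3⟩ | ⟨c, -, h2, h3⟩ | ⟨c, h2, -, h3⟩
  · rw [lamA_lt_iff c hl] at h3
    have h4 := four_mul_lt_of_le_one c' hg1 h2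
    exact isSink_ptP15L hC hg1 hl h3 (pos_of_weighted_add_nonneg hA hg0 (by linarith)
      (mul_nonneg (by linarith) (by linarith)) h3)
  · rw [lamA_lt_iff (by linarith) hl] at h3
    rw [le_gam4_iff c] at h2
    exact isSink_ptP15L hC hg1 hl h3 (pos_of_weighted_add_nonneg hA hg0 (by linarith)
      (mul_nonneg (by linarith) (by linarith)) h3)
  · rw [lamO_lt_iff hg1 hl] at h3
    rw [gam4_lt_iff c] at h2
    rw [add_comm] at hA
    exact isSink_ptP15L hC hg1 hl (neg_of_weighted_add_nonpos hA (by linarith) hg0.le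
      (mul_nonpos_of_nonneg_of_nonpos (by linarith) (by linarith)) h3) h3

theorem SourceP15L.isSource (h : SourceP15L C g l) (hC : 0 < C) (hg1 : 1 < g) (hl : 0 < l) :
    IsSource C g l (ptP15L C l) := by
  have hg0 : 0 < g := by linarith
  have hB := lamB_lamO_identity C g l
  have hB' := hB
  rw [add_comm] at hB'
  rw [SourceP15L, lt_lamO_iff hg1 hl] at h
  rcases h with ⟨-, c', -, h2, -, h3⟩ | ⟨c, -, h2, -, h3⟩ | ⟨c, h2, -, -, h3⟩
  · rcases le_or_gt C (1 / 4) with c | c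
    · refine isSource_ptP15L hC hg1 hl ?_ h3
      have : 0 ≤ (1 - 4 * C) * l ^ 2 := mul_nonneg (by linarith) (sq_nonneg l)
      linarith
    · have h4 := eight_mul_lt_of_le_half c' hg1 h2
      exact isSource_ptP15L hC hg1 hl (pos_of_weighted_add_nonneg hB' (by linarith) hg0.le
        (mul_nonneg (by linarith) (by linarith)) h3) h3
  · rw [le_gam8_iff c] at h2
    exact isSource_ptP15L hC hg1 hl (pos_of_weighted_add_nonneg hB' (by linarith) hg0.le
      (mul_nonneg (by linarith) (by linarith)) h3) h3
  · rw [gam8_lt_iff c] at h2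
    rw [lt_lamB_iff (by linarith) hl] at h3
    exact isSource_ptP15L hC hg1 hl h3 (neg_of_weighted_add_nonpos hB hg0 (by linarith)
      (mul_nonpos_of_nonneg_of_nonpos (by linarith) (by linarith)) h3)

theorem NonhypP15L.isNonhyperbolic (h : NonhypP15L C g l) (hC : 0 < C) (hg1 : 1 < g)
    (hl : 0 < l) : IsNonhyperbolic C g l (ptP15L C l) := by
  have h' : (1 / 2 < C ∧ l = lamA C) ∨ l = lamO C g ∨ (1 / 4 < C ∧ l = lamB C) := by
    have h2 : 1 < C → 1 / 2 < C := fun h => by linarith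
    have h4 : 1 / 2 < C → 1 / 4 < C := fun h => by linarith
    rw [NonhypP15L] at h
    tauto
  refine isNonhyperbolic_ptP15L hC hg1 hl ?_
  rcases h' with ⟨c, h⟩ | h | ⟨c, h⟩
  · exact Or.inl (eq_lamA_imp c hl h)
  · exact Or.inr (Or.inl (eq_lamO_imp hg1 hl h))
  · exact Or.inr (Or.inr (eq_lamB_imp c hl h))

theorem SaddleP15L.isSaddle (h : SaddleP15L C g l) (hC : 0 < C) (hg1 : 1 < g) (hl : 0 < l) :
    IsSaddle C g l (ptP15L C l) := by
  have hg0 : 0 < g := by linarith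
  have hA := lamA_lamO_identity C g l
  have hB := lamB_lamO_identity C g l
  have hAB : 2 * C - (4 * C - 1) * l ^ 2 < 2 * C - (2 * C - 1) * l ^ 2 := by
    have : 0 < 2 * C * l ^ 2 := by positivity
    linarith
  -- the two combinations of signs that occur
  have s1 : 2 * C - (4 * C - 1) * l ^ 2 < 0 → g * l ^ 2 - 4 * (g - 1) * C < 0 →
      2 * C - (2 * C - 1) * l ^ 2 ≠ 0 → IsSaddle C g l (ptP15L C l) := fun h1 h2 h3 =>
    isSaddle_ptP15L hC hg1 hl h3 h2.ne h1.ne (Or.inr h2) (Or.inl h1)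
  have s2 : 0 < 2 * C - (2 * C - 1) * l ^ 2 → 0 < g * l ^ 2 - 4 * (g - 1) * C →
      2 * C - (4 * C - 1) * l ^ 2 ≠ 0 → IsSaddle C g l (ptP15L C l) := fun h1 h2 h3 =>
    isSaddle_ptP15L hC hg1 hl h1.ne' h2.ne' h3 (Or.inl h1) (Or.inr h2)
  rw [SaddleP15L, lt_lamO_iff hg1 hl, lamO_lt_iff hg1 hl] at h
  rcases h with ⟨c, c', -, h2, h3, h4⟩ | ⟨c, h2, -, h3, h4⟩ | ⟨c, -, h2, h3, h4⟩ |
    ⟨-, c, -, -, h3⟩ | ⟨c, -, -, -, h3, h4⟩ | ⟨c, -, -, h3, h4⟩ | ⟨c, c', -, h2, h3⟩ |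
    ⟨c, -, h2, -, h3, h4⟩ | ⟨c, -, -, h2, h3, h4⟩ | ⟨c, h2, -, h3, h4⟩ | ⟨c, -, h2, h3, h4⟩ |
    ⟨c, h2, -, h3, h4⟩
  · rw [lamB_lt_iff (by linarith) hl] at h3
    have h5 := four_mul_lt_of_le_one c' hg1 h2
    rw [add_comm] at hA
    exact s1 h3 h4 (pos_of_weighted_add_nonneg hA (by linarith) hg0.le
      (mul_nonneg (by linarith) (by linarith)) h4).ne'
  · rw [lamB_lt_iff (by linarith) hl] at h3
    rw [lt_lamA_iff (by linarith) hl] at h4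
    rw [gam4_lt_iff c] at h2
    exact s1 h3 (neg_of_weighted_add_nonpos hA hg0 (by linarith)
      (mul_nonpos_of_nonneg_of_nonpos (by linarith) (by linarith)) h4) h4.ne'
  · rw [lamB_lt_iff (by linarith) hl] at h3
    rw [le_gam4_iff c] at h2
    rw [add_comm] at hA
    exact s1 h3 h4 (pos_of_weighted_add_nonneg hA (by linarith) hg0.le
      (mul_nonneg (by linarith) (by linarith)) h4).ne'
  · have h5 : 0 < 2 * C - (4 * C - 1) * l ^ 2 := by
      have : 0 ≤ (1 - 4 * C) * l ^ 2 := mul_nonneg (by linarith) (sq_nonneg l)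
      linarith
    exact s2 (h5.trans hAB) h3 h5.ne'
  · rw [lt_lamB_iff c hl] at h4
    exact s2 (h4.trans hAB) h3 h4.ne'
  · rw [lt_lamB_iff (by linarith) hl] at h4
    exact s2 (h4.trans hAB) h3 h4.ne'
  · rw [lamB_lt_iff c hl] at h3
    have h5 := eight_mul_lt_of_le_half c' hg1 h2
    have h6 : 0 < 2 * C - (2 * C - 1) * l ^ 2 := by
      have : 0 ≤ (1 - 2 * C) * l ^ 2 := mul_nonneg (by linarith) (sq_nonneg l)
      linarith
    exact s2 h6 (pos_of_weighted_add_nonneg hB hg0 (by linarith)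
      (mul_nonneg (by linarith) (by linarith)) h3) h3.ne
  · rw [lt_lamA_iff c hl] at h4
    rw [gam8_lt_iff c] at h2
    rw [add_comm] at hB
    exact s2 h4 h3 (neg_of_weighted_add_nonpos hB (by linarith) hg0.le
      (mul_nonpos_of_nonneg_of_nonpos (by linarith) (by linarith)) h3).ne
  · rw [lamB_lt_iff (by linarith) hl] at h3
    rw [lt_lamA_iff c hl] at h4
    rw [le_gam8_iff c] at h2
    exact s2 h4 (pos_of_weighted_add_nonneg hB hg0 (by linarith)
      (mul_nonneg (by linarith) (by linarith)) h3) h3.ne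
  · rw [lt_lamA_iff (by linarith) hl] at h4
    rw [gam8_lt_iff (by linarith)] at h2
    rw [add_comm] at hB
    exact s2 h4 h3 (neg_of_weighted_add_nonpos hB (by linarith) hg0.le
      (mul_nonpos_of_nonneg_of_nonpos (by linarith) (by linarith)) h3).ne
  · rw [lamB_lt_iff (by linarith) hl] at h3
    rw [lt_lamA_iff (by linarith) hl] at h4
    rw [le_gam8_iff (by linarith)] at h2
    exact s2 h4 (pos_of_weighted_add_nonneg hB hg0 (by linarith)
      (mul_nonneg (by linarith) (by linarith)) h3) h3.ne
  · rw [lamA_lt_iff (by linarith) hl] at h3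
    exact s1 (hAB.trans h3) h4 h3.ne

end P15LStability

/-! ### Enumeration of the real equilibria -/

section Enumeration

variable {C g l : ℝ}

theorem complexSqrt_ofReal {x : ℝ} (hx : 0 ≤ x) : Complex.sqrt (x : ℂ) = ((√x : ℝ) : ℂ) := by
  rw [Complex.sqrt_of_nonneg (by exact_mod_cast hx), Complex.ofReal_re]

/-- Equilibria without scalar field. -/
theorem eq_of_realField_eq_zero_of_w_eq_zero {S K u : ℝ} (hC : 0 < C) (hg1 : 1 < g) (hu : 0 ≤ u)
    (h : realField C g l ![S, K, u, 0] = 0) :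
    ![S, K, u, 0] = ptN1 ∨ (∃ s : ℝ, C * s ^ 2 ≤ 1 ∧ ![S, K, u, 0] = curveL C s) ∨
      ![S, K, u, 0] = ptP13 C g ∨ ![S, K, u, 0] = ptP14 C g := by
  have hg : g - 1 ≠ 0 := (sub_pos.2 hg1).ne'
  have hh : 3 * g - 2 ≠ 0 := by linarith
  have h0 := congrFun h 0
  have h1 := congrFun h 1
  have h2 := congrFun h 2
  simp only [realField, reducedField, Matrix.cons_val, Pi.zero_apply] at h0 h1 h2
  field_simp at h0
  have hK : K = 0 ∨ 2 * C * S ^ 2 + K + 2 * u ^ 2 - 1 = 0 := by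
    rcases mul_eq_zero.1 h1 with h1 | h1
    · left; linarith
    · exact Or.inr h1
  have hU : u = 0 ∨ 2 * C * S ^ 2 + K + 2 * u ^ 2 - 2 = 0 := by
    rw [zero_pow two_ne_zero, mul_zero, zero_div, sub_zero] at h2
    exact mul_eq_zero.1 h2
  rcases hK with rfl | hK <;> rcases hU with rfl | hU
  · have hfac : (C * S ^ 2 - 1) * (4 * (g - 1) * C * S + (3 * g - 2)) = 0 := by
      linear_combination h0
    rcases mul_eq_zero.1 hfac with hS | hS
    · refine Or.inr (Or.inl ⟨S, by linarith, ?_⟩)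
      have : 1 - C * S ^ 2 = 0 := by linarith
      rw [curveL, this, Real.sqrt_zero]
    · refine Or.inr (Or.inr (Or.inl ?_))
      have : S = (2 - 3 * g) / (4 * (g - 1) * C) := by
        rw [eq_div_iff (by positivity)]
        linarith
      rw [ptP13, ← this]
  · refine Or.inr (Or.inl ⟨S, by nlinarith [sq_nonneg u], ?_⟩)
    have : 1 - C * S ^ 2 = u ^ 2 := by linarith
    rw [curveL, this, Real.sqrt_sq hu]
  · have hK' : K = 1 - 2 * C * S ^ 2 := by linarith
    subst hK'
    have hfac : C * (S * ((3 * g - 2) * S + 2 * (g - 1))) = 0 := by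
      linear_combination -h0
    rcases mul_eq_zero.1 ((mul_eq_zero.1 hfac).resolve_left hC.ne') with rfl | hS
    · left
      simp [ptN1]
    · refine Or.inr (Or.inr (Or.inr ?_))
      have hS' : S = -(2 * (g - 1)) / (3 * g - 2) := by
        rw [eq_div_iff hh]
        linarith
      have hK : 1 - 2 * C * S ^ 2 = 1 - 8 * (g - 1) ^ 2 * C / (2 - 3 * g) ^ 2 := by
        have h4 : (2 - 3 * g) ^ 2 = (3 * g - 2) ^ 2 := by ring
        rw [hS', div_pow, h4]
        ring
      rw [ptP14, ← hS', ← hK]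
  · linarith

/-- Equilibria with scalar field. For `K ≠ 0` the equation `u' = 0` forces `u < 0`. For `K = 0` the
equations reduce to a linear and a quadratic one in `Σ` and `v = √2 u`. -/
theorem eq_of_realField_eq_zero_of_w_pos {S K u w : ℝ} (hC : 0 < C) (hg1 : 1 < g) (hl : 0 < l)
    (hu : 0 ≤ u) (hw : 0 < w) (h : realField C g l ![S, K, u, w] = 0) :
    toComplex ![S, K, u, w] = ptP13L C g l ∨ toComplex ![S, K, u, w] = ptP15L C l := by
  have hg : 0 < g - 1 := sub_pos.2 hg1
  have hh : 0 < 3 * g - 2 := by linarith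
  have hg0 : 0 < g := by linarith
  have hD := dd_pos l hC hg1
  have hr : √2 ^ 2 = 2 := Real.sq_sqrt (by norm_num)
  have hr0 : 0 < √2 := Real.sqrt_pos.2 two_pos
  have h0 := congrFun h 0
  have h1 := congrFun h 1
  have h2 := congrFun h 2
  have h3 := congrFun h 3
  simp only [realField, reducedField, Matrix.cons_val, Pi.zero_apply] at h0 h1 h2 h3
  replace h3 := (mul_eq_zero.1 h3).resolve_left hw.ne'
  obtain ⟨v, hv⟩ : ∃ v, v = √2 * u := ⟨_, rfl⟩
  have hv2 : 2 * u ^ 2 = v ^ 2 := by rw [hv, mul_pow, hr]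
  have hv0 : 0 ≤ v := by rw [hv]; positivity
  have hW : 2 * w ^ 2 = l * v * (2 * C * S ^ 2 + K + v ^ 2 - 2) := by
    have h2' : l * (√2 * (u * (2 * C * S ^ 2 + K + 2 * u ^ 2 - 2) - √2 * w ^ 2 / l)) = 0 := by
      rw [h2, mul_zero, mul_zero]
    have h2'' : l * (√2 * (u * (2 * C * S ^ 2 + K + 2 * u ^ 2 - 2) - √2 * w ^ 2 / l)) =
        l * (√2 * u) * (2 * C * S ^ 2 + K + 2 * u ^ 2 - 2) - √2 ^ 2 * w ^ 2 := by
      field_simp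
    rw [h2'', hr, ← hv, hv2] at h2'
    linarith
  have hW0 : 0 < l * v * (2 * C * S ^ 2 + K + v ^ 2 - 2) := by rw [← hW]; positivity
  have hm : 0 < 2 * C * S ^ 2 + K + v ^ 2 - 2 :=
    pos_of_mul_pos_right hW0 (mul_nonneg hl.le hv0)
  have hK : K = 0 := by
    rcases mul_eq_zero.1 h1 with h1 | h1 <;> linarith
  subst hK
  have hE : 2 * C * S ^ 2 + S + v ^ 2 = v / l := by
    rw [hv2, ← hv] at h3
    linarith
  field_simp at h0 hE
  have hm' : v * (2 * C * S ^ 2 + v ^ 2 - 2) ≠ 0 := fun h' => by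
    have : l * v * (2 * C * S ^ 2 + 0 + v ^ 2 - 2) = 0 := by linear_combination l * h'
    linarith
  have hm'' : 2 * C * S ^ 2 + v ^ 2 - 2 ≠ 0 := fun h' => hm' (by rw [h', mul_zero])
  have hlin : g * l * v = 3 * g - 2 + 4 * (g - 1) * C * S := by
    have : (2 * C * S ^ 2 + v ^ 2 - 2) * (g * l * v - (3 * g - 2 + 4 * (g - 1) * C * S)) = 0 := by
      linear_combination -2 * h0 - g * hW + (3 * g - 2 + 4 * (g - 1) * C * S) * hv2
    linarith [(mul_eq_zero.1 this).resolve_left hm'']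
  have hfac : (2 * C * S + 1) * (dd C g l * S + 2 * (g - 1) * (3 * g - 2)) = 0 := by
    rw [dd]
    linear_combination g ^ 2 * l * hE + (g - (3 * g - 2 + 4 * (g - 1) * C * S) - g * l * v) * hlin
  have hu' : u = v / √2 := by rw [hv]; field_simp
  rcases mul_eq_zero.1 hfac with hS | hS
  · right
    have hS' : S = -(1 / (2 * C)) := by
      field_simp
      linarith
    have hv' : v = 1 / l := by
      have : g * (l * v) = g * 1 := by linear_combination hlin + 2 * (g - 1) * hS
      rw [eq_div_iff hl.ne', mul_comm]
      exact mul_left_cancel₀ hg0.ne' this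
    have hq : w ^ 2 = (l ^ 2 + (2 - 4 * l ^ 2) * C) / (2 * l * √C) ^ 2 := by
      have : w ^ 2 = l * v * (2 * C * S ^ 2 + 0 + v ^ 2 - 2) / 2 := by linarith
      rw [this, hS', hv', mul_pow, Real.sq_sqrt hC.le]
      field_simp
      ring
    have hq0 : 0 ≤ l ^ 2 + (2 - 4 * l ^ 2) * C := by
      have hden : 0 < (2 * l * √C) ^ 2 := by positivity
      rw [eq_div_iff hden.ne'] at hq
      rw [← hq]
      positivity
    have hw' : w = √(l ^ 2 + (2 - 4 * l ^ 2) * C) / (2 * l * √C) := by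
      rw [← sq_eq_sq₀ hw.le (by positivity), hq, div_pow, Real.sq_sqrt hq0]
    rw [toComplex_cons, ptP15L, complexSqrt_ofReal hq0, ← Complex.ofReal_div, ← hw', ← hS', hu',
      hv', div_div, mul_comm l, Complex.ofReal_zero]
  · left
    have hS' : S = -(2 * (g - 1) * (3 * g - 2)) / dd C g l := by
      rw [eq_div_iff hD.ne']
      linarith
    have hv' : v = g * (3 * g - 2) * l / dd C g l := by
      have : g * l * (v * dd C g l) = g * l * (g * (3 * g - 2) * l) := by
        have hd : dd C g l = 8 * C * (g - 1) ^ 2 + g ^ 2 * l ^ 2 := rfl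
        linear_combination dd C g l * hlin + 4 * (g - 1) * C * hS + (3 * g - 2) * hd
      rw [eq_div_iff hD.ne']
      exact mul_left_cancel₀ (mul_pos hg0 hl).ne' this
    have hq : w ^ 2 = g * (3 * g - 2) * l ^ 2 * qq C g l / (√2 * dd C g l) ^ 2 := by
      have : w ^ 2 = l * v * (2 * C * S ^ 2 + 0 + v ^ 2 - 2) / 2 := by linarith
      have hd : dd C g l = 8 * C * (g - 1) ^ 2 + g ^ 2 * l ^ 2 := rfl
      rw [this, hS', hv', mul_pow √2, hr, qq_eq]
      generalize dd C g l = D at hD hd ⊢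
      field_simp
      rw [hd]
      ring
    have hq0 : 0 ≤ qq C g l := by
      have hden : 0 < (√2 * dd C g l) ^ 2 := by positivity
      rw [eq_div_iff hden.ne'] at hq
      have hc : 0 < g * (3 * g - 2) * l ^ 2 := by positivity
      refine nonneg_of_mul_nonneg_right (a := g * (3 * g - 2) * l ^ 2) ?_ hc
      rw [← hq]
      positivity
    have hw' : w = √g * √(3 * g - 2) * l * √(qq C g l) / (√2 * dd C g l) := by
      rw [← sq_eq_sq₀ hw.le (by positivity), hq, div_pow (√g * √(3 * g - 2) * l * √(qq C g l)),
        mul_pow _ √(qq C g l), mul_pow _ l, mul_pow √g, Real.sq_sqrt hq0, Real.sq_sqrt hg0.le,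
        Real.sq_sqrt hh.le]
    rw [toComplex_cons, ptP13L, complexSqrt_ofReal hq0, ← Complex.ofReal_mul,
      ← Complex.ofReal_div, ← hw', ← hS', hu', hv', div_div, mul_comm (dd C g l),
      Complex.ofReal_zero]

theorem eq_of_realField_eq_zero (hC : 0 < C) (hg1 : 1 < g) (hl : 0 < l) (p : Fin 4 → ℝ)
    (hu : 0 ≤ p 2) (hw : 0 ≤ p 3) (h : realField C g l p = 0) :
    p = ptN1 ∨ (∃ s : ℝ, C * s ^ 2 ≤ 1 ∧ p = curveL C s) ∨ p = ptP13 C g ∨ p = ptP14 C g ∨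
      toComplex p = ptP13L C g l ∨ toComplex p = ptP14L C g l ∨ toComplex p = ptP15L C l := by
  have hp : p = ![p 0, p 1, p 2, p 3] := by
    ext i
    fin_cases i <;> rfl
  generalize p 0 = S at hp
  generalize p 1 = K at hp
  generalize p 2 = u at hp hu
  generalize p 3 = w at hp hw
  subst hp
  rcases hw.eq_or_lt with rfl | hw
  · have := eq_of_realField_eq_zero_of_w_eq_zero hC hg1 hu h
    exact this.imp_right (Or.imp_right (Or.imp_right Or.inl))
  · have := eq_of_realField_eq_zero_of_w_pos hC hg1 hl hu hw h
    exact Or.inr (Or.inr (Or.inr (Or.inr (this.imp_right Or.inr))))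

end Enumeration

end AetherScalar

theorem mainTheorem10 (C g l : ℝ) (hC : 0 < C) (hg1 : 1 < g) (hg2 : g ≤ 2) (hl : 0 < l) :
    -- enumeration of the real equilibrium points with K, u, w ≥ 0
    (∀ p : Fin 4 → ℝ, 0 ≤ p 1 → 0 ≤ p 2 → 0 ≤ p 3 → realField C g l p = 0 →
      p = ptN1 ∨ (∃ s : ℝ, C * s ^ 2 ≤ 1 ∧ p = curveL C s) ∨ p = ptP13 C g ∨ p = ptP14 C g ∨
      toComplex p = ptP13L C g l ∨ toComplex p = ptP14L C g l ∨ toComplex p = ptP15L C l) ∧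
    -- N₁
    (realField C g l ptN1 = 0 ∧ omegaT C g (toComplex ptN1) = 0 ∧
      eigenvalues C g l (toComplex ptN1) = {-1, -1, 1, 2} ∧
      IsSaddle C g l (toComplex ptN1)) ∧
    -- the curve L
    (curveL C (-(1 / √C)) = ptP11 C ∧ curveL C (1 / √C) = ptP12 C) ∧
    (∀ s : ℝ, C * s ^ 2 ≤ 1 →
      realField C g l (curveL C s) = 0 ∧ omegaT C g (toComplex (curveL C s)) = 0 ∧
      eigenvalues C g l (toComplex (curveL C s)) =
        Multiset.map Complex.ofReal
          {0, (3 * g - 2) * s / (g - 1) + 4, -(√(2 - 2 * C * s ^ 2) / l) + s + 2, 2} ∧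
      (C * s ^ 2 < 1 →
        HasDerivAt (curveL C) (velocityL C s) s ∧
        tangentL C s = √(1 - C * s ^ 2) • velocityL C s) ∧
      (s ≠ 0 →
        (jacobian (realField C g l) (curveL C s)).mulVec (nullVectorL C s) = 0 ∧
        tangentL C s = (-(C * s)) • nullVectorL C s) ∧
      IsTangentNullDirection C g l (curveL C s) (tangentL C s) ∧
      (IsNormallyHyperbolicAt C g l (curveL C s) (tangentL C s) ↔
        (3 * g - 2) * s / (g - 1) + 4 ≠ 0 ∧ -(√(2 - 2 * C * s ^ 2) / l) + s + 2 ≠ 0)) ∧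
    (∀ s : ℝ,
      (SourceL C s g l → C * s ^ 2 ≤ 1 ∧ IsSourceOnCurve C g l (curveL C s) (tangentL C s)) ∧
      (SaddleL C s g l → C * s ^ 2 ≤ 1 ∧ IsSaddleOnCurve C g l (curveL C s) (tangentL C s)) ∧
      (NonhypL C s g l →
        C * s ^ 2 ≤ 1 ∧ IsNonhyperbolicOnCurve C g l (curveL C s) (tangentL C s))) ∧
    -- P₁₃
    (realField C g l (ptP13 C g) = 0 ∧
      omegaT C g (toComplex (ptP13 C g)) =
        ((1 / (g - 1) - (2 - 3 * g) ^ 2 / (16 * (g - 1) ^ 3 * C) : ℝ) : ℂ) ∧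
      eigenvalues C g l (toComplex (ptP13 C g)) =
        Multiset.map Complex.ofReal
          {g * (3 * g - 2) / (8 * (g - 1) ^ 2 * C),
            (2 - 3 * g) ^ 2 / (8 * (g - 1) ^ 2 * C) - 2,
            (2 - 3 * g) ^ 2 / (8 * (g - 1) ^ 2 * C) - 2,
            (2 - 3 * g) ^ 2 / (4 * (g - 1) ^ 2 * C) - 2}) ∧
    -- P₁₄
    (realField C g l (ptP14 C g) = 0 ∧
      omegaT C g (toComplex (ptP14 C g)) = ((4 * (g - 1) * C / (2 - 3 * g) ^ 2 : ℝ) : ℂ) ∧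
      eigenvalues C g l (toComplex (ptP14 C g)) =
        {-1, ((g / (3 * g - 2) : ℝ) : ℂ),
          -(1 / 2) - Complex.sqrt ((64 * (g - 1) ^ 2 * C - 7 * (2 - 3 * g) ^ 2 : ℝ) : ℂ) /
            ((2 * (3 * g - 2) : ℝ) : ℂ),
          -(1 / 2) + Complex.sqrt ((64 * (g - 1) ^ 2 * C - 7 * (2 - 3 * g) ^ 2 : ℝ) : ℂ) /
            ((2 * (3 * g - 2) : ℝ) : ℂ)}) ∧
    -- P₁₃(λ)
    (complexField C g l (ptP13L C g l) = 0 ∧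
      omegaT C g (ptP13L C g l) =
        (((g * l ^ 2 - 4 * (g - 1) * C) * qq C g l / dd C g l ^ 2 : ℝ) : ℂ) ∧
      Tendsto (fun t : ℝ => ptP13L C g t) (𝓝[>] 0) (𝓝 (toComplex (ptP13 C g))) ∧
      eigenvalues C g l (ptP13L C g l) =
        {((-2 + (2 - 3 * g) ^ 2 / dd C g l : ℝ) : ℂ),
          ((-2 + 2 * (2 - 3 * g) ^ 2 / dd C g l : ℝ) : ℂ),
          -((((g - 1) * C * dd C g l * (-qq C g l) : ℝ) : ℂ) +
              Complex.sqrt ((radicandP13L C g l : ℝ) : ℂ)) /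
            ((2 * (g - 1) * C * dd C g l ^ 2 : ℝ) : ℂ),
          (-(((g - 1) * C * dd C g l * (-qq C g l) : ℝ) : ℂ) +
              Complex.sqrt ((radicandP13L C g l : ℝ) : ℂ)) /
            ((2 * (g - 1) * C * dd C g l ^ 2 : ℝ) : ℂ)} ∧
      (SinkP13L C g l → IsSink C g l (ptP13L C g l)) ∧
      (SourceP13L C g l → IsSource C g l (ptP13L C g l)) ∧
      (NonhypP13L C g l → IsNonhyperbolic C g l (ptP13L C g l)) ∧
      (SaddleP13L C g l → IsSaddle C g l (ptP13L C g l))) ∧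
    -- P₁₄(λ)
    (complexField C g l (ptP14L C g l) = 0 ∧
      omegaT C g (ptP14L C g l) =
        (((4 * (g - 1) * C - g * l ^ 2) / (2 - 3 * g) ^ 2 : ℝ) : ℂ) ∧
      Tendsto (fun t : ℝ => ptP14L C g t) (𝓝[>] 0) (𝓝 (toComplex (ptP14 C g)))) ∧
    -- P₁₅(λ)
    (complexField C g l (ptP15L C l) = 0 ∧
      omegaT C g (ptP15L C l) = 0 ∧
      eigenvalues C g l (ptP15L C l) =
        Multiset.map Complex.ofReal
          {1 / C + 2 / l ^ 2 - 2, g / (2 * C - 2 * g * C) + 2 / l ^ 2,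
            1 / (2 * C) + 1 / l ^ 2 - 2, 1 / (2 * C) + 1 / l ^ 2 - 2} ∧
      (SinkP15L C g l → IsSink C g l (ptP15L C l)) ∧
      (SourceP15L C g l → IsSource C g l (ptP15L C l)) ∧
      (NonhypP15L C g l → IsNonhyperbolic C g l (ptP15L C l)) ∧
      (SaddleP15L C g l → IsSaddle C g l (ptP15L C l))) := by
  refine ⟨fun p _ hu hw h => eq_of_realField_eq_zero hC hg1 hl p hu hw h,
    ⟨realField_ptN1 C g l, omegaT_ptN1 C g, eigenvalues_ptN1 C g l, isSaddle_ptN1 C g l⟩,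
    ⟨?_, ?_⟩, fun s hs => ?_, fun s => ?_,
    ⟨realField_ptP13 l hC hg1, omegaT_ptP13 hC hg1, eigenvalues_ptP13 l hC hg1⟩,
    ⟨realField_ptP14 l hC hg1, omegaT_ptP14 hg1, eigenvalues_ptP14 l hC hg1⟩,
    ⟨complexField_ptP13L hC hg1 hl, omegaT_ptP13L hC hg1, tendsto_ptP13L hC hg1,
      eigenvalues_ptP13L hC hg1 hl, fun h => h.isSink hC hg1 hl, fun h => h.isSource hC hg1 hl,
      fun h => h.isNonhyperbolic hC hg1 hl, fun h => h.isSaddle hC hg1 hl⟩,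
    ⟨complexField_ptP14L hC hg1 hl, omegaT_ptP14L hg1, tendsto_ptP14L hg1⟩,
    ⟨complexField_ptP15L hC hg1 hl, omegaT_ptP15L g hC hl, eigenvalues_ptP15L hC hg1 hl,
      fun h => h.isSink hC hg1 hl, fun h => h.isSource hC hg1 hl,
      fun h => h.isNonhyperbolic hC hg1 hl, fun h => h.isSaddle hC hg1 hl⟩⟩
  · rw [curveL, ptP11, neg_sq, mul_inv_sqrt_sq hC, sub_self, Real.sqrt_zero]
  · rw [curveL, ptP12, mul_inv_sqrt_sq hC, sub_self, Real.sqrt_zero]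
  · exact ⟨realField_curveL g l hs, omegaT_curveL g hs, eigenvalues_curveL hC hg1 hl hs,
      fun h => ⟨hasDerivAt_curveL h, tangentL_eq_smul_velocityL h⟩,
      fun h => ⟨jacobian_mulVec_nullVectorL g l hC hg1 hs h, tangentL_eq_smul_nullVectorL hC h⟩,
      isTangentNullDirection_tangentL g l hC hg1 hs, isNormallyHyperbolicAt_curveL_iff hC hg1 hl hs⟩
  · exact ⟨fun h => h.isSourceOnCurve hC hg1 hl, fun h => h.isSaddleOnCurve hC hg1 hl,
      fun h => h.isNonhyperbolicOnCurve hC hg1 hl⟩
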